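/- **Setting.** Fix an infinite set of indices and an infinite set of variables. *λ-side.* Implicational types over a set $P$ of atoms are built with $\multimap$. A $\lambda$-signature $\Sigma=(P,C,\mathfrak T)$ assigns an implicational type $\mathfrak T(c)$ to every constant $c\in C$ (finiteness of $P$, $C$ and of alphabets is not needed). Judgements $\Gamma\vdash t:A$ ($\Gamma$ a finite set of assumptions $x:B$ with distinct variables) are derived from the axioms $\vdash c:\mathfrak T(c)$ by the rules of linear $\lambda$-calculus: $x:A\vdash x:A$; from $\Gamma\vdash t:A\multimap B$ and $\Gamma'\vdash s:A$ infer $\Gamma,\Gamma'\vdash (ts):B$; from $\Gamma,x:A\vdash t:B$ infer $\Gamma\vdash\lambda x.t:A\multimap B$. The string signature $Str_{\lambda,T}$ over an alphabet $T$ has one atom $O$, constants $T$, and $\mathfrak T(c)=O\multimap O$. A string ACG $G=(\Sigma,T,\phi,S)$ consists of a $\lambda$-signature $\Sigma$, a lexicon $\phi:\Sigma\to Str_{\lambda,T}$ (a $\multimap$-homomorphism on types, and terms $\phi(c)$ with $\vdash\phi(c):\phi(\mathfrak T(c))$ derivable in $Str_{\lambda,T}$; extended to terms and judgements in the obvious way),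 and an atom $S$ with $\phi(S)=O\multimap O$. *Tensor side.* Tensor terms over $T$ are products of $[w]_i^j$ and $[w]$ ($w\in T^*$; no index occurring twice as an upper or twice as a lower one), modulo the congruence generated by associativity and commutativity of the product, $[u]_i^j[v]_j^k\equiv[uv]_i^k$, $[u]_i^i\equiv[u]$ and cyclic rotation of $w$ in $[w]$; write $\delta_{i_1\dots i_n}^{j_1\dots j_n}=[\epsilon]_{i_1}^{j_1}\cdots[\epsilon]_{i_n}^{j_n}$. Tensor type symbols over a set $P$ of atoms $p$ with valencies $v(p)\in\mathbb N^2$ are formulas built from literals $p,\overline p$ with $\otimes,\wp$, where $v(\overline p)$ is $v(p)$ swapped and $v(A\otimes B)=v(A\wp B)=v(A)+v(B)$. A tensor type $A^I_J$ is a symbol $A$ with sequences $I$, $J$ of pairwise distinct upper and lower indices of lengths given by $v(A)$; for $\otimes$ and $\wp$ the sequences are concatenated. Duality is $\overline{p^I_J}=\overline p^{\,\overline J}_{\,\overline I}$ ($\overline I$ is $I$ reversed), $\overline{A\otimes B}=\overline B\wp\overline A$, $\overline{A\wp B}=\overline B\otimes\overline A$. A tensor typing judgement $t\vdash\Gamma$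 has a term $t$ and a finite set $\Gamma$ of types without common indices, such that the free upper (lower) indices of $t$ are the lower (upper) indices of $\Gamma$; it is taken up to congruence of terms and renaming of free indices. A tensor signature is given by $P$, $v$, $T$ and a set of judgements (axioms); derivability in it is generated, besides the axioms, by $\delta^{I'\overline J}_{\overline I J'}\vdash\overline p^I_J,p_{I'}^{J'}$; from $t\vdash\Gamma,A$ and $s\vdash\overline A,\Theta$ infer $ts\vdash\Gamma,\Theta$; from $t\vdash\Gamma,A,B$ infer $t\vdash\Gamma,A\wp B$; from $t\vdash\Gamma,A$ and $s\vdash B,\Theta$ infer $ts\vdash\Gamma,A\otimes B,\Theta$ (all judgements well defined). *Translation.* Implicational types are read as tensor type symbols by $A\multimap B=B\wp\overline A$. A judgement $\pi=(t\vdash\Gamma)$ is polarized if one element of $\Gamma$ has an implicational symbol and all the others have duals of implicational symbols. Given valencies of the atoms and, for each axiom $\vdash c:A$ of a $\lambda$-signature, a tensor judgement $\widetilde c\vdash A^I_J$, the tensor translation of $x_1:A_1,\dots,x_n:A_n\vdash t:A$ is a tensor judgement with types $\overline{A_1},\dots,\overline{A_n},A$ (each variable $x_k$ thus corresponds to one of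 these type occurrences), defined by induction on a derivation: $x:A\vdash x:A$ goes to $\delta_{\overline IJ'}^{I'\overline J}\vdash A^{J'}_{I'},\overline A^I_J$; an axiom goes to its assigned judgement; $\lambda$-abstraction of $x:A$ joins $B$ and the type $\overline A$ of $x$ into $B\wp\overline A$, the tensor term being unchanged; application splits $B\wp\overline A$ into $B,\overline A$ and cuts $\overline A$ with $A$. The string signature is translated with $v(O)=(1,0)$ and $\vdash c:O\multimap O$ going to $[c]_i^j\vdash O^i\wp\overline O_j$; call the resulting tensor signature $Str_{\otimes,T}$. For the ACG $G$ put $v(p)=v(\phi(p))$, extend $\phi$ to tensor types over $P$ as a homomorphism for $\otimes,\wp$ and duality that keeps the indices, and translate an axiom $\vdash c:A$ of $\Sigma$ to $e\vdash A^I_J$, where $e\vdash\phi(A)^I_J$ is the translation of $\vdash\phi(c):\phi(A)$ in $Str_{\otimes,T}$. Let $\widetilde\Sigma$ be the tensor signature over $P$ and $T$ with these axioms. **Theorem.** Let $G=(\Sigma,T,\phi,S)$ be a string ACG and let $\pi=(t\vdash\Gamma)$ be a polarized tensor typing judgement over $P$ and $T$. Then tensor translation from $\Sigma$ to $\widetilde\Sigma$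 is an embedding on the string level, in the following sense. 1. $\pi$ is derivable in $\widetilde\Sigma$ if and only if there is a $\lambda$-typing judgement $\sigma$ derivable in $\Sigma$ such that $\sigma$ translates to $\pi$ and its string level image $\phi(\sigma)$ translates in $Str_{\otimes,T}$ to $t\vdash\phi(\Gamma)$ (each variable corresponding in both translations to the same element of $\Gamma$, up to $\phi$). 2. If $\lambda$-typing judgements $\sigma_1$, $\sigma_2$ derivable in $\Sigma$ both translate to $\pi$, then they have the same type to the right of the turnstile, there is a renaming of variables that takes the context of $\sigma_1$ to that of $\sigma_2$ so that corresponding variables have the same type and correspond to the same element of $\Gamma$, and after this renaming the terms of $\phi(\sigma_1)$ and $\phi(\sigma_2)$ are $\beta\eta$-equivalent. -/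

import Mathlib

namespace StringACGTensor

/-! ## Linear lambda-calculus -/

/-- Linear implicational types over a set `P` of atomic types. -/
inductive ImpType (P : Type*) where
  | atom (p : P) : ImpType P
  | imp (A B : ImpType P) : ImpType P

/-- Lambda-terms over variables `X` and constants `C`, modulo renaming of bound variables: free
variables are named, bound variables are de Bruijn indices (locally nameless representation). -/
inductive LamTerm (X C : Type*) where
  | bvar (n : ℕ) : LamTerm X C
  | fvar (x : X) : LamTerm X C
  | con (c : C) : LamTerm X C
  | app (t s : LamTerm X C) : LamTerm X C
  | abs (t : LamTerm X C) : LamTerm X C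

namespace LamTerm

variable {X C C' : Type*}

/-- All de Bruijn indices that point outside of the term are `< k`; for `k = 0` the term is a
proper lambda-term. -/
def ClosedAt : ℕ → LamTerm X C → Prop
  | k, bvar n => n < k
  | _, fvar _ => True
  | _, con _ => True
  | k, app t s => ClosedAt k t ∧ ClosedAt k s
  | k, abs t => ClosedAt (k + 1) t

/-- Replace the bound variable `k` by the (proper) term `s`. -/
def openAt (s : LamTerm X C) : ℕ → LamTerm X C → LamTerm X C
  | k, bvar n => if n = k then s else bvar n
  | _, fvar x => fvar x
  | _, con c => con c
  | k, app t u => app (openAt s k t) (openAt s k u)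
  | k, abs t => abs (openAt s (k + 1) t)

/-- Replace the free variable `x` by the bound variable `k`. -/
def closeAt [DecidableEq X] (x : X) : ℕ → LamTerm X C → LamTerm X C
  | _, bvar n => bvar n
  | k, fvar y => if y = x then bvar k else fvar y
  | _, con c => con c
  | k, app t u => app (closeAt x k t) (closeAt x k u)
  | k, abs t => abs (closeAt x (k + 1) t)

/-- The abstraction `λ x . t`. -/
def lam [DecidableEq X] (x : X) (t : LamTerm X C) : LamTerm X C := abs (closeAt x 0 t)

/-- Renaming of the free variables. -/
def rename (r : X → X) : LamTerm X C → LamTerm X C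
  | bvar n => bvar n
  | fvar x => fvar (r x)
  | con c => con c
  | app t s => app (rename r t) (rename r s)
  | abs t => abs (rename r t)

/-- The extension of a map from constants to terms to a map from terms to terms. -/
def mapCon (g : C → LamTerm X C') : LamTerm X C → LamTerm X C'
  | bvar n => bvar n
  | fvar x => fvar x
  | con c => g c
  | app t s => app (mapCon g t) (mapCon g s)
  | abs t => abs (mapCon g t)

/-- Beta-eta-equivalence of lambda-terms. -/
inductive BetaEta [DecidableEq X] : LamTerm X C → LamTerm X C → Prop
  | beta {t s : LamTerm X C} : ClosedAt 1 t → ClosedAt 0 s →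
      BetaEta (app (abs t) s) (openAt s 0 t)
  | eta {t : LamTerm X C} : ClosedAt 0 t → BetaEta (abs (app t (bvar 0))) t
  | app {t t' s s' : LamTerm X C} : BetaEta t t' → BetaEta s s' → BetaEta (app t s) (app t' s')
  | lam {t t' : LamTerm X C} (x : X) : BetaEta t t' → BetaEta (lam x t) (lam x t')
  | refl (t : LamTerm X C) : BetaEta t t
  | symm {t s : LamTerm X C} : BetaEta t s → BetaEta s t
  | trans {t s u : LamTerm X C} : BetaEta t s → BetaEta s u → BetaEta t u

end LamTerm

/-- A lambda-signature with atomic types `P` and constants `C`: a type for every constant. -/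
structure LamSignature (P C : Type*) where
  typeOf : C → ImpType P

/-- `LamDer S Γ t A`: the judgement `Γ ⊢ t : A` is derivable in the signature `S`. Contexts are
finite collections of typing assumptions with pairwise distinct variables. The linearity of `t` is
enforced by the rules. -/
inductive LamDer {P C X : Type*} [DecidableEq X] (S : LamSignature P C) :
    Multiset (X × ImpType P) → LamTerm X C → ImpType P → Prop
  | var (x : X) (A : ImpType P) : LamDer S {(x, A)} (.fvar x) A
  | con (c : C) : LamDer S 0 (.con c) (S.typeOf c)
  | app {Γ Γ' : Multiset (X × ImpType P)} {t s : LamTerm X C} {A B : ImpType P} :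
      LamDer S Γ t (.imp A B) → LamDer S Γ' s A → ((Γ + Γ').map Prod.fst).Nodup →
      LamDer S (Γ + Γ') (.app t s) B
  | lam {Γ : Multiset (X × ImpType P)} {x : X} {t : LamTerm X C} {A B : ImpType P} :
      LamDer S ((x, A) ::ₘ Γ) t B → LamDer S Γ (.lam x t) (.imp A B)

/-- A map of lambda-signatures. -/
structure SignatureMap (X : Type*) [DecidableEq X] {P₁ C₁ P₂ C₂ : Type*}
    (S₁ : LamSignature P₁ C₁) (S₂ : LamSignature P₂ C₂) where
  onType : ImpType P₁ → ImpType P₂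
  onType_imp : ∀ A B, onType (.imp A B) = .imp (onType A) (onType B)
  onCon : C₁ → LamTerm X C₂
  onCon_der : ∀ c, LamDer S₂ 0 (onCon c) (onType (S₁.typeOf c))

/-- The implicational type `str = O ⊸ O`; the single atomic type `O` is the point of `Unit`. -/
def strType : ImpType Unit := .imp (.atom ()) (.atom ())

/-- The lambda-string signature over the alphabet `T`. -/
def strLam (T : Type*) : LamSignature Unit T where
  typeOf _ := strType

/-- A string abstract categorial grammar: abstract signature, lexicon and sentence type. -/
structure StringACG (P C T X : Type*) [DecidableEq X] where
  abstractSig : LamSignature P C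
  lexicon : SignatureMap X abstractSig (strLam T)
  sentence : P
  onType_sentence : lexicon.onType (.atom sentence) = strType

/-! ## Tensor terms -/

/-- Raw tensor term expressions over terminals `T` and indices `Ind`: `edge w i j` is `[w]` with
upper index `i` and lower index `j`, `loop w` is `[w]` without indices, `mul` is the product. -/
inductive TensorTerm (T Ind : Type*) where
  | edge (w : List T) (up lo : Ind) : TensorTerm T Ind
  | loop (w : List T) : TensorTerm T Ind
  | mul (t s : TensorTerm T Ind) : TensorTerm T Ind

namespace TensorTerm

variable {T Ind : Type*}

/-- The upper indices of a term expression, one entry per occurrence. -/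
def sups : TensorTerm T Ind → List Ind
  | edge _ i _ => [i]
  | loop _ => []
  | mul t s => sups t ++ sups s

/-- The lower indices of a term expression, one entry per occurrence. -/
def subs : TensorTerm T Ind → List Ind
  | edge _ _ j => [j]
  | loop _ => []
  | mul t s => subs t ++ subs s

/-- `t` is a term expression: in every product inside `t` the factors have disjoint sets of upper
indices and disjoint sets of lower indices, that is, no index occurs twice as an upper one or twice
as a lower one. -/
def WF (t : TensorTerm T Ind) : Prop := t.sups.Nodup ∧ t.subs.Nodup

/-- The free upper indices. -/
def freeSup (t : TensorTerm T Ind) : Set Ind := {i | i ∈ t.sups ∧ i ∉ t.subs}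

/-- The free lower indices. -/
def freeSub (t : TensorTerm T Ind) : Set Ind := {i | i ∈ t.subs ∧ i ∉ t.sups}

/-- Replace every index `i` by `f i`. -/
def mapInd (f : Ind → Ind) : TensorTerm T Ind → TensorTerm T Ind
  | edge w i j => edge w (f i) (f j)
  | loop w => loop w
  | mul t s => mul (mapInd f t) (mapInd f s)

/-- Congruence of term expressions: the smallest equivalence relation on well-formed term
expressions with the listed properties. -/
inductive Cong : TensorTerm T Ind → TensorTerm T Ind → Prop
  | assoc {t s k : TensorTerm T Ind} : WF (mul (mul t s) k) →
      Cong (mul (mul t s) k) (mul t (mul s k))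
  | comm {t s : TensorTerm T Ind} : WF (mul t s) → Cong (mul t s) (mul s t)
  | mul {t s k : TensorTerm T Ind} : Cong t s → WF (mul t k) → WF (mul s k) →
      Cong (mul t k) (mul s k)
  | glue {u v : List T} {i j k : Ind} : WF (mul (edge u j i) (edge v k j)) →
      Cong (mul (edge u j i) (edge v k j)) (edge (u ++ v) k i)
  | loop (u : List T) (i : Ind) : Cong (edge u i i) (loop u)
  | rotate (a : T) (u : List T) : Cong (loop (u ++ [a])) (loop (a :: u))
  | refl {t : TensorTerm T Ind} : WF t → Cong t t
  | symm {t s : TensorTerm T Ind} : Cong t s → Cong s t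
  | trans {t s k : TensorTerm T Ind} : Cong t s → Cong s k → Cong t k

/-- The Kronecker delta with upper indices `I` and lower indices `J`, two sequences of the same
nonzero length. (For other sequences the value is irrelevant.) -/
def delta : List Ind → List Ind → TensorTerm T Ind
  | [i], [j] => edge [] i j
  | i :: I, j :: J => mul (edge [] i j) (delta I J)
  | _, _ => loop []

end TensorTerm

/-- Replace the index `i` by `i'`. -/
def replaceIndex {Ind : Type*} [DecidableEq Ind] (i i' : Ind) : Ind → Ind :=
  fun k => if k = i then i' else k

/-! ## Tensor types -/

/-- Tensor type symbols over the positive literals `P`: types with all indices erased. -/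
inductive TypeSymbol (P : Type*) where
  | pos (p : P) : TypeSymbol P
  | neg (p : P) : TypeSymbol P
  | tensor (A B : TypeSymbol P) : TypeSymbol P
  | par (A B : TypeSymbol P) : TypeSymbol P

namespace TypeSymbol

variable {P : Type*}

def dual : TypeSymbol P → TypeSymbol P
  | pos p => neg p
  | neg p => pos p
  | tensor A B => par (dual B) (dual A)
  | par A B => tensor (dual B) (dual A)

/-- The valency (number of upper indices, number of lower indices) of a type symbol. -/
def valency (v : P → ℕ × ℕ) : TypeSymbol P → ℕ × ℕ
  | pos p => v p
  | neg p => (v p).swap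
  | tensor A B => valency v A + valency v B
  | par A B => valency v A + valency v B

end TypeSymbol

/-- The embedding of implicational types into tensor type symbols, `A ⊸ B` being `B ⅋ Ā`. -/
def ImpType.toSymbol {P : Type*} : ImpType P → TypeSymbol P
  | .atom p => .pos p
  | .imp A B => .par B.toSymbol A.toSymbol.dual

/-- A tensor type, given as a type symbol together with the ordered sequences of its upper and of
its lower indices. -/
structure TensorType (P Ind : Type*) where
  sym : TypeSymbol P
  up : List Ind
  lo : List Ind

namespace TensorType

variable {P Ind : Type*}

/-- The number of indices is the one prescribed by the valency of the type symbol. -/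
def FitsValency (v : P → ℕ × ℕ) (A : TensorType P Ind) : Prop :=
  (A.up.length, A.lo.length) = A.sym.valency v

/-- Duality reverses the order of the indices and exchanges upper and lower ones. -/
def dual (A : TensorType P Ind) : TensorType P Ind := ⟨A.sym.dual, A.lo.reverse, A.up.reverse⟩

def tensor (A B : TensorType P Ind) : TensorType P Ind :=
  ⟨.tensor A.sym B.sym, A.up ++ B.up, A.lo ++ B.lo⟩

def par (A B : TensorType P Ind) : TensorType P Ind :=
  ⟨.par A.sym B.sym, A.up ++ B.up, A.lo ++ B.lo⟩

/-- Replace every index `i` by `f i`. -/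
def mapInd (f : Ind → Ind) (A : TensorType P Ind) : TensorType P Ind :=
  ⟨A.sym, A.up.map f, A.lo.map f⟩

end TensorType

/-! ## Tensor typing judgements and derivations -/

/-- A syntactic pair `t ⊢ Γ` of a tensor term and a collection of tensor types. -/
structure TensorJudgement (P T Ind : Type*) where
  term : TensorTerm T Ind
  sequent : Multiset (TensorType P Ind)

/-- `t ⊢ Γ` is a syntactic tensor typing judgement: `t` is a term expression, the elements of `Γ` are
tensor types, no index occurs twice in `Γ`, and the free upper (lower) indices of `t` are the lower
(upper) indices of `Γ`. -/
structure TensorJudgement.Valid {P T Ind : Type*} (v : P → ℕ × ℕ)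
    (σ : TensorJudgement P T Ind) : Prop where
  wf : σ.term.WF
  fits : ∀ A ∈ σ.sequent, A.FitsValency v
  nodup : (σ.sequent.bind fun A => (↑(A.up ++ A.lo) : Multiset Ind)).Nodup
  sup : σ.term.freeSup = {i | ∃ A ∈ σ.sequent, i ∈ A.lo}
  sub : σ.term.freeSub = {i | ∃ A ∈ σ.sequent, i ∈ A.up}

/-- The Kronecker delta that types `Ā, A`, where `A` has the upper indices `U` and the lower indices
`L` and `Ā` has the upper indices `U'` and the lower indices `L'`. -/
def idTerm {T Ind : Type*} (U L U' L' : List Ind) : TensorTerm T Ind :=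
  TensorTerm.delta (L ++ L'.reverse) (U'.reverse ++ U)

/-- A tensor signature over `P` and `T`. -/
structure TensorSignature (P T Ind : Type*) where
  val : P → ℕ × ℕ
  ax : Set (TensorJudgement P T Ind)

/-- `TensorDer S t Γ`: the tensor typing judgement represented by `t ⊢ Γ` is derivable in `S` by the
rules of tensor type calculus. The last two rules identify the syntactic representatives of a typing
judgement (congruence of terms and alpha-conversion). -/
inductive TensorDer {P T Ind : Type*} [DecidableEq Ind] (S : TensorSignature P T Ind) :
    TensorTerm T Ind → Multiset (TensorType P Ind) → Prop
  | ax {t : TensorTerm T Ind} {Γ : Multiset (TensorType P Ind)} :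
      ⟨t, Γ⟩ ∈ S.ax → TensorJudgement.Valid S.val ⟨t, Γ⟩ → TensorDer S t Γ
  | id {p : P} {U L U' L' : List Ind} :
      TensorJudgement.Valid S.val
        ⟨(idTerm U L U' L' : TensorTerm T Ind), {⟨.neg p, U', L'⟩, ⟨.pos p, U, L⟩}⟩ →
      TensorDer S (idTerm U L U' L') {⟨.neg p, U', L'⟩, ⟨.pos p, U, L⟩}
  | cut {t s : TensorTerm T Ind} {Γ Θ : Multiset (TensorType P Ind)} {A : TensorType P Ind} :
      TensorDer S t (A ::ₘ Γ) → TensorDer S s (A.dual ::ₘ Θ) →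
      TensorJudgement.Valid S.val ⟨t.mul s, Γ + Θ⟩ → TensorDer S (t.mul s) (Γ + Θ)
  | par {t : TensorTerm T Ind} {Γ : Multiset (TensorType P Ind)} {A B : TensorType P Ind} :
      TensorDer S t (A ::ₘ B ::ₘ Γ) → TensorDer S t (A.par B ::ₘ Γ)
  | tensor {t s : TensorTerm T Ind} {Γ Θ : Multiset (TensorType P Ind)} {A B : TensorType P Ind} :
      TensorDer S t (A ::ₘ Γ) → TensorDer S s (B ::ₘ Θ) →
      TensorJudgement.Valid S.val ⟨t.mul s, A.tensor B ::ₘ (Γ + Θ)⟩ →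
      TensorDer S (t.mul s) (A.tensor B ::ₘ (Γ + Θ))
  | cong {t t' : TensorTerm T Ind} {Γ : Multiset (TensorType P Ind)} :
      TensorDer S t Γ → t.Cong t' → TensorDer S t' Γ
  | alpha {t : TensorTerm T Ind} {Γ : Multiset (TensorType P Ind)} {i i' : Ind} :
      TensorDer S t Γ → i ∈ t.freeSup ∪ t.freeSub → i' ∉ t.sups → i' ∉ t.subs →
      TensorDer S (t.mapInd (replaceIndex i i')) (Γ.map (TensorType.mapInd (replaceIndex i i')))

/-- A sequent is polarized: one element is a positive implicational type, all others are negative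
implicational types. -/
def Polarized {P Ind : Type*} (Γ : Multiset (TensorType P Ind)) : Prop :=
  ∃ (A : TensorType P Ind) (Θ : Multiset (TensorType P Ind)), Γ = A ::ₘ Θ ∧
    (∃ F : ImpType P, A.sym = F.toSymbol) ∧ ∀ B ∈ Θ, ∃ F : ImpType P, B.sym = F.toSymbol.dual

/-! ## Tensor translation of lambda-signatures -/

/-- The data of a tensor translation of a lambda-signature: valencies of the atomic types and, for
every constant `c` of type `A`, (all representatives `e ⊢ L` of) the tensor translation of the
signature axiom `⊢ c : A`. -/
structure TensorTranslation (P C T Ind : Type*) where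
  val : P → ℕ × ℕ
  conTr : C → TensorTerm T Ind → TensorType P Ind → Prop

/-- The tensor signature whose axioms are the translations of the axioms of the signature. -/
def TensorTranslation.signature {P C T Ind : Type*} (R : TensorTranslation P C T Ind) :
    TensorSignature P T Ind where
  val := R.val
  ax := {π | ∃ c e L, R.conTr c e L ∧ π = ⟨e, {L}⟩}

/-- A typing assumption `x : A` together with the link (a tensor type with symbol `Ā`) to which it
is translated. -/
structure LinkedAssumption (P X Ind : Type*) where
  var : X
  type : ImpType P
  link : TensorType P Ind

/-- The typing assumption `x : A` itself. -/
def LinkedAssumption.assumption {P X Ind : Type*} (a : LinkedAssumption P X Ind) : X × ImpType P :=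
  (a.var, a.type)

def LinkedAssumption.rename {P X Ind : Type*} (r : X → X) (a : LinkedAssumption P X Ind) :
    LinkedAssumption P X Ind :=
  ⟨r a.var, a.type, a.link⟩

/-- `Translates S R Δ t A e L`: by induction on a derivation, the judgement `Γ ⊢ t : A` derivable in
`S`, where `Γ` consists of the assumptions in `Δ`, is translated to the tensor typing judgement with
the representative `e ⊢ Θ, L`, where `Θ` consists of the links in `Δ`. The last two rules identify
the syntactic representatives of a tensor typing judgement. -/
inductive Translates {P C T X Ind : Type*} [DecidableEq X] [DecidableEq Ind]
    (S : LamSignature P C) (R : TensorTranslation P C T Ind) :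
    Multiset (LinkedAssumption P X Ind) → LamTerm X C → ImpType P →
      TensorTerm T Ind → TensorType P Ind → Prop
  | var (x : X) (A : ImpType P) {U L U' L' : List Ind} :
      TensorJudgement.Valid R.val ⟨(idTerm U L U' L' : TensorTerm T Ind),
        {⟨A.toSymbol, U, L⟩, ⟨A.toSymbol.dual, U', L'⟩}⟩ →
      Translates S R {⟨x, A, ⟨A.toSymbol.dual, U', L'⟩⟩} (.fvar x) A
        (idTerm U L U' L') ⟨A.toSymbol, U, L⟩
  | con (c : C) {e : TensorTerm T Ind} {L : TensorType P Ind} :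
      R.conTr c e L → L.sym = (S.typeOf c).toSymbol →
      TensorJudgement.Valid R.val ⟨e, {L}⟩ →
      Translates S R 0 (.con c) (S.typeOf c) e L
  | lam {Δ : Multiset (LinkedAssumption P X Ind)} {x : X} {t : LamTerm X C} {A B : ImpType P}
      {e : TensorTerm T Ind} {L M : TensorType P Ind} :
      Translates S R (⟨x, A, M⟩ ::ₘ Δ) t B e L →
      Translates S R Δ (.lam x t) (.imp A B) e (L.par M)
  | app {Δ Δ' : Multiset (LinkedAssumption P X Ind)} {t s : LamTerm X C} {A B : ImpType P}
      {e e' : TensorTerm T Ind} {L M : TensorType P Ind} :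
      Translates S R Δ t (.imp A B) e (L.par M) →
      Translates S R Δ' s A e' M.dual →
      ((Δ + Δ').map LinkedAssumption.var).Nodup →
      TensorJudgement.Valid R.val ⟨e.mul e', L ::ₘ (Δ + Δ').map LinkedAssumption.link⟩ →
      Translates S R (Δ + Δ') (.app t s) B (e.mul e') L
  | cong {Δ : Multiset (LinkedAssumption P X Ind)} {t : LamTerm X C} {A : ImpType P}
      {e e' : TensorTerm T Ind} {L : TensorType P Ind} :
      Translates S R Δ t A e L → e.Cong e' → Translates S R Δ t A e' L
  | alpha {Δ : Multiset (LinkedAssumption P X Ind)} {t : LamTerm X C} {A : ImpType P}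
      {e : TensorTerm T Ind} {L : TensorType P Ind} {i i' : Ind} :
      Translates S R Δ t A e L → i ∈ e.freeSup ∪ e.freeSub → i' ∉ e.sups → i' ∉ e.subs →
      Translates S R
        (Δ.map fun a => ⟨a.var, a.type, a.link.mapInd (replaceIndex i i')⟩) t A
        (e.mapInd (replaceIndex i i')) (L.mapInd (replaceIndex i i'))

/-- The judgement `Γ ⊢ t : A`, with `Γ` the assumptions in `Δ`, translates to the tensor typing
judgement `π`, the assumptions corresponding to the links recorded in `Δ`. -/
def TranslatesTo {P C T X Ind : Type*} [DecidableEq X] [DecidableEq Ind]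
    (S : LamSignature P C) (R : TensorTranslation P C T Ind)
    (Δ : Multiset (LinkedAssumption P X Ind)) (t : LamTerm X C) (A : ImpType P)
    (π : TensorJudgement P T Ind) : Prop :=
  ∃ L : TensorType P Ind,
    Translates S R Δ t A π.term L ∧ π.sequent = L ::ₘ Δ.map LinkedAssumption.link

/-- The tensor translation of the string signature: `O` has valency `(1,0)`, and `⊢ c : str` goes to
`[c]`, with lower index `i` and upper index `j`, of type `O^i ⅋ Ō_j`. -/
def strTranslation (T Ind : Type*) : TensorTranslation Unit T T Ind where
  val _ := (1, 0)
  conTr c e L := ∃ i j : Ind, i ≠ j ∧ e = .edge [c] j i ∧ L = ⟨strType.toSymbol, [i], [j]⟩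

/-! ## Tensor translation of a string ACG -/

namespace StringACG

variable {P C T X Ind : Type*} [DecidableEq X]

/-- The lexicon on lambda-terms. -/
def onTerm (G : StringACG P C T X) : LamTerm X C → LamTerm X T :=
  LamTerm.mapCon G.lexicon.onCon

/-- The lexicon on tensor type symbols. -/
def onSymbol (G : StringACG P C T X) : TypeSymbol P → TypeSymbol Unit
  | .pos p => (G.lexicon.onType (.atom p)).toSymbol
  | .neg p => (G.lexicon.onType (.atom p)).toSymbol.dual
  | .tensor A B => .tensor (onSymbol G A) (onSymbol G B)
  | .par A B => .par (onSymbol G A) (onSymbol G B)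

/-- The lexicon on tensor types; the indices do not change. -/
def onTensorType (G : StringACG P C T X) (A : TensorType P Ind) : TensorType Unit Ind :=
  ⟨G.onSymbol A.sym, A.up, A.lo⟩

/-- From `t ⊢ Γ` to `t ⊢ φ(Γ)`. -/
def onTensorJudgement (G : StringACG P C T X) (π : TensorJudgement P T Ind) :
    TensorJudgement Unit T Ind :=
  ⟨π.term, π.sequent.map G.onTensorType⟩

/-- The lexicon on typing assumptions and on the corresponding links. -/
def onAssumption (G : StringACG P C T X) (a : LinkedAssumption P X Ind) :
    LinkedAssumption Unit X Ind :=
  ⟨a.var, G.lexicon.onType a.type, G.onTensorType a.link⟩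

/-- The valency of an atomic type `p` is the valency of `φ(p)` in the tensor string signature. -/
def val (G : StringACG P C T X) (p : P) : ℕ × ℕ :=
  (G.lexicon.onType (.atom p)).toSymbol.valency fun _ => (1, 0)

/-- The tensor translation of the abstract signature: an axiom `⊢ c : A` goes to `e ⊢ A` with those
`e` and indices for which `e ⊢ φ(A)` is the translation of `⊢ φ(c) : φ(A)` in the string
signature. -/
def translation (G : StringACG P C T X) (Ind : Type*) [DecidableEq Ind] :
    TensorTranslation P C T Ind where
  val := G.val
  conTr c e L := L.sym = (G.abstractSig.typeOf c).toSymbol ∧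
    TranslatesTo (X := X) (strLam T) (strTranslation T Ind) 0 (G.lexicon.onCon c)
      (G.lexicon.onType (G.abstractSig.typeOf c)) ⟨e, {G.onTensorType L}⟩

end StringACG

end StringACGTensor

namespace StringACGTensor

set_option linter.unusedSectionVars false

open TensorTerm

/-! ## Tensor terms as multisets of factors -/

/-- An elementary factor of a tensor term. -/
inductive Factor (T Ind : Type*) where
  | edge (w : List T) (up lo : Ind) : Factor T Ind
  | loop (w : List T) : Factor T Ind

namespace Factor

variable {T Ind : Type*}

def term : Factor T Ind → TensorTerm T Ind
  | edge w i j => .edge w i j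
  | loop w => .loop w

def sup : Factor T Ind → Multiset Ind
  | edge _ i _ => {i}
  | loop _ => 0

def sub : Factor T Ind → Multiset Ind
  | edge _ _ j => {j}
  | loop _ => 0

def mapInd (f : Ind → Ind) : Factor T Ind → Factor T Ind
  | edge w i j => edge w (f i) (f j)
  | loop w => loop w

end Factor

abbrev Net (T Ind : Type*) := Multiset (Factor T Ind)

abbrev Seq (P Ind : Type*) := Multiset (TensorType P Ind)

namespace TensorTerm

variable {T Ind : Type*}

/-- The multiset of factors of a tensor term. -/
def flat : TensorTerm T Ind → Net T Ind
  | edge w i j => {Factor.edge w i j}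
  | loop w => {Factor.loop w}
  | mul t s => flat t + flat s

end TensorTerm

section Counting

variable {P T Ind : Type*}

@[simp] lemma TensorType.up_dual (A : TensorType P Ind) : A.dual.up = A.lo.reverse := rfl
@[simp] lemma TensorType.lo_dual (A : TensorType P Ind) : A.dual.lo = A.up.reverse := rfl
@[simp] lemma TensorType.sym_dual (A : TensorType P Ind) : A.dual.sym = A.sym.dual := rfl
@[simp] lemma TensorType.up_par (A B : TensorType P Ind) : (A.par B).up = A.up ++ B.up := rfl
@[simp] lemma TensorType.lo_par (A B : TensorType P Ind) : (A.par B).lo = A.lo ++ B.lo := rfl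
@[simp] lemma TensorType.sym_par (A B : TensorType P Ind) :
    (A.par B).sym = .par A.sym B.sym := rfl
@[simp] lemma TensorType.up_tensor (A B : TensorType P Ind) :
    (A.tensor B).up = A.up ++ B.up := rfl
@[simp] lemma TensorType.lo_tensor (A B : TensorType P Ind) :
    (A.tensor B).lo = A.lo ++ B.lo := rfl
@[simp] lemma TensorType.sym_tensor (A B : TensorType P Ind) :
    (A.tensor B).sym = .tensor A.sym B.sym := rfl

variable [DecidableEq Ind]

def csup (m : Net T Ind) (i : Ind) : ℕ := (m.bind Factor.sup).count i
def csub (m : Net T Ind) (i : Ind) : ℕ := (m.bind Factor.sub).count i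
def cup (Γ : Seq P Ind) (i : Ind) : ℕ := (Γ.bind fun A => (A.up : Multiset Ind)).count i
def clo (Γ : Seq P Ind) (i : Ind) : ℕ := (Γ.bind fun A => (A.lo : Multiset Ind)).count i

@[simp] lemma csup_add (m n : Net T Ind) (i : Ind) : csup (m + n) i = csup m i + csup n i := by
  simp [csup]
@[simp] lemma csub_add (m n : Net T Ind) (i : Ind) : csub (m + n) i = csub m i + csub n i := by
  simp [csub]
@[simp] lemma csup_zero (i : Ind) : csup (0 : Net T Ind) i = 0 := by simp [csup]
@[simp] lemma csub_zero (i : Ind) : csub (0 : Net T Ind) i = 0 := by simp [csub]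
@[simp] lemma csup_cons (a : Factor T Ind) (n : Net T Ind) (i : Ind) :
    csup (a ::ₘ n) i = a.sup.count i + csup n i := by simp [csup]
@[simp] lemma csub_cons (a : Factor T Ind) (n : Net T Ind) (i : Ind) :
    csub (a ::ₘ n) i = a.sub.count i + csub n i := by simp [csub]
@[simp] lemma csup_singleton (a : Factor T Ind) (i : Ind) :
    csup {a} i = a.sup.count i := by simp [csup]
@[simp] lemma csub_singleton (a : Factor T Ind) (i : Ind) :
    csub {a} i = a.sub.count i := by simp [csub]
@[simp] lemma cup_add (m n : Seq P Ind) (i : Ind) : cup (m + n) i = cup m i + cup n i := by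
  simp [cup]
@[simp] lemma clo_add (m n : Seq P Ind) (i : Ind) : clo (m + n) i = clo m i + clo n i := by
  simp [clo]
@[simp] lemma cup_zero (i : Ind) : cup (0 : Seq P Ind) i = 0 := by simp [cup]
@[simp] lemma clo_zero (i : Ind) : clo (0 : Seq P Ind) i = 0 := by simp [clo]
@[simp] lemma cup_cons (a : TensorType P Ind) (n : Seq P Ind) (i : Ind) :
    cup (a ::ₘ n) i = a.up.count i + cup n i := by simp [cup]
@[simp] lemma clo_cons (a : TensorType P Ind) (n : Seq P Ind) (i : Ind) :
    clo (a ::ₘ n) i = a.lo.count i + clo n i := by simp [clo]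
@[simp] lemma cup_singleton (a : TensorType P Ind) (i : Ind) :
    cup {a} i = a.up.count i := by simp [cup]
@[simp] lemma clo_singleton (a : TensorType P Ind) (i : Ind) :
    clo {a} i = a.lo.count i := by simp [clo]

lemma TensorTerm.coe_sups (e : TensorTerm T Ind) :
    (e.sups : Multiset Ind) = e.flat.bind Factor.sup := by
  induction e with
  | edge w i j => simp [sups, flat, Factor.sup]
  | loop w => simp [sups, flat, Factor.sup]
  | mul t s h1 h2 => simp [sups, flat, ← h1, ← h2]

lemma TensorTerm.coe_subs (e : TensorTerm T Ind) :
    (e.subs : Multiset Ind) = e.flat.bind Factor.sub := by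
  induction e with
  | edge w i j => simp [subs, flat, Factor.sub]
  | loop w => simp [subs, flat, Factor.sub]
  | mul t s h1 h2 => simp [subs, flat, ← h1, ← h2]

lemma TensorTerm.count_sups (e : TensorTerm T Ind) (i : Ind) :
    e.sups.count i = csup e.flat i := by
  rw [csup, ← e.coe_sups, Multiset.coe_count]

lemma TensorTerm.count_subs (e : TensorTerm T Ind) (i : Ind) :
    e.subs.count i = csub e.flat i := by
  rw [csub, ← e.coe_subs, Multiset.coe_count]

lemma TensorTerm.mem_sups_iff (e : TensorTerm T Ind) (i : Ind) :
    i ∈ e.sups ↔ 0 < csup e.flat i := by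
  rw [← count_sups, List.count_pos_iff]

lemma TensorTerm.mem_subs_iff (e : TensorTerm T Ind) (i : Ind) :
    i ∈ e.subs ↔ 0 < csub e.flat i := by
  rw [← count_subs, List.count_pos_iff]

/-- No index occurs twice as an upper or twice as a lower one. -/
def NetWF (m : Net T Ind) : Prop := ∀ i, csup m i ≤ 1 ∧ csub m i ≤ 1

lemma TensorTerm.wf_iff (e : TensorTerm T Ind) : e.WF ↔ NetWF e.flat := by
  simp only [WF, NetWF, List.nodup_iff_count_le_one, count_sups, count_subs, forall_and]

/-- Validity of a judgement in terms of multiplicities of indices. -/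
def NetValid (v : P → ℕ × ℕ) (m : Net T Ind) (Γ : Seq P Ind) : Prop :=
  (∀ A ∈ Γ, A.FitsValency v) ∧ ∀ i, csup m i ≤ 1 ∧ csub m i ≤ 1 ∧ cup Γ i + clo Γ i ≤ 1 ∧
    csup m i + cup Γ i = csub m i + clo Γ i

lemma NetValid.wf {v : P → ℕ × ℕ} {m : Net T Ind} {Γ : Seq P Ind} (h : NetValid v m Γ) :
    NetWF m := fun i => ⟨(h.2 i).1, (h.2 i).2.1⟩

lemma mem_up_iff (Γ : Seq P Ind) (i : Ind) : (∃ A ∈ Γ, i ∈ A.up) ↔ 0 < cup Γ i := by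
  simp [cup, Multiset.count_pos]

lemma mem_lo_iff (Γ : Seq P Ind) (i : Ind) : (∃ A ∈ Γ, i ∈ A.lo) ↔ 0 < clo Γ i := by
  simp [clo, Multiset.count_pos]

lemma count_bind_indices (Γ : Seq P Ind) (i : Ind) :
    (Γ.bind fun A => (↑(A.up ++ A.lo) : Multiset Ind)).count i = cup Γ i + clo Γ i := by
  induction Γ using Multiset.induction with
  | empty => simp
  | cons a s ih => simp [ih] at *; omega

lemma valid_iff (v : P → ℕ × ℕ) (e : TensorTerm T Ind) (Γ : Seq P Ind) :
    TensorJudgement.Valid v ⟨e, Γ⟩ ↔ NetValid v e.flat Γ := by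
  constructor
  · rintro ⟨hw, hf, hn, hs, hb⟩
    refine ⟨hf, fun i => ?_⟩
    have h1 := (e.wf_iff.1 hw) i
    have h2 := Multiset.nodup_iff_count_le_one.1 hn i
    simp only [count_bind_indices] at h2
    have h3 := Set.ext_iff.1 hs i
    have h4 := Set.ext_iff.1 hb i
    simp only [freeSup, freeSub, Set.mem_ofPred_eq, mem_sups_iff, mem_subs_iff, mem_up_iff,
      mem_lo_iff] at h3 h4
    refine ⟨h1.1, h1.2, h2, ?_⟩
    omega
  · rintro ⟨hf, h⟩
    refine ⟨e.wf_iff.2 fun i => ⟨(h i).1, (h i).2.1⟩, hf, ?_, ?_, ?_⟩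
    · rw [Multiset.nodup_iff_count_le_one]
      intro i
      simp only [count_bind_indices]
      exact (h i).2.2.1
    · ext i
      simp only [freeSup, Set.mem_ofPred_eq, mem_sups_iff, mem_subs_iff, mem_lo_iff]
      have := h i
      omega
    · ext i
      simp only [freeSub, Set.mem_ofPred_eq, mem_sups_iff, mem_subs_iff, mem_up_iff]
      have := h i
      omega

lemma TensorTerm.mem_freeSup_iff (e : TensorTerm T Ind) (i : Ind) :
    i ∈ e.freeSup ↔ 0 < csup e.flat i ∧ csub e.flat i = 0 := by
  simp [freeSup, mem_sups_iff, mem_subs_iff]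

lemma TensorTerm.mem_freeSub_iff (e : TensorTerm T Ind) (i : Ind) :
    i ∈ e.freeSub ↔ 0 < csub e.flat i ∧ csup e.flat i = 0 := by
  simp [freeSub, mem_sups_iff, mem_subs_iff]

end Counting

section Congruence

variable {T Ind : Type*}

lemma TensorTerm.flat_ne_zero (e : TensorTerm T Ind) : e.flat ≠ 0 := by
  induction e with
  | edge w i j => simp [flat]
  | loop w => simp [flat]
  | mul t s h1 h2 => simp [flat, h1]

lemma Factor.flat_term (a : Factor T Ind) : a.term.flat = {a} := by
  cases a <;> rfl

lemma Net.exists_term {m : Net T Ind} (h : m ≠ 0) : ∃ e : TensorTerm T Ind, e.flat = m := by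
  induction m using Multiset.induction with
  | empty => exact absurd rfl h
  | cons a s ih =>
    rcases eq_or_ne s 0 with rfl | hs
    · exact ⟨a.term, a.flat_term⟩
    · obtain ⟨e, he⟩ := ih hs
      exact ⟨a.term.mul e, by simp [flat, he, a.flat_term]⟩

variable [DecidableEq Ind]

lemma TensorTerm.WF.of_flat_eq {e e' : TensorTerm T Ind} (h : e.WF) (he : e.flat = e'.flat) :
    e'.WF := by
  rw [wf_iff] at *
  rwa [← he]

lemma NetWF.of_le {m n : Net T Ind} (h : NetWF (m + n)) : NetWF m := fun i => by
  have := h i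
  simp at this
  omega

lemma NetWF.of_le' {m n : Net T Ind} (h : NetWF (m + n)) : NetWF n := fun i => by
  have := h i
  simp at this
  omega

lemma TensorTerm.WF.left {t s : TensorTerm T Ind} (h : (t.mul s).WF) : t.WF :=
  t.wf_iff.2 ((wf_iff _).1 h).of_le

lemma TensorTerm.WF.right {t s : TensorTerm T Ind} (h : (t.mul s).WF) : s.WF :=
  s.wf_iff.2 ((wf_iff _).1 h).of_le'

lemma TensorTerm.Cong.mul_right {t s k : TensorTerm T Ind} (h : Cong t s) (h1 : WF (k.mul t))
    (h2 : WF (k.mul s)) : Cong (k.mul t) (k.mul s) := by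
  have h1' : WF (t.mul k) := h1.of_flat_eq (add_comm _ _)
  have h2' : WF (s.mul k) := h2.of_flat_eq (add_comm _ _)
  exact (Cong.comm h1).trans ((Cong.mul h h1' h2').trans (Cong.comm h2'))

/-- Any factor of a term can be moved to the front. -/
lemma TensorTerm.exists_cong_mul {e : TensorTerm T Ind} (he : e.WF) {a : Factor T Ind}
    (ha : a ∈ e.flat) : e = a.term ∨ ∃ e', Cong e (a.term.mul e') ∧ e.flat = a ::ₘ e'.flat := by
  induction e with
  | edge w i j => left; simp [flat] at ha; subst ha; rfl
  | loop w => left; simp [flat] at ha; subst ha; rfl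
  | mul t s ht hs =>
    right
    simp only [flat, Multiset.mem_add] at ha
    rcases ha with ha | ha
    · rcases ht he.left ha with rfl | ⟨e', h1, h2⟩
      · exact ⟨s, .refl he, by simp [flat, a.flat_term]⟩
      · have hw : WF ((a.term.mul e').mul s) :=
          he.of_flat_eq (by simp [flat, h2, a.flat_term])
        exact ⟨e'.mul s, (Cong.mul h1 he hw).trans (Cong.assoc hw), by simp [flat, h2]⟩
    · rcases hs he.right ha with rfl | ⟨e', h1, h2⟩
      · exact ⟨t, .comm he, by simp [flat, a.flat_term, add_comm]⟩
      · have he' : WF (s.mul t) := he.of_flat_eq (add_comm _ _)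
        have hw : WF ((a.term.mul e').mul t) :=
          he'.of_flat_eq (by simp [flat, h2, a.flat_term])
        exact ⟨e'.mul t, (Cong.comm he).trans ((Cong.mul h1 he' hw).trans (Cong.assoc hw)),
          by simp [flat, h2, add_comm]⟩

lemma TensorTerm.cong_of_flat_eq {e e' : TensorTerm T Ind} (he : e.WF) (h : e.flat = e'.flat) :
    Cong e e' := by
  have key : ∀ (n : ℕ) (e e' : TensorTerm T Ind), e.flat.card = n → e.WF → e.flat = e'.flat →
      Cong e e' := by
    intro n
    induction n with
    | zero =>
      intro e e' hn
      exact absurd (Multiset.card_eq_zero.1 hn) e.flat_ne_zero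
    | succ n ih =>
      intro e e' hn he h
      have he' := he.of_flat_eq h
      obtain ⟨a, ha⟩ := Multiset.exists_mem_of_ne_zero e.flat_ne_zero
      have ha' := h ▸ ha
      rcases exists_cong_mul he ha with rfl | ⟨e1, h1, h2⟩
      · rcases exists_cong_mul he' ha' with rfl | ⟨e1', h1', h2'⟩
        · exact .refl he
        · rw [a.flat_term, h2'] at h
          exact absurd h (by simp [← Multiset.cons_zero, e1'.flat_ne_zero.symm])
      · rcases exists_cong_mul he' ha' with rfl | ⟨e1', h1', h2'⟩
        · rw [a.flat_term, h2] at h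
          exact absurd h (by simp [← Multiset.cons_zero, e1.flat_ne_zero])
        · have h3 : e1.flat = e1'.flat := by
            rw [h2, h2'] at h
            exact (Multiset.cons_inj_right a).1 h
          have w1 : WF (a.term.mul e1) := he.of_flat_eq (by simp [flat, a.flat_term, h2])
          have w2 : WF (a.term.mul e1') := he'.of_flat_eq (by simp [flat, a.flat_term, h2'])
          have := ih e1 e1' (by rw [h2] at hn; simpa using hn) w1.right h3
          exact h1.trans ((this.mul_right w1 w2).trans h1'.symm)
  exact key _ e e' rfl he h

lemma TensorTerm.Cong.wf {e e' : TensorTerm T Ind} (h : Cong e e') : e.WF ∧ e'.WF := by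
  induction h with
  | assoc h => exact ⟨h, h.of_flat_eq (add_assoc _ _ _)⟩
  | comm h => exact ⟨h, h.of_flat_eq (add_comm _ _)⟩
  | mul _ h1 h2 => exact ⟨h1, h2⟩
  | glue h => exact ⟨h, by simp [WF, sups, subs]⟩
  | loop => simp [WF, sups, subs]
  | rotate => simp [WF, sups, subs]
  | refl h => exact ⟨h, h⟩
  | symm _ h => exact h.symm
  | trans _ _ h1 h2 => exact ⟨h1.1, h2.2⟩

/-- Congruent terms have the same free indices. -/
lemma TensorTerm.Cong.count {e e' : TensorTerm T Ind} (h : Cong e e') (i : Ind) :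
    csup e.flat i + csub e'.flat i = csup e'.flat i + csub e.flat i := by
  induction h with
  | assoc h => simp [flat]; omega
  | comm h => simp [flat]; omega
  | mul _ h1 h2 ih => simp [flat]; omega
  | glue h => simp [flat, Factor.sup, Factor.sub]; omega
  | loop => simp [flat, Factor.sup, Factor.sub]
  | rotate => simp [flat, Factor.sup, Factor.sub]
  | refl h => rfl
  | symm _ h => omega
  | trans _ _ h1 h2 => omega

/-- Congruence of nets. -/
def NetCong (m n : Net T Ind) : Prop :=
  ∃ e e' : TensorTerm T Ind, e.flat = m ∧ e'.flat = n ∧ Cong e e'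

lemma NetCong.cong {e e' : TensorTerm T Ind} (h : NetCong e.flat e'.flat) : Cong e e' := by
  obtain ⟨a, b, h1, h2, h3⟩ := h
  exact ((cong_of_flat_eq h3.wf.1 h1).symm.trans h3).trans (cong_of_flat_eq h3.wf.2 h2)

lemma NetCong.refl {m : Net T Ind} (h0 : m ≠ 0) (h : NetWF m) : NetCong m m := by
  obtain ⟨e, rfl⟩ := Net.exists_term h0
  exact ⟨e, e, rfl, rfl, .refl (e.wf_iff.2 h)⟩

lemma NetCong.symm {m n : Net T Ind} (h : NetCong m n) : NetCong n m := by
  obtain ⟨a, b, h1, h2, h3⟩ := h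
  exact ⟨b, a, h2, h1, h3.symm⟩

lemma NetCong.trans {m n k : Net T Ind} (h : NetCong m n) (h' : NetCong n k) : NetCong m k := by
  obtain ⟨a, b, rfl, rfl, h3⟩ := h
  obtain ⟨c, d, h4, rfl, h6⟩ := h'
  exact ⟨a, d, rfl, rfl, h3.trans ((cong_of_flat_eq h6.wf.1 h4).symm.trans h6)⟩

lemma NetCong.add {m n k : Net T Ind} (h : NetCong m n) (h1 : NetWF (m + k))
    (h2 : NetWF (n + k)) : NetCong (m + k) (n + k) := by
  rcases eq_or_ne k 0 with rfl | hk
  · simpa using h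
  obtain ⟨a, b, rfl, rfl, h3⟩ := h
  obtain ⟨c, rfl⟩ := Net.exists_term hk
  exact ⟨a.mul c, b.mul c, rfl, rfl, .mul h3 ((wf_iff _).2 h1) ((wf_iff _).2 h2)⟩

lemma NetCong.wf_left {m n : Net T Ind} (h : NetCong m n) : NetWF m := by
  obtain ⟨a, b, rfl, rfl, h3⟩ := h
  exact (wf_iff _).1 h3.wf.1

lemma NetCong.wf_right {m n : Net T Ind} (h : NetCong m n) : NetWF n := h.symm.wf_left

lemma NetCong.count {m n : Net T Ind} (h : NetCong m n) (i : Ind) :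
    csup m i + csub n i = csup n i + csub m i := by
  obtain ⟨a, b, rfl, rfl, h3⟩ := h
  exact h3.count i

lemma NetCong.ne_zero {m n : Net T Ind} (h : NetCong m n) : m ≠ 0 := by
  obtain ⟨a, b, rfl, rfl, h3⟩ := h
  exact a.flat_ne_zero

lemma NetCong.glue {u v : List T} {i j k : Ind} {m : Net T Ind}
    (h : NetWF (Factor.edge u j i ::ₘ Factor.edge v k j ::ₘ m)) :
    NetCong (Factor.edge u j i ::ₘ Factor.edge v k j ::ₘ m) (Factor.edge (u ++ v) k i ::ₘ m) := by
  have e : Factor.edge u j i ::ₘ Factor.edge v k j ::ₘ m =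
      ({Factor.edge u j i} + {Factor.edge v k j}) + m := by
    rw [add_assoc, Multiset.singleton_add, Multiset.singleton_add]
  rw [e] at h ⊢
  rw [← Multiset.singleton_add _ m]
  exact NetCong.add (k := m) (m := {Factor.edge u j i} + {Factor.edge v k j})
    (n := {Factor.edge (u ++ v) k i})
    ⟨_, _, rfl, rfl, .glue ((wf_iff (mul (edge u j i) (edge v k j))).2 h.of_le)⟩ h fun a => by
      have := h a
      simp [Factor.sup, Factor.sub] at this ⊢
      omega

lemma NetCong.loop {u : List T} {i : Ind} {m : Net T Ind}
    (h : NetWF (Factor.edge u i i ::ₘ m)) :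
    NetCong (Factor.edge u i i ::ₘ m) (Factor.loop u ::ₘ m) := by
  rw [← Multiset.singleton_add] at h ⊢
  rw [← Multiset.singleton_add _ m]
  exact NetCong.add (k := m) (m := {Factor.edge u i i}) (n := {Factor.loop u})
    ⟨_, _, rfl, rfl, .loop u i⟩ h fun a => by
      have := h a
      simp [Factor.sup, Factor.sub] at this ⊢
      omega

end Congruence

section Renaming

variable {P T Ind : Type*}

@[simp] lemma TensorTerm.flat_mapInd (f : Ind → Ind) (e : TensorTerm T Ind) :
    (e.mapInd f).flat = e.flat.map (Factor.mapInd f) := by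
  induction e with
  | edge w i j => rfl
  | loop w => rfl
  | mul t s h1 h2 => simp [mapInd, flat, h1, h2]

@[simp] lemma Factor.mapInd_mapInd (f g : Ind → Ind) (a : Factor T Ind) :
    (a.mapInd f).mapInd g = a.mapInd (g ∘ f) := by
  cases a <;> rfl

@[simp] lemma TensorType.mapInd_mapInd (f g : Ind → Ind) (A : TensorType P Ind) :
    (A.mapInd f).mapInd g = A.mapInd (g ∘ f) := by
  simp [mapInd]

@[simp] lemma TensorType.mapInd_id (A : TensorType P Ind) : A.mapInd id = A := by
  simp [mapInd]

@[simp] lemma Factor.mapInd_id (a : Factor T Ind) : a.mapInd id = a := by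
  cases a <;> rfl

@[simp] lemma TensorType.mapInd_id' (A : TensorType P Ind) : A.mapInd (fun x => x) = A :=
  A.mapInd_id

@[simp] lemma Factor.mapInd_id' (a : Factor T Ind) : a.mapInd (fun x => x) = a := a.mapInd_id

lemma TensorType.mapInd_dual (f : Ind → Ind) (A : TensorType P Ind) :
    A.dual.mapInd f = (A.mapInd f).dual := by
  simp [mapInd, dual]

lemma TensorType.mapInd_par (f : Ind → Ind) (A B : TensorType P Ind) :
    (A.par B).mapInd f = (A.mapInd f).par (B.mapInd f) := by
  simp [mapInd, par]

lemma TensorType.mapInd_tensor (f : Ind → Ind) (A B : TensorType P Ind) :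
    (A.tensor B).mapInd f = (A.mapInd f).tensor (B.mapInd f) := by
  simp [mapInd, tensor]


abbrev Net.mapInd (f : Ind → Ind) (m : Net T Ind) : Net T Ind := m.map (Factor.mapInd f)

abbrev Seq.mapInd (f : Ind → Ind) (Γ : Seq P Ind) : Seq P Ind := Γ.map (TensorType.mapInd f)

lemma TensorType.mapInd_congr {f g : Ind → Ind} {A : TensorType P Ind}
    (h : ∀ i, i ∈ A.up ∨ i ∈ A.lo → f i = g i) : A.mapInd f = A.mapInd g := by
  simp only [mapInd, TensorType.mk.injEq, true_and]
  exact ⟨List.map_congr_left fun i hi => h i (.inl hi),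
    List.map_congr_left fun i hi => h i (.inr hi)⟩

lemma Factor.mapInd_congr {f g : Ind → Ind} {a : Factor T Ind}
    (h : ∀ i, i ∈ a.sup ∨ i ∈ a.sub → f i = g i) : a.mapInd f = a.mapInd g := by
  cases a <;> simp_all [mapInd, sup, sub]

variable [DecidableEq Ind]

lemma Net.mapInd_congr {f g : Ind → Ind} {m : Net T Ind}
    (h : ∀ i, 0 < csup m i ∨ 0 < csub m i → f i = g i) : m.mapInd f = m.mapInd g := by
  refine Multiset.map_congr rfl fun a ha => Factor.mapInd_congr fun i hi => h i ?_
  simp only [csup, csub, Multiset.count_pos, Multiset.mem_bind]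
  exact hi.imp (fun h => ⟨a, ha, h⟩) fun h => ⟨a, ha, h⟩

lemma Seq.mapInd_congr {f g : Ind → Ind} {Γ : Seq P Ind}
    (h : ∀ i, 0 < cup Γ i ∨ 0 < clo Γ i → f i = g i) : Γ.mapInd f = Γ.mapInd g := by
  refine Multiset.map_congr rfl fun a ha => TensorType.mapInd_congr fun i hi => h i ?_
  rw [← mem_up_iff, ← mem_lo_iff]
  exact hi.imp (fun h => ⟨a, ha, h⟩) fun h => ⟨a, ha, h⟩

lemma Net.mapInd_eq_self {f : Ind → Ind} {m : Net T Ind}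
    (h : ∀ i, 0 < csup m i ∨ 0 < csub m i → f i = i) : m.mapInd f = m := by
  rw [Net.mapInd_congr (g := id) h]
  simp [mapInd]

lemma Seq.mapInd_eq_self {f : Ind → Ind} {Γ : Seq P Ind}
    (h : ∀ i, 0 < cup Γ i ∨ 0 < clo Γ i → f i = i) : Γ.mapInd f = Γ := by
  rw [Seq.mapInd_congr (g := id) h]
  simp [mapInd]

@[simp] lemma csup_mapInd (f : Equiv.Perm Ind) (m : Net T Ind) (i : Ind) :
    csup (m.map (Factor.mapInd f)) (f i) = csup m i := by
  induction m using Multiset.induction with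
  | empty => simp
  | cons a s ih => cases a <;> simp [Factor.mapInd, Factor.sup, ih, Multiset.count_singleton]

@[simp] lemma csub_mapInd (f : Equiv.Perm Ind) (m : Net T Ind) (i : Ind) :
    csub (m.map (Factor.mapInd f)) (f i) = csub m i := by
  induction m using Multiset.induction with
  | empty => simp
  | cons a s ih => cases a <;> simp [Factor.mapInd, Factor.sub, ih, Multiset.count_singleton]

@[simp] lemma cup_mapInd (f : Equiv.Perm Ind) (m : Seq P Ind) (i : Ind) :
    cup (m.map (TensorType.mapInd f)) (f i) = cup m i := by
  induction m using Multiset.induction with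
  | empty => simp
  | cons a s ih => simp [TensorType.mapInd, ih, List.count_map_of_injective _ _ f.injective]

@[simp] lemma clo_mapInd (f : Equiv.Perm Ind) (m : Seq P Ind) (i : Ind) :
    clo (m.map (TensorType.mapInd f)) (f i) = clo m i := by
  induction m using Multiset.induction with
  | empty => simp
  | cons a s ih => simp [TensorType.mapInd, ih, List.count_map_of_injective _ _ f.injective]

lemma TensorType.FitsValency.mapInd {v : P → ℕ × ℕ} {A : TensorType P Ind}
    (h : A.FitsValency v) (f : Ind → Ind) : (A.mapInd f).FitsValency v := by
  simpa [FitsValency, TensorType.mapInd] using h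

lemma NetWF.mapInd {m : Net T Ind} (h : NetWF m) (f : Equiv.Perm Ind) :
    NetWF (m.map (Factor.mapInd f)) := fun i => by
  obtain ⟨i, rfl⟩ := f.surjective i
  simpa using h i

lemma NetValid.mapInd {v : P → ℕ × ℕ} {m : Net T Ind} {Γ : Seq P Ind} (h : NetValid v m Γ)
    (f : Equiv.Perm Ind) :
    NetValid v (m.map (Factor.mapInd f)) (Γ.map (TensorType.mapInd f)) := by
  refine ⟨?_, fun i => ?_⟩
  · simp only [Multiset.mem_map, forall_exists_index, and_imp, forall_apply_eq_imp_iff₂]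
    exact fun A hA => (h.1 A hA).mapInd f
  · obtain ⟨i, rfl⟩ := f.surjective i
    simpa using h.2 i

lemma TensorTerm.WF.mapInd {e : TensorTerm T Ind} (h : e.WF) (f : Equiv.Perm Ind) :
    (e.mapInd f).WF := by
  rw [wf_iff, flat_mapInd] at *
  exact h.mapInd f

lemma TensorTerm.Cong.mapInd {e e' : TensorTerm T Ind} (h : Cong e e') (f : Equiv.Perm Ind) :
    Cong (e.mapInd f) (e'.mapInd f) := by
  induction h with
  | assoc h => exact .assoc (h.mapInd f)
  | comm h => exact .comm (h.mapInd f)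
  | mul _ h1 h2 ih => exact .mul ih (h1.mapInd f) (h2.mapInd f)
  | glue h => exact .glue (h.mapInd f)
  | loop => exact .loop _ _
  | rotate => exact .rotate _ _
  | refl h => exact .refl (h.mapInd f)
  | symm _ h => exact h.symm
  | trans _ _ h1 h2 => exact h1.trans h2

lemma NetCong.mapInd {m n : Net T Ind} (h : NetCong m n) (f : Equiv.Perm Ind) :
    NetCong (m.map (Factor.mapInd f)) (n.map (Factor.mapInd f)) := by
  obtain ⟨a, b, rfl, rfl, h3⟩ := h
  exact ⟨a.mapInd f, b.mapInd f, by simp, by simp, h3.mapInd f⟩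

/-- On judgements that do not mention `i'`, the substitution of `i'` for `i` is a swap. -/
lemma replaceIndex_eq_swap {i i' k : Ind} (h : k ≠ i') : replaceIndex i i' k = Equiv.swap i i' k := by
  unfold replaceIndex
  split_ifs with h1
  · simp [h1]
  · rw [Equiv.swap_apply_of_ne_of_ne h1 h]

lemma TensorTerm.mapInd_congr {f g : Ind → Ind} {e : TensorTerm T Ind}
    (h : ∀ i, i ∈ e.sups ∨ i ∈ e.subs → f i = g i) : e.mapInd f = e.mapInd g := by
  induction e with
  | edge w i j => simp_all [TensorTerm.mapInd, sups, subs]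
  | loop w => rfl
  | mul t s h1 h2 =>
    simp only [sups, subs, List.mem_append] at h
    simp only [TensorTerm.mapInd, h1 fun i hi => h i (by tauto), h2 fun i hi => h i (by tauto)]

lemma TensorTerm.mapInd_replaceIndex {e : TensorTerm T Ind} {i i' : Ind} (h1 : i' ∉ e.sups)
    (h2 : i' ∉ e.subs) :
    e.mapInd (replaceIndex i i') = e.mapInd (Equiv.swap i i') :=
  mapInd_congr fun k hk => replaceIndex_eq_swap (by rintro rfl; tauto)

lemma Seq.mapInd_replaceIndex {v : P → ℕ × ℕ} {m : Net T Ind} {Γ : Seq P Ind}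
    (h : NetValid v m Γ) {i i' : Ind} (h1 : csup m i' = 0) (h2 : csub m i' = 0) :
    Γ.mapInd (replaceIndex i i') = Γ.mapInd (Equiv.swap i i') :=
  Seq.mapInd_congr fun k hk => replaceIndex_eq_swap (by rintro rfl; have := h.2 k; omega)

end Renaming

section Fresh

lemma exists_fresh_list {α : Type*} [Infinite α] (F : Finset α) (n : ℕ) :
    ∃ l : List α, l.length = n ∧ l.Nodup ∧ ∀ x ∈ l, x ∉ F := by
  obtain ⟨t, h1, h2⟩ := (F.finite_toSet.infinite_compl).exists_subset_card_eq n
  refine ⟨t.toList, by simp [h2], t.nodup_toList, fun x hx => ?_⟩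
  simpa using h1 (by simpa using hx)

lemma exists_perm_list {α : Type*} [DecidableEq α] (l l' : List α) (h : l.length = l'.length)
    (hn : (l ++ l').Nodup) :
    ∃ f : Equiv.Perm α, l.map f = l' ∧ ∀ x, x ∉ l → x ∉ l' → f x = x := by
  induction l generalizing l' with
  | nil =>
    obtain rfl : l' = [] := List.length_eq_zero_iff.1 h.symm
    exact ⟨1, by simp⟩
  | cons a t ih =>
    obtain - | ⟨b, t'⟩ := l'
    · simp at h
    obtain ⟨f, h1, h2⟩ := ih t' (by simpa using h) (by
      simp only [List.cons_append, List.nodup_cons, List.nodup_append, List.mem_cons] at hn ⊢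
      exact ⟨hn.2.1, hn.2.2.1.2, fun x hx y hy => hn.2.2.2 x hx y (.inr hy)⟩)
    have hb : b ∉ t ∧ b ∉ t' := by
      simp only [List.cons_append, List.nodup_cons, List.nodup_append, List.mem_cons] at hn
      exact ⟨fun hb => hn.2.2.2 b hb b (.inl rfl) rfl, hn.2.2.1.1⟩
    refine ⟨f * Equiv.swap a b, ?_, fun x hx hx' => ?_⟩
    · simp only [List.map_cons, Equiv.Perm.coe_mul, Function.comp_apply, Equiv.swap_apply_left,
        h2 b hb.1 hb.2, List.cons.injEq, true_and]
      rw [← h1]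
      refine List.map_congr_left fun x hx => ?_
      rw [Function.comp_apply, Equiv.swap_apply_of_ne_of_ne]
      · rintro rfl
        simp [hx] at hn
      · rintro rfl
        exact hb.1 hx
    · simp only [List.mem_cons, not_or] at hx hx'
      simp [Equiv.swap_apply_of_ne_of_ne hx.1 hx'.1, h2 x hx.2 hx'.2]

/-- A permutation that moves `B` away from `F` and fixes the other elements of `F`. -/
lemma exists_perm_avoid {α : Type*} [DecidableEq α] [Infinite α] (B F : Finset α) :
    ∃ f : Equiv.Perm α, (∀ i ∈ B, f i ∉ F) ∧ ∀ i ∈ F, i ∉ B → f i = i := by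
  obtain ⟨l, h1, h2, h3⟩ := exists_fresh_list (B ∪ F) B.card
  obtain ⟨f, h4, h5⟩ := exists_perm_list B.toList l (by simp [h1]) (by
    rw [List.nodup_append]
    refine ⟨B.nodup_toList, h2, ?_⟩
    rintro x hx y hy rfl
    exact h3 x hy (Finset.mem_union_left _ (by simpa using hx)))
  refine ⟨f, fun i hi hF => ?_, fun i hF hi => h5 i (by simpa using hi) fun hl => h3 i hl
    (Finset.mem_union_right _ hF)⟩
  have : f i ∈ l := by
    rw [← h4]
    exact List.mem_map_of_mem (by simpa using hi)
  exact h3 _ this (Finset.mem_union_right _ hF)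

/-- Two lists without repetitions of the same length are related by a permutation. -/
lemma exists_perm_map_eq {α : Type*} [DecidableEq α] [Infinite α] (l l' : List α)
    (h : l.length = l'.length) (hn : l.Nodup) (hn' : l'.Nodup) :
    ∃ f : Equiv.Perm α, l.map f = l' := by
  obtain ⟨k, h1, h2, h3⟩ := exists_fresh_list (l.toFinset ∪ l'.toFinset) l.length
  have aux : ∀ j : List α, j.Nodup → (∀ x ∈ j, x ∈ l ∨ x ∈ l') → (j ++ k).Nodup := by
    intro j hj hj'
    rw [List.nodup_append]
    refine ⟨hj, h2, ?_⟩
    rintro x hx y hy rfl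
    have := h3 x hy
    simp at this
    have := hj' x hx
    tauto
  obtain ⟨f, hf, -⟩ := exists_perm_list l k h1.symm (aux l hn fun x => .inl)
  obtain ⟨g, hg, -⟩ := exists_perm_list l' k (h.symm.trans h1.symm) (aux l' hn' fun x => .inr)
  refine ⟨g⁻¹ * f, ?_⟩
  rw [Equiv.Perm.coe_mul, ← List.map_map, hf, ← hg, List.map_map, ← Equiv.Perm.coe_mul]
  simp

end Fresh

section Names

variable {P T Ind : Type*} [DecidableEq Ind]

def Net.names (m : Net T Ind) : Finset Ind := (m.bind Factor.sup + m.bind Factor.sub).toFinset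

lemma Net.mem_names {m : Net T Ind} {i : Ind} : i ∈ m.names ↔ 0 < csup m i ∨ 0 < csub m i := by
  simp only [names, csup, csub, Multiset.mem_toFinset, Multiset.mem_add, Multiset.count_pos]

def Seq.names (Γ : Seq P Ind) : Finset Ind :=
  ((Γ.bind fun A => (A.up : Multiset Ind)) + Γ.bind fun A => (A.lo : Multiset Ind)).toFinset

lemma Seq.mem_names {m : Seq P Ind} {i : Ind} : i ∈ m.names ↔ 0 < cup m i ∨ 0 < clo m i := by
  simp only [names, cup, clo, Multiset.mem_toFinset, Multiset.mem_add, Multiset.count_pos]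

/-- A predicate on judgements that does not depend on representatives. -/
structure NetPred (v : P → ℕ × ℕ) (Q : Net T Ind → Seq P Ind → Prop) : Prop where
  valid : ∀ {m Γ}, Q m Γ → NetValid v m Γ
  cong : ∀ {m n Γ}, Q m Γ → NetCong m n → Q n Γ
  perm : ∀ {m Γ}, Q m Γ → ∀ f : Equiv.Perm Ind,
    Q (m.map (Factor.mapInd f)) (Γ.map (TensorType.mapInd f))

lemma TypeSymbol.valency_ne_zero {v : P → ℕ × ℕ} (hv : ∀ p, v p ≠ 0) (A : TypeSymbol P) :
    A.valency v ≠ 0 := by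
  induction A with
  | pos p => exact hv p
  | neg p =>
    intro h
    refine hv p ?_
    have := congrArg Prod.swap h
    simpa [valency] using this
  | tensor A B h1 h2 => simp [valency, h1]
  | par A B h1 h2 => simp [valency, h1]

lemma TypeSymbol.valency_dual {v : P → ℕ × ℕ} (A : TypeSymbol P) :
    A.dual.valency v = (A.valency v).swap := by
  induction A with
  | pos p => rfl
  | neg p => simp [dual, valency]
  | tensor A B h1 h2 => simp [dual, valency, h1, h2, add_comm]
  | par A B h1 h2 => simp [dual, valency, h1, h2, add_comm]

@[simp] lemma TypeSymbol.dual_dual (A : TypeSymbol P) : A.dual.dual = A := by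
  induction A <;> simp_all [dual]

@[simp] lemma TensorType.dual_dual (A : TensorType P Ind) : A.dual.dual = A := by
  simp [dual]

@[simp] lemma TensorType.fits_dual {v : P → ℕ × ℕ} {A : TensorType P Ind} :
    A.dual.FitsValency v ↔ A.FitsValency v := by
  simp only [FitsValency, dual, TypeSymbol.valency_dual, List.length_reverse]
  rw [← Prod.swap_inj]
  simp

lemma TensorType.FitsValency.par {v : P → ℕ × ℕ} {A B : TensorType P Ind}
    (hA : A.FitsValency v) (hB : B.FitsValency v) : (A.par B).FitsValency v := by
  unfold FitsValency at *
  simp [TypeSymbol.valency, ← hA, ← hB]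

lemma TensorType.FitsValency.tensor {v : P → ℕ × ℕ} {A B : TensorType P Ind}
    (hA : A.FitsValency v) (hB : B.FitsValency v) : (A.tensor B).FitsValency v := by
  unfold FitsValency at *
  simp [TypeSymbol.valency, ← hA, ← hB]

lemma TensorType.dual_par (A B : TensorType P Ind) : (A.par B).dual = B.dual.tensor A.dual := by
  simp [dual, par, tensor, TypeSymbol.dual]

lemma TensorType.dual_tensor (A B : TensorType P Ind) : (A.tensor B).dual = B.dual.par A.dual := by
  simp [dual, par, tensor, TypeSymbol.dual]

lemma TensorType.FitsValency.length_eq {v : P → ℕ × ℕ} {A B : TensorType P Ind}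
    (hA : A.FitsValency v) (hB : B.FitsValency v) (h : A.sym = B.sym) :
    A.up.length = B.up.length ∧ A.lo.length = B.lo.length := by
  simp only [FitsValency, h] at *
  simpa using hA.trans hB.symm

lemma NetValid.ne_zero {v : P → ℕ × ℕ} (hv : ∀ p, v p ≠ 0) {m : Net T Ind} {C : TensorType P Ind}
    {Γ : Seq P Ind} (h : NetValid v m (C ::ₘ Γ)) : m ≠ 0 := by
  rintro rfl
  have h1 := h.1 C (by simp)
  have h2 : C.up = [] := List.eq_nil_iff_forall_not_mem.2 fun i hi => by
    have h3 := List.count_pos_iff.2 hi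
    have h4 := h.2 i
    simp at h4
    omega
  have h3 : C.lo = [] := List.eq_nil_iff_forall_not_mem.2 fun i hi => by
    have h3 := List.count_pos_iff.2 hi
    have h4 := h.2 i
    simp at h4
    omega
  refine TypeSymbol.valency_ne_zero hv C.sym ?_
  rw [← h1, h2, h3]
  rfl

end Names

section Glue

variable {P T Ind : Type*} [DecidableEq Ind]

/-- A wire that renames the index `p.2.1` into `p.2.2`. -/
def wire (p : Bool × Ind × Ind) : Factor T Ind :=
  if p.1 then .edge [] p.2.2 p.2.1 else .edge [] p.2.1 p.2.2

lemma NetCong.wire_sup {m : Net T Ind} (hm : NetWF m) {a b : Ind} (h1 : csup m b = 1)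
    (h2 : csub m b = 0) (h3 : csup m a = 0) (h4 : csub m a = 0) :
    NetCong (Factor.edge [] a b ::ₘ m) (m.map (Factor.mapInd (Equiv.swap b a))) := by
  have hb : b ∈ m.bind Factor.sup := Multiset.count_pos.1 (by rw [← csup, h1]; exact one_pos)
  obtain ⟨x, hx, hbx⟩ := Multiset.mem_bind.1 hb
  obtain ⟨m0, rfl⟩ := Multiset.exists_cons_of_mem hx
  cases x with
  | loop w => simp [Factor.sup] at hbx
  | edge w b' k =>
    simp only [Factor.sup, Multiset.mem_singleton] at hbx
    subst hbx
    simp [Factor.sup, Factor.sub, Multiset.count_singleton] at h1 h2 h3 h4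
    have hw : NetWF (Factor.edge w b k ::ₘ Factor.edge [] a b ::ₘ m0) := fun i => by
      have := hm i
      simp [Factor.sup, Factor.sub, Multiset.count_singleton] at this ⊢
      refine ⟨?_, ?_⟩
      · by_cases hia : i = a
        · subst hia; simp [h3]
        · simp [hia]; exact this.1
      · by_cases hib : i = b
        · subst hib; simp [h2]
        · simp [hib]; exact this.2
    have h5 := NetCong.glue hw
    rw [Multiset.cons_swap, Multiset.map_cons]
    have h6 : m0.map (Factor.mapInd (Equiv.swap b a)) = m0 := Net.mapInd_eq_self fun i hi => by
      refine Equiv.swap_apply_of_ne_of_ne ?_ ?_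
      · rintro rfl; omega
      · rintro rfl; omega
    rw [h6]
    have hk1 : k ≠ b := fun h => h2.1 h.symm
    have hk2 : k ≠ a := fun h => h4.1 h.symm
    simpa [Factor.mapInd, Equiv.swap_apply_of_ne_of_ne hk1 hk2] using h5

lemma NetCong.wire_sub {m : Net T Ind} (hm : NetWF m) {a b : Ind} (h1 : csub m b = 1)
    (h2 : csup m b = 0) (h3 : csup m a = 0) (h4 : csub m a = 0) :
    NetCong (Factor.edge [] b a ::ₘ m) (m.map (Factor.mapInd (Equiv.swap b a))) := by
  have hb : b ∈ m.bind Factor.sub := Multiset.count_pos.1 (by rw [← csub, h1]; exact one_pos)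
  obtain ⟨x, hx, hbx⟩ := Multiset.mem_bind.1 hb
  obtain ⟨m0, rfl⟩ := Multiset.exists_cons_of_mem hx
  cases x with
  | loop w => simp [Factor.sub] at hbx
  | edge w k b' =>
    simp only [Factor.sub, Multiset.mem_singleton] at hbx
    subst hbx
    simp [Factor.sup, Factor.sub, Multiset.count_singleton] at h1 h2 h3 h4
    have hw : NetWF (Factor.edge [] b a ::ₘ Factor.edge w k b ::ₘ m0) := fun i => by
      have := hm i
      simp [Factor.sup, Factor.sub, Multiset.count_singleton] at this ⊢
      refine ⟨?_, ?_⟩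
      · by_cases hib : i = b
        · subst hib; simp [h2]
        · simp [hib]; exact this.1
      · by_cases hia : i = a
        · subst hia; simp [h4]
        · simp [hia]; exact this.2
    have h5 := NetCong.glue hw
    rw [Multiset.map_cons]
    have h6 : m0.map (Factor.mapInd (Equiv.swap b a)) = m0 := Net.mapInd_eq_self fun i hi => by
      refine Equiv.swap_apply_of_ne_of_ne ?_ ?_
      · rintro rfl; omega
      · rintro rfl; omega
    rw [h6]
    have hk1 : k ≠ b := fun h => h2.1 h.symm
    have hk2 : k ≠ a := fun h => h3.1 h.symm
    simpa [Factor.mapInd, Equiv.swap_apply_of_ne_of_ne hk1 hk2] using h5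

lemma NetCong.exists_perm_wires (ps : List (Bool × Ind × Ind)) : ∀ m : Net T Ind, m ≠ 0 →
    NetWF m →
    (∀ p ∈ ps, (p.1 = true → csup m p.2.1 = 1 ∧ csub m p.2.1 = 0) ∧
      (p.1 = false → csub m p.2.1 = 1 ∧ csup m p.2.1 = 0) ∧
      csup m p.2.2 = 0 ∧ csub m p.2.2 = 0) →
    (ps.map (fun p => p.2.1) ++ ps.map (fun p => p.2.2)).Nodup →
    ∃ f : Equiv.Perm Ind, (∀ p ∈ ps, f p.2.1 = p.2.2) ∧
      (∀ x, x ∉ ps.map (fun p => p.2.1) → x ∉ ps.map (fun p => p.2.2) → f x = x) ∧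
      NetCong (m + ((ps.map wire : List (Factor T Ind)) : Net T Ind)) (m.map (Factor.mapInd f)) := by
  induction ps with
  | nil =>
    intro m h0 hm _ _
    refine ⟨1, by simp, by simp, ?_⟩
    rw [show m.map (Factor.mapInd (1 : Equiv.Perm Ind)) = m from Net.mapInd_eq_self (by simp)]
    simpa using NetCong.refl h0 hm
  | cons p ps ih =>
    intro m h0 hm hp hn
    obtain ⟨k, b, a⟩ := p
    have hba := hp (k, b, a) (by simp)
    simp only at hba
    have step : NetCong (wire (k, b, a) ::ₘ m) (m.map (Factor.mapInd (Equiv.swap b a))) := by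
      cases k with
      | true => exact NetCong.wire_sup hm (hba.1 rfl).1 (hba.1 rfl).2 hba.2.2.1 hba.2.2.2
      | false => exact NetCong.wire_sub hm (hba.2.1 rfl).1 (hba.2.1 rfl).2 hba.2.2.1 hba.2.2.2
    simp only [List.map_cons, List.cons_append, List.nodup_cons, List.mem_append, List.mem_cons,
      not_or, List.nodup_append] at hn
    obtain ⟨⟨hn1, hn2, hn3⟩, hn4, ⟨hn5, hn6⟩, hn7⟩ := hn
    have hn7' : a ∉ ps.map fun p => p.2.1 := fun h => (hn7 a h a (.inl rfl)) rfl
    have hsw : ∀ p ∈ ps, Equiv.swap b a p.2.1 = p.2.1 ∧ Equiv.swap b a p.2.2 = p.2.2 := by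
      intro p hpp
      refine ⟨Equiv.swap_apply_of_ne_of_ne ?_ ?_, Equiv.swap_apply_of_ne_of_ne ?_ ?_⟩
      · rintro rfl; exact hn1 (List.mem_map.2 ⟨p, hpp, rfl⟩)
      · rintro rfl; exact hn7' (List.mem_map.2 ⟨p, hpp, rfl⟩)
      · rintro rfl; exact hn3 (List.mem_map.2 ⟨p, hpp, rfl⟩)
      · rintro rfl; exact hn5 (List.mem_map.2 ⟨p, hpp, rfl⟩)
    obtain ⟨f, hf1, hf2, hf3⟩ := ih (m.map (Factor.mapInd (Equiv.swap b a))) (by simpa using h0)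
      (hm.mapInd _) (fun p hpp => by
        have h1 := hp p (by simp [hpp])
        obtain ⟨h2, h3⟩ := hsw p hpp
        have e1 := csup_mapInd (Equiv.swap b a) m p.2.1
        have e2 := csub_mapInd (Equiv.swap b a) m p.2.1
        have e3 := csup_mapInd (Equiv.swap b a) m p.2.2
        have e4 := csub_mapInd (Equiv.swap b a) m p.2.2
        rw [h2] at e1 e2
        rw [h3] at e3 e4
        rwa [e1, e2, e3, e4])
      (by
        simp only [List.nodup_append]
        exact ⟨hn4, hn6, fun x hx y hy => hn7 x hx y (.inr hy)⟩)
    refine ⟨f * Equiv.swap b a, ?_, ?_, ?_⟩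
    · intro p hpp
      rcases List.mem_cons.1 hpp with rfl | hpp
      · simp [hf2 a hn7' hn5]
      · simp [(hsw p hpp).1, hf1 p hpp]
    · intro x hx hx'
      simp only [List.map_cons, List.mem_cons, not_or] at hx hx'
      simp [Equiv.swap_apply_of_ne_of_ne hx.1 hx'.1, hf2 x hx.2 hx'.2]
    · have e1 : m + ((List.map wire ((k, b, a) :: ps) : List (Factor T Ind)) : Multiset _) =
          (wire (k, b, a) ::ₘ m) + ((ps.map wire : List (Factor T Ind)) : Net T Ind) := by
        rw [List.map_cons, ← Multiset.cons_coe, Multiset.add_cons, Multiset.cons_add]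
      have e2 : (m.map (Factor.mapInd (Equiv.swap b a))).map (Factor.mapInd f) =
          m.map (Factor.mapInd (f * Equiv.swap b a : Equiv.Perm Ind)) := by
        simp
      rw [e1, ← e2]
      have hw2 := hf3.wf_left
      refine NetCong.trans (NetCong.add step ?_ hw2) hf3
      intro i
      have c1 := hw2 i
      have c2 := step.count i
      have c3 := step.wf_left i
      by_cases hz : i ∈ ps.map (fun p => p.2.1) ∨ i ∈ ps.map (fun p => p.2.2)
      · obtain ⟨p, hpp, hpi⟩ : ∃ p ∈ ps, p.2.1 = i ∨ p.2.2 = i := by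
          rcases hz with h | h <;> obtain ⟨p, h1, h2⟩ := List.mem_map.1 h
          · exact ⟨p, h1, .inl h2⟩
          · exact ⟨p, h1, .inr h2⟩
        have hib : i ≠ b := by
          rintro rfl
          rcases hz with h | h
          · exact hn1 h
          · exact hn3 h
        have hia : i ≠ a := by
          rintro rfl
          rcases hz with h | h
          · exact hn7' h
          · exact hn5 h
        have d1 : csup (wire (k, b, a) ::ₘ m) i = csup m i := by
          cases k <;> simp [wire, Factor.sup, hib, hia]
        have d2 : csub (wire (k, b, a) ::ₘ m) i = csub m i := by
          cases k <;> simp [wire, Factor.sub, hib, hia]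
        have e1 := csup_mapInd (Equiv.swap b a) m i
        have e2 := csub_mapInd (Equiv.swap b a) m i
        rw [Equiv.swap_apply_of_ne_of_ne hib hia] at e1 e2
        simp only [csup_add, csub_add] at c1 ⊢
        omega
      · have d1 : ∀ qs : List (Bool × Ind × Ind), (∀ p ∈ qs, i ≠ p.2.1 ∧ i ≠ p.2.2) →
            csup ((qs.map wire : List (Factor T Ind)) : Multiset (Factor T Ind)) i = 0 ∧
            csub ((qs.map wire : List (Factor T Ind)) : Multiset (Factor T Ind)) i = 0 := by
          intro qs hq
          induction qs with
          | nil => simp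
          | cons q qs ih =>
            obtain ⟨k', b', a'⟩ := q
            have q1 := hq (k', b', a') (by simp)
            have q2 := ih fun p hp => hq p (by simp [hp])
            cases k' <;>
            simp [← Multiset.cons_coe, wire, Factor.sup, Factor.sub, q2,
              q1.1, q1.2]
        have d2 := d1 ps fun p hp => ⟨fun h => hz (.inl (h ▸ List.mem_map_of_mem hp)),
          fun h => hz (.inr (h ▸ List.mem_map_of_mem hp))⟩
        simp only [csup_add, csub_add] at c1 ⊢
        omega

/-- The wires that rename the indices of the type `C` into those of `C'`. -/
def idNet (C C' : TensorType P Ind) : Net T Ind :=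
  (List.zipWith (Factor.edge []) C'.lo C.lo : List (Factor T Ind)) +
  (List.zipWith (Factor.edge []) C.up C'.up : List (Factor T Ind))

lemma count_zipWith_edge {I J : List Ind} (h : I.length = J.length) (i : Ind) :
    csup ((List.zipWith (Factor.edge []) I J : List (Factor T Ind)) : Net T Ind) i = I.count i ∧
    csub ((List.zipWith (Factor.edge []) I J : List (Factor T Ind)) : Net T Ind) i = J.count i := by
  induction I generalizing J with
  | nil =>
    obtain rfl : J = [] := List.length_eq_zero_iff.1 h.symm
    simp
  | cons a I ih =>
    obtain - | ⟨b, J⟩ := J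
    · simp at h
    have := ih (J := J) (by simpa using h)
    rw [List.zipWith_cons_cons, ← Multiset.cons_coe, csup_cons, csub_cons, this.1, this.2,
      List.count_cons, List.count_cons]
    simp only [Factor.sup, Factor.sub, Multiset.count_singleton, beq_iff_eq, eq_comm (a := i)]
    omega

lemma csup_idNet {v : P → ℕ × ℕ} {C C' : TensorType P Ind} (h : C.FitsValency v)
    (h' : C'.FitsValency v) (hs : C'.sym = C.sym) (i : Ind) :
    csup (idNet C C' : Net T Ind) i = C'.lo.count i + C.up.count i := by
  have hl := h'.length_eq h hs
  simp [-Multiset.coe_add, idNet, (count_zipWith_edge (T := T) hl.2 i).1, (count_zipWith_edge (T := T) hl.1.symm i).1]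

lemma csub_idNet {v : P → ℕ × ℕ} {C C' : TensorType P Ind} (h : C.FitsValency v)
    (h' : C'.FitsValency v) (hs : C'.sym = C.sym) (i : Ind) :
    csub (idNet C C' : Net T Ind) i = C.lo.count i + C'.up.count i := by
  have hl := h'.length_eq h hs
  simp [-Multiset.coe_add, idNet, (count_zipWith_edge (T := T) hl.2 i).2, (count_zipWith_edge (T := T) hl.1.symm i).2]

lemma zipWith_edge_eq_map_wire (I J : List Ind) :
    (List.zipWith (Factor.edge []) I J : List (Factor T Ind)) =
      (List.zip J I).map (fun p => wire (true, p)) ∧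
    (List.zipWith (Factor.edge []) I J : List (Factor T Ind)) =
      (List.zip I J).map (fun p => wire (false, p)) := by
  induction I generalizing J with
  | nil => simp
  | cons a I ih =>
    obtain - | ⟨b, J⟩ := J
    · simp
    · simp only [List.zipWith_cons_cons, List.zip_cons_cons, List.map_cons, wire]
      rw [(ih J).1]
      refine ⟨by simp [wire], ?_⟩
      rw [← (ih J).1, (ih J).2]
      simp [wire]

lemma NetCong.exists_perm_idNet {v : P → ℕ × ℕ} (hv : ∀ p, v p ≠ 0) {m : Net T Ind}
    {C C' : TensorType P Ind} {Θ : Seq P Ind} (hs : C'.sym = C.sym) (hm : NetValid v m (C ::ₘ Θ))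
    (hm' : NetValid v (m + idNet C C') (C' ::ₘ Θ)) :
    ∃ f : Equiv.Perm Ind, C.mapInd f = C' ∧ Θ.map (TensorType.mapInd f) = Θ ∧
      NetCong (m + idNet C C') (m.map (Factor.mapInd f)) := by
  have hC := hm.1 C (by simp)
  have hC' := hm'.1 C' (by simp)
  have hl := hC.length_eq hC' hs.symm
  have hcount : ∀ i, _ := fun i => And.intro (hm.2 i) (hm'.2 i)
  simp only [csup_add, csub_add, cup_cons, clo_cons, csup_idNet hC hC' hs,
    csub_idNet hC hC' hs] at hcount
  have key := NetCong.exists_perm_wires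
    ((List.zip C.lo C'.lo).map (Prod.mk true) ++ (List.zip C.up C'.up).map (Prod.mk false)) m
    (hm.ne_zero hv) hm.wf ?_ ?_
  · obtain ⟨f, h1, h2, h3⟩ := key
    simp only [List.map_append, List.map_map] at h3 h2
    have e1 : ∀ l l' : List Ind, l.length = l'.length →
        (l.zip l').map (fun x => x.1) = l ∧ (l.zip l').map (fun x => x.2) = l' := fun l l' h =>
      ⟨List.map_fst_zip (by omega), List.map_snd_zip (by omega)⟩
    have e2 : ∀ (l l' : List Ind), l.length = l'.length →
        (∀ p ∈ List.zip l l', f p.1 = p.2) → l.map f = l' := by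
      intro l l' h hp
      conv_lhs => rw [← (e1 l l' h).1]
      conv_rhs => rw [← (e1 l l' h).2]
      rw [List.map_map]
      exact List.map_congr_left hp
    refine ⟨f, ?_, ?_, ?_⟩
    · have h4 := e2 C.lo C'.lo hl.2 fun p hp => h1 (true, p) (by simp [hp])
      have h5 := e2 C.up C'.up hl.1 fun p hp => h1 (false, p) (by simp [hp])
      cases C'
      simp only [TensorType.mapInd, TensorType.mk.injEq]
      exact ⟨hs.symm, h5, h4⟩
    · refine Seq.mapInd_eq_self fun i hi => h2 i ?_ ?_
      · rw [show ((fun p : Bool × Ind × Ind => p.2.1) ∘ Prod.mk true) = fun x => x.1 from rfl,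
          show ((fun p : Bool × Ind × Ind => p.2.1) ∘ Prod.mk false) = fun x => x.1 from rfl,
          (e1 _ _ hl.1).1, (e1 _ _ hl.2).1, List.mem_append, ← List.count_pos_iff,
          ← List.count_pos_iff]
        have := hcount i
        omega
      · rw [show ((fun p : Bool × Ind × Ind => p.2.2) ∘ Prod.mk true) = fun x => x.2 from rfl,
          show ((fun p : Bool × Ind × Ind => p.2.2) ∘ Prod.mk false) = fun x => x.2 from rfl,
          (e1 _ _ hl.1).2, (e1 _ _ hl.2).2, List.mem_append, ← List.count_pos_iff,
          ← List.count_pos_iff]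
        have := hcount i
        omega
    · rw [idNet, (zipWith_edge_eq_map_wire C'.lo C.lo).1, (zipWith_edge_eq_map_wire C.up C'.up).2,
        Multiset.coe_add]
      exact h3
  · intro p hp
    simp only [List.mem_append, List.mem_map] at hp
    rcases hp with ⟨⟨b, a⟩, hp, rfl⟩ | ⟨⟨b, a⟩, hp, rfl⟩
    · have hb := List.count_pos_iff.2 (List.of_mem_zip hp).1
      have ha := List.count_pos_iff.2 (List.of_mem_zip hp).2
      have cb := hcount b
      have ca := hcount a
      simp only [true_implies, reduceCtorEq, false_implies, true_and]
      omega
    · have hb := List.count_pos_iff.2 (List.of_mem_zip hp).1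
      have ha := List.count_pos_iff.2 (List.of_mem_zip hp).2
      have cb := hcount b
      have ca := hcount a
      simp only [true_implies, reduceCtorEq, false_implies, true_and]
      omega
  · rw [List.nodup_iff_count_le_one]
    intro i
    simp only [List.map_append, List.map_map]
    rw [show ((fun p : Bool × Ind × Ind => p.2.1) ∘ Prod.mk true) = fun x => x.1 from rfl,
      show ((fun p : Bool × Ind × Ind => p.2.1) ∘ Prod.mk false) = fun x => x.1 from rfl,
      show ((fun p : Bool × Ind × Ind => p.2.2) ∘ Prod.mk true) = fun x => x.2 from rfl,
      show ((fun p : Bool × Ind × Ind => p.2.2) ∘ Prod.mk false) = fun x => x.2 from rfl,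
      List.map_fst_zip (by omega), List.map_snd_zip (by omega),
      List.map_fst_zip (by omega), List.map_snd_zip (by omega)]
    simp only [List.count_append]
    have := hcount i
    omega

/-- Composing with an identity renames the indices of a type. -/
theorem NetPred.idNet_iff {v : P → ℕ × ℕ} (hv : ∀ p, v p ≠ 0)
    {Q : Net T Ind → Seq P Ind → Prop} (hQ : NetPred v Q) {m : Net T Ind}
    {C C' : TensorType P Ind} {Θ : Seq P Ind} (hs : C'.sym = C.sym) (hm : NetValid v m (C ::ₘ Θ))
    (hm' : NetValid v (m + idNet C C') (C' ::ₘ Θ)) :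
    Q (m + idNet C C') (C' ::ₘ Θ) ↔ Q m (C ::ₘ Θ) := by
  obtain ⟨f, rfl, h2, h3⟩ := NetCong.exists_perm_idNet hv hs hm hm'
  constructor
  · intro h
    have h4 := hQ.perm (hQ.cong h h3) f⁻¹
    have h2' : Θ.map (TensorType.mapInd (f⁻¹ : Equiv.Perm Ind)) = Θ := by
      conv_lhs => rw [← h2]
      simp [Function.comp_def]
    rw [Multiset.map_cons, h2'] at h4
    simpa [Function.comp_def] using h4
  · intro h
    have h4 := hQ.perm h f
    rw [Multiset.map_cons, h2] at h4
    exact hQ.cong h4 h3.symm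

lemma exists_fresh_copy [Infinite Ind] {v : P → ℕ × ℕ} {C : TensorType P Ind}
    (hC : C.FitsValency v) (F : Finset Ind) :
    ∃ C' : TensorType P Ind, C'.sym = C.sym ∧ C'.FitsValency v ∧
      ∀ i, C'.up.count i + C'.lo.count i ≤ 1 ∧
        (i ∈ F → C'.up.count i = 0 ∧ C'.lo.count i = 0) := by
  obtain ⟨l, h1, h2, h3⟩ := exists_fresh_list F (C.up.length + C.lo.length)
  refine ⟨⟨C.sym, l.take C.up.length, l.drop C.up.length⟩, rfl, ?_, fun i => ⟨?_, fun hi => ?_⟩⟩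
  · simp only [TensorType.FitsValency] at hC ⊢
    rw [← hC, List.length_take, List.length_drop, h1]
    simp
  · rw [← List.count_append, List.take_append_drop]
    exact List.nodup_iff_count_le_one.1 h2 i
  · simp only [List.count_eq_zero]
    exact ⟨fun h => h3 i (List.mem_of_mem_take h) hi, fun h => h3 i (List.mem_of_mem_drop h) hi⟩

lemma exists_fresh_type [Infinite Ind] {v : P → ℕ × ℕ} {C : TensorType P Ind}
    (hC : C.FitsValency v) (m : Net T Ind) (Γ : Seq P Ind) :
    ∃ C' : TensorType P Ind, C'.sym = C.sym ∧ C'.FitsValency v ∧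
      ∀ i, C'.up.count i + C'.lo.count i ≤ 1 ∧
        ((C'.up.count i = 0 ∧ C'.lo.count i = 0) ∨
          (csup m i = 0 ∧ csub m i = 0 ∧ cup Γ i = 0 ∧ clo Γ i = 0)) := by
  obtain ⟨C', h1, h2, h3⟩ := exists_fresh_copy hC (m.names ∪ Γ.names)
  refine ⟨C', h1, h2, fun i => ⟨(h3 i).1, ?_⟩⟩
  by_cases hi : i ∈ m.names ∪ Γ.names
  · exact .inl ((h3 i).2 hi)
  · simp only [Finset.mem_union, Net.mem_names, Seq.mem_names, not_or, not_lt, Nat.le_zero] at hi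
    exact .inr ⟨hi.1.1, hi.1.2, hi.2.1, hi.2.2⟩

/-- Every net is congruent to one without bound indices. -/
lemma NetCong.exists_reduced {m : Net T Ind} (h0 : m ≠ 0) (hm : NetWF m) :
    ∃ n, NetCong m n ∧ ∀ i, csup n i = 0 ∨ csub n i = 0 := by
  have key : ∀ (N : ℕ) (m : Net T Ind), (m.bind Factor.sup).card = N → m ≠ 0 → NetWF m →
      ∃ n, NetCong m n ∧ ∀ i, csup n i = 0 ∨ csub n i = 0 := by
    intro N
    induction N using Nat.strong_induction_on with
    | _ N ih =>
      intro m hN h0 hm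
      by_cases h : ∀ i, csup m i = 0 ∨ csub m i = 0
      · exact ⟨m, .refl h0 hm, h⟩
      push Not at h
      obtain ⟨i, hi1, hi2⟩ := h
      obtain ⟨x, hx, hix⟩ := Multiset.mem_bind.1 (Multiset.count_pos.1 (Nat.pos_of_ne_zero hi1))
      obtain ⟨y, hy, hiy⟩ := Multiset.mem_bind.1 (Multiset.count_pos.1 (Nat.pos_of_ne_zero hi2))
      cases x with
      | loop w => simp [Factor.sup] at hix
      | edge u i' k =>
      cases y with
      | loop w => simp [Factor.sub] at hiy
      | edge v l i'' =>
      simp only [Factor.sup, Factor.sub, Multiset.mem_singleton] at hix hiy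
      subst hix
      subst hiy
      obtain ⟨m0, rfl⟩ := Multiset.exists_cons_of_mem hx
      rcases Multiset.mem_cons.1 hy with hxy | hy
      · cases hxy
        have h1 := NetCong.loop hm
        obtain ⟨n, h2, h3⟩ := ih _ (by rw [← hN]; simp [Factor.sup]) (Factor.loop u ::ₘ m0) rfl
          h1.symm.ne_zero h1.wf_right
        exact ⟨n, h1.trans h2, h3⟩
      · obtain ⟨m1, rfl⟩ := Multiset.exists_cons_of_mem hy
        have h1 := NetCong.glue hm
        obtain ⟨n, h2, h3⟩ := ih _ (by rw [← hN]; simp [Factor.sup])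
          (Factor.edge (u ++ v) l k ::ₘ m1) rfl h1.symm.ne_zero h1.wf_right
        exact ⟨n, h1.trans h2, h3⟩
  exact key _ m rfl h0 hm

end Glue

section Polarity

variable {P Ind : Type*}

lemma ImpType.toSymbol_ne_dual (F H : ImpType P) : F.toSymbol ≠ H.toSymbol.dual := by
  cases F <;> cases H <;> simp [ImpType.toSymbol, TypeSymbol.dual]

lemma TypeSymbol.dual_injective : Function.Injective (TypeSymbol.dual (P := P)) := fun A B h => by
  have := congrArg TypeSymbol.dual h
  simpa using this

lemma ImpType.toSymbol_injective : Function.Injective (ImpType.toSymbol (P := P)) := by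
  intro F
  induction F with
  | atom p => intro H h; cases H <;> simp_all [ImpType.toSymbol]
  | imp A B hA hB =>
    intro H h
    cases H with
    | atom p => simp [ImpType.toSymbol] at h
    | imp A' B' =>
      simp only [ImpType.toSymbol, TypeSymbol.par.injEq] at h
      rw [hB h.1, hA (TypeSymbol.dual_injective h.2)]

/-- The symbol of a type is implicational or dual to an implicational one. -/
def TypeSymbol.Pos (A : TypeSymbol P) : Prop := ∃ F : ImpType P, A = F.toSymbol

def TypeSymbol.Neg (A : TypeSymbol P) : Prop := ∃ F : ImpType P, A = F.toSymbol.dual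

lemma TypeSymbol.Pos.not_neg {A : TypeSymbol P} (h : A.Pos) : ¬ A.Neg := by
  obtain ⟨F, rfl⟩ := h
  rintro ⟨H, hH⟩
  exact F.toSymbol_ne_dual H hH

lemma TypeSymbol.Pos.dual {A : TypeSymbol P} (h : A.Pos) : A.dual.Neg := by
  obtain ⟨F, rfl⟩ := h
  exact ⟨F, rfl⟩

lemma TypeSymbol.Neg.dual {A : TypeSymbol P} (h : A.Neg) : A.dual.Pos := by
  obtain ⟨F, rfl⟩ := h
  exact ⟨F, by simp⟩

end Polarity

section Lam

variable {X C : Type*} [DecidableEq X]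

namespace LamTerm

lemma rename_closeAt (r : Equiv.Perm X) (x : X) (t : LamTerm X C) (k : ℕ) :
    (closeAt x k t).rename r = closeAt (r x) k (t.rename r) := by
  induction t generalizing k with
  | bvar n => rfl
  | fvar y =>
    by_cases h : y = x
    · simp [closeAt, rename, h]
    · simp [closeAt, rename, h]
  | con c => rfl
  | app t s h1 h2 => simp [closeAt, rename, h1, h2]
  | abs t h => simp [closeAt, rename, h]

lemma rename_lam (r : Equiv.Perm X) (x : X) (t : LamTerm X C) :
    (lam x t).rename r = lam (r x) (t.rename r) := by
  simp [lam, rename, rename_closeAt]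

end LamTerm

end Lam

section Identity

variable {P T Ind : Type*} [DecidableEq Ind]

lemma flat_delta (I J : List Ind) (h : I.length = J.length) (h0 : I ≠ []) :
    (delta I J : TensorTerm T Ind).flat =
      ((List.zipWith (Factor.edge []) I J : List (Factor T Ind)) : Net T Ind) := by
  induction I generalizing J with
  | nil => exact absurd rfl h0
  | cons i I ih =>
    obtain - | ⟨j, J⟩ := J
    · simp at h
    obtain - | ⟨i', I⟩ := I
    · obtain - | ⟨j', J⟩ := J
      · simp [delta, flat]
      · simp at h
    · obtain - | ⟨j', J⟩ := J
      · simp at h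
      · have := ih (j' :: J) (by simpa using h) (by simp)
        simp only [delta, flat, this]
        simp

lemma mapInd_delta (f : Ind → Ind) (I J : List Ind) :
    (delta I J : TensorTerm T Ind).mapInd f = delta (I.map f) (J.map f) := by
  induction I generalizing J with
  | nil => cases J <;> simp [delta, mapInd]
  | cons i I ih =>
    obtain - | ⟨j, J⟩ := J
    · cases I <;> simp [delta, mapInd]
    obtain - | ⟨i', I⟩ := I
    · obtain - | ⟨j', J⟩ := J
      · simp [delta, mapInd]
      · have := ih (j' :: J)
        simp only [List.map_nil, List.map_cons] at this
        simp [delta, mapInd]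
    · have := ih J
      simp only [List.map_cons] at this
      cases J <;> simp [delta, mapInd, this]

lemma mapInd_idTerm (f : Ind → Ind) (U L U' L' : List Ind) :
    (idTerm U L U' L' : TensorTerm T Ind).mapInd f =
      idTerm (U.map f) (L.map f) (U'.map f) (L'.map f) := by
  simp [idTerm, mapInd_delta]

lemma flat_idTerm {v : P → ℕ × ℕ} (hv : ∀ p, v p ≠ 0) {C C' : TensorType P Ind}
    (hC : C.FitsValency v) (hC' : C'.FitsValency v) (hs : C'.sym = C.sym) :
    (idTerm C'.up C'.lo C.dual.up C.dual.lo : TensorTerm T Ind).flat = idNet C C' := by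
  have hl := hC.length_eq hC' hs.symm
  rw [idTerm, flat_delta, TensorType.up_dual, TensorType.lo_dual, List.reverse_reverse,
    List.reverse_reverse, List.zipWith_append hl.2.symm, idNet, Multiset.coe_add]
  · simp [hl, add_comm]
  · intro h
    simp only [TensorType.lo_dual, List.reverse_reverse, List.append_eq_nil_iff] at h
    refine TypeSymbol.valency_ne_zero hv C.sym ?_
    rw [← hC, hl.2, h.1, h.2]
    rfl

lemma idNet_dual {v : P → ℕ × ℕ} {C C' : TensorType P Ind}
    (hC : C.FitsValency v) (hC' : C'.FitsValency v) (hs : C'.sym = C.sym) :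
    (idNet C'.dual C.dual : Net T Ind) = idNet C C' := by
  have hl := hC.length_eq hC' hs.symm
  simp only [idNet, TensorType.up_dual, TensorType.lo_dual]
  rw [← List.reverse_zipWith hl.1, ← List.reverse_zipWith hl.2.symm, Multiset.coe_reverse,
    Multiset.coe_reverse, add_comm]

lemma NetValid.cong {v : P → ℕ × ℕ} {m n : Net T Ind} {Γ : Seq P Ind} (h : NetValid v m Γ)
    (hc : NetCong m n) : NetValid v n Γ := by
  refine ⟨h.1, fun i => ?_⟩
  have h1 := h.2 i
  have h2 := hc.count i
  have h3 := hc.wf_right i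
  omega

lemma NetValid.par {v : P → ℕ × ℕ} {m : Net T Ind} {Γ : Seq P Ind} {A B : TensorType P Ind}
    (h : NetValid v m (A ::ₘ B ::ₘ Γ)) : NetValid v m (A.par B ::ₘ Γ) := by
  have h1 := h.1
  simp only [Multiset.mem_cons, forall_eq_or_imp] at h1
  refine ⟨?_, fun i => ?_⟩
  · simp only [Multiset.mem_cons, forall_eq_or_imp]
    exact ⟨h1.1.par h1.2.1, h1.2.2⟩
  · have := h.2 i
    simp at this ⊢
    omega

end Identity

section Basic

variable {P C T X Ind : Type*} [DecidableEq X] [DecidableEq Ind]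
  {S : LamSignature P C} {R : TensorTranslation P C T Ind}

/-- The links of a collection of linked assumptions. -/
abbrev links (Δ : Multiset (LinkedAssumption P X Ind)) : Seq P Ind :=
  Δ.map LinkedAssumption.link

def LinkedAssumption.mapLink (f : Ind → Ind) (a : LinkedAssumption P X Ind) :
    LinkedAssumption P X Ind := ⟨a.var, a.type, a.link.mapInd f⟩

lemma links_mapLink (f : Ind → Ind) (Δ : Multiset (LinkedAssumption P X Ind)) :
    links (Δ.map (LinkedAssumption.mapLink f)) = (links Δ).map (TensorType.mapInd f) := by
  simp [links, LinkedAssumption.mapLink, Function.comp_def]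

lemma NetValid.alpha {v : P → ℕ × ℕ} {e : TensorTerm T Ind} {Γ : Seq P Ind}
    (h : NetValid v e.flat Γ) {i i' : Ind} (h1 : i' ∉ e.sups) (h2 : i' ∉ e.subs) :
    e.mapInd (replaceIndex i i') = e.mapInd (Equiv.swap i i') ∧
    Γ.map (TensorType.mapInd (replaceIndex i i')) =
      Γ.map (TensorType.mapInd (Equiv.swap i i')) := by
  refine ⟨mapInd_replaceIndex h1 h2, Seq.mapInd_replaceIndex h ?_ ?_⟩
  · simpa [mem_sups_iff] using h1
  · simpa [mem_subs_iff] using h2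

/-- Basic invariants of the translation. -/
lemma Translates.invariants {Δ : Multiset (LinkedAssumption P X Ind)} {t : LamTerm X C}
    {A : ImpType P} {e : TensorTerm T Ind} {L : TensorType P Ind}
    (h : Translates S R Δ t A e L) :
    NetValid R.val e.flat (L ::ₘ links Δ) ∧ (Δ.map LinkedAssumption.var).Nodup ∧
      L.sym = A.toSymbol ∧ ∀ a ∈ Δ, a.link.sym = a.type.toSymbol.dual := by
  induction h with
  | var x A hv =>
    refine ⟨?_, by simp, rfl, by simp⟩
    have := (valid_iff _ _ _).1 hv
    simpa [links] using this
  | con c h1 h2 h3 => exact ⟨by simpa [links] using (valid_iff _ _ _).1 h3, by simp, h2, by simp⟩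
  | @lam Δ x t A B e L M _ ih =>
    obtain ⟨h1, h2, h3, h4⟩ := ih
    simp only [links, Multiset.map_cons, Multiset.nodup_cons, Multiset.mem_cons,
      forall_eq_or_imp] at h1 h2 h4
    exact ⟨h1.par, h2.2, by simp [h3, h4.1, ImpType.toSymbol], h4.2⟩
  | app _ _ hn hv ih1 ih2 =>
    refine ⟨(valid_iff _ _ _).1 hv, hn, ?_, ?_⟩
    · have := ih1.2.2.1
      simp only [TensorType.sym_par, ImpType.toSymbol, TypeSymbol.par.injEq] at this
      exact this.1
    · intro a ha
      rcases Multiset.mem_add.1 ha with ha | ha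
      · exact ih1.2.2.2 a ha
      · exact ih2.2.2.2 a ha
  | cong _ hc ih => exact ⟨ih.1.cong ⟨_, _, rfl, rfl, hc⟩, ih.2⟩
  | @alpha Δ t A e L i i' _ hi h1 h2 ih =>
    have h3 := ih.1.alpha (i := i) h1 h2
    refine ⟨?_, by simpa using ih.2.1, ih.2.2.1, ?_⟩
    · have h4 := ih.1.mapInd (Equiv.swap i i')
      rw [← h3.2, ← flat_mapInd, ← h3.1, Multiset.map_cons, ← links_mapLink] at h4
      exact h4
    · intro a ha
      obtain ⟨b, hb, rfl⟩ := Multiset.mem_map.1 ha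
      exact ih.2.2.2 b hb

lemma Translates.lamDer {Δ : Multiset (LinkedAssumption P X Ind)} {t : LamTerm X C}
    {A : ImpType P} {e : TensorTerm T Ind} {L : TensorType P Ind}
    (h : Translates S R Δ t A e L) : LamDer S (Δ.map LinkedAssumption.assumption) t A := by
  induction h with
  | var x A hv => exact .var x A
  | con c h1 h2 h3 => exact .con c
  | lam _ ih => exact .lam (by simpa [LinkedAssumption.assumption] using ih)
  | app _ _ hn hv ih1 ih2 =>
    rw [Multiset.map_add]
    refine .app ih1 ih2 ?_
    rw [← Multiset.map_add, Multiset.map_map]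
    exact hn
  | cong _ hc ih => exact ih
  | alpha _ hi h1 h2 ih =>
    rw [Multiset.map_map]
    exact ih

lemma comp_replaceIndex (f : Equiv.Perm Ind) (i i' : Ind) :
    f ∘ replaceIndex i i' = replaceIndex (f i) (f i') ∘ f := by
  funext k
  simp only [Function.comp_apply, replaceIndex]
  by_cases h : k = i
  · simp [h]
  · simp [h]

@[simp] lemma TensorTerm.mapInd_mapInd (f g : Ind → Ind) (e : TensorTerm T Ind) :
    (e.mapInd f).mapInd g = e.mapInd (g ∘ f) := by
  induction e with
  | edge w i j => rfl
  | loop w => rfl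
  | mul t s h1 h2 => simp only [TensorTerm.mapInd, h1, h2]

lemma TensorTerm.sups_mapInd (f : Ind → Ind) (e : TensorTerm T Ind) :
    (e.mapInd f).sups = e.sups.map f := by
  induction e with
  | edge w i j => rfl
  | loop w => rfl
  | mul t s h1 h2 => simp [TensorTerm.mapInd, sups, h1, h2]

lemma TensorTerm.subs_mapInd (f : Ind → Ind) (e : TensorTerm T Ind) :
    (e.mapInd f).subs = e.subs.map f := by
  induction e with
  | edge w i j => rfl
  | loop w => rfl
  | mul t s h1 h2 => simp [TensorTerm.mapInd, subs, h1, h2]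

/-- The representatives of the translations of the constants are closed under permutations of
indices. -/
def TensorTranslation.Equivariant (R : TensorTranslation P C T Ind) : Prop :=
  ∀ c e L (f : Equiv.Perm Ind), R.conTr c e L → R.conTr c (e.mapInd f) (L.mapInd f)

lemma Translates.mapInd (hR : R.Equivariant) {Δ : Multiset (LinkedAssumption P X Ind)}
    {t : LamTerm X C} {A : ImpType P} {e : TensorTerm T Ind} {L : TensorType P Ind}
    (h : Translates S R Δ t A e L) (f : Equiv.Perm Ind) :
    Translates S R (Δ.map (LinkedAssumption.mapLink f)) t A (e.mapInd f) (L.mapInd f) := by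
  induction h with
  | var x A hv =>
    rw [mapInd_idTerm]
    refine .var x A ?_
    rw [← mapInd_idTerm, valid_iff, flat_mapInd]
    have := ((valid_iff _ _ _).1 hv).mapInd f
    simpa [TensorType.mapInd] using this
  | con c h1 h2 h3 =>
    refine .con c (hR _ _ _ f h1) h2 ?_
    have := ((valid_iff _ _ _).1 h3).mapInd f
    rw [valid_iff, flat_mapInd]
    simpa using this
  | lam _ ih =>
    rw [TensorType.mapInd_par]
    refine .lam ?_
    simpa [LinkedAssumption.mapLink] using ih
  | app _ _ hn hv ih1 ih2 =>
    rw [Multiset.map_add]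
    refine .app (by rwa [TensorType.mapInd_par] at ih1) (by rwa [TensorType.mapInd_dual] at ih2)
      ?_ ?_
    · rw [← Multiset.map_add, Multiset.map_map]
      exact hn
    · have := ((valid_iff _ _ _).1 hv).mapInd f
      rw [← flat_mapInd] at this
      rw [valid_iff, ← Multiset.map_add, ← links, links_mapLink]
      simpa [TensorTerm.mapInd] using this
  | cong _ hc ih => exact .cong ih (hc.mapInd f)
  | @alpha Δ t A e L i i' _ hi h1 h2 ih =>
    have := Translates.alpha (i := f i) (i' := f i') ih ?_ ?_ ?_
    · rw [Multiset.map_map] at this ⊢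
      simp only [TensorType.mapInd_mapInd, TensorTerm.mapInd_mapInd, LinkedAssumption.mapLink,
        Function.comp_def] at this ⊢
      have e1 := comp_replaceIndex f i i'
      simp only [Function.comp_def] at e1
      rw [e1]
      exact this
    · simpa only [Set.mem_union, mem_freeSup_iff, mem_freeSub_iff, flat_mapInd, csup_mapInd,
        csub_mapInd] using hi
    · simpa [sups_mapInd] using h1
    · simpa [subs_mapInd] using h2

lemma Translates.rename {Δ : Multiset (LinkedAssumption P X Ind)}
    {t : LamTerm X C} {A : ImpType P} {e : TensorTerm T Ind} {L : TensorType P Ind}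
    (h : Translates S R Δ t A e L) (r : Equiv.Perm X) :
    Translates S R (Δ.map (LinkedAssumption.rename r)) (t.rename r) A e L := by
  induction h with
  | var x A hv => exact .var _ A hv
  | con c h1 h2 h3 => exact .con c h1 h2 h3
  | lam _ ih =>
    rw [LamTerm.rename_lam]
    refine .lam ?_
    simpa [LinkedAssumption.rename] using ih
  | @app Δ Δ' t s A B e e' L M _ _ hn hv ih1 ih2 =>
    rw [Multiset.map_add]
    refine .app ih1 ih2 ?_ ?_
    · rw [← Multiset.map_add, Multiset.map_map]
      have := hn.map r.injective
      rwa [Multiset.map_map] at this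
    · rw [← Multiset.map_add, Multiset.map_map]
      exact hv
  | cong _ hc ih => exact .cong ih hc
  | alpha _ hi h1 h2 ih =>
    have := Translates.alpha ih hi h1 h2
    rw [Multiset.map_map] at this ⊢
    exact this

end Basic

section Classes

variable {P C T X Ind : Type*} [DecidableEq X] [DecidableEq Ind]

/-- The judgements to which a typable lambda-term translates. -/
def TrQ (X : Type*) [DecidableEq X] (S : LamSignature P C) (R : TensorTranslation P C T Ind)
    (m : Net T Ind) (Γ : Seq P Ind) : Prop :=
  ∃ e : TensorTerm T Ind, e.flat = m ∧ ∃ (Δ : Multiset (LinkedAssumption P X Ind))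
    (t : LamTerm X C) (A : ImpType P) (L : TensorType P Ind),
    Translates S R Δ t A e L ∧ Γ = L ::ₘ links Δ

/-- A class of judgements with polarized types that is closed under the rules of the tensor
calculus. -/
structure PolPred (v : P → ℕ × ℕ) (Q : Net T Ind → Seq P Ind → Prop) : Prop
    extends NetPred v Q where
  id : ∀ {C C' : TensorType P Ind}, C'.sym = C.sym → C.sym.Pos →
    NetValid v (idNet C C' : Net T Ind) {C', C.dual} → Q (idNet C C') {C', C.dual}
  cut : ∀ {m n : Net T Ind} {C : TensorType P Ind} {Γ Θ : Seq P Ind}, C.sym.Pos →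
    Q m (C ::ₘ Γ) → Q n (C.dual ::ₘ Θ) → NetValid v (m + n) (Γ + Θ) → Q (m + n) (Γ + Θ)
  par : ∀ {m : Net T Ind} {A B : TensorType P Ind} {Γ : Seq P Ind}, A.sym.Pos → B.sym.Neg →
    Q m (A ::ₘ B ::ₘ Γ) → Q m (A.par B ::ₘ Γ)
  tensor : ∀ {m n : Net T Ind} {A B : TensorType P Ind} {Γ Θ : Seq P Ind}, A.sym.Pos →
    B.sym.Neg → Q m (A ::ₘ Γ) → Q n (B ::ₘ Θ) → NetValid v (m + n) (A.tensor B ::ₘ (Γ + Θ)) →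
    Q (m + n) (A.tensor B ::ₘ (Γ + Θ))

variable {S : LamSignature P C} {R : TensorTranslation P C T Ind}

lemma TrQ.netPred (hR : R.Equivariant) : NetPred R.val (TrQ X S R) where
  valid := by
    rintro m Γ ⟨e, rfl, Δ, t, A, L, h, rfl⟩
    exact h.invariants.1
  cong := by
    rintro m n Γ ⟨e, rfl, Δ, t, A, L, h, rfl⟩ hc
    obtain ⟨e', rfl⟩ := Net.exists_term hc.symm.ne_zero
    exact ⟨e', rfl, Δ, t, A, L, h.cong hc.cong, rfl⟩
  perm := by
    rintro m Γ ⟨e, rfl, Δ, t, A, L, h, rfl⟩ f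
    exact ⟨e.mapInd f, by simp, _, t, A, _, h.mapInd hR f, by
      rw [links_mapLink, Multiset.map_cons]⟩

lemma exists_of_pos {L A : TensorType P Ind} {Θ : Seq P Ind}
    {Δ : Multiset (LinkedAssumption P X Ind)} (h : A ::ₘ Θ = L ::ₘ links Δ) (hA : A.sym.Pos)
    (hΔ : ∀ a ∈ Δ, a.link.sym = a.type.toSymbol.dual) : A = L ∧ Θ = links Δ := by
  rcases Multiset.cons_eq_cons.1 h with h | ⟨-, Ξ, -, h2⟩
  · exact h
  · exfalso
    have : A ∈ links Δ := by rw [h2]; simp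
    obtain ⟨a, ha, rfl⟩ := Multiset.mem_map.1 this
    exact hA.not_neg ⟨_, hΔ a ha⟩

lemma exists_of_neg {L A : TensorType P Ind} {Θ : Seq P Ind}
    {Δ : Multiset (LinkedAssumption P X Ind)} (h : A ::ₘ Θ = L ::ₘ links Δ) (hA : A.sym.Neg)
    (hL : L.sym.Pos) : ∃ a Δ', Δ = a ::ₘ Δ' ∧ a.link = A ∧ Θ = L ::ₘ links Δ' := by
  rcases Multiset.cons_eq_cons.1 h with ⟨rfl, -⟩ | ⟨-, Ξ, h1, h2⟩
  · exact absurd hA hL.not_neg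
  · have : A ∈ links Δ := by rw [h2]; simp
    obtain ⟨a, ha, rfl⟩ := Multiset.mem_map.1 this
    obtain ⟨Δ', rfl⟩ := Multiset.exists_cons_of_mem ha
    simp only [links, Multiset.map_cons, Multiset.cons_inj_right] at h2
    exact ⟨a, Δ', rfl, rfl, h1.trans (congrArg _ h2.symm)⟩

variable [Infinite X]

/-- The variables of a judgement can be chosen outside of a finite set. -/
lemma Translates.exists_fresh {Δ : Multiset (LinkedAssumption P X Ind)}
    {t : LamTerm X C} {A : ImpType P} {e : TensorTerm T Ind} {L : TensorType P Ind}
    (h : Translates S R Δ t A e L) (F : Finset X) :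
    ∃ Δ' t', Translates S R Δ' t' A e L ∧ links Δ' = links Δ ∧ ∀ a ∈ Δ', a.var ∉ F := by
  obtain ⟨r, hr, -⟩ := exists_perm_avoid (Δ.map LinkedAssumption.var).toFinset F
  refine ⟨_, _, h.rename r, by simp [links, LinkedAssumption.rename, Function.comp_def], ?_⟩
  intro a ha
  obtain ⟨b, hb, rfl⟩ := Multiset.mem_map.1 ha
  exact hr _ (by simpa using ⟨b, hb, rfl⟩)

lemma TrQ.app {m n : Net T Ind} {A M : TensorType P Ind} {Γ Θ : Seq P Ind}
    (hA : A.sym.Pos) (hM : M.sym.Neg) (h1 : TrQ X S R m (A.par M ::ₘ Γ))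
    (h2 : TrQ X S R n (M.dual ::ₘ Θ)) (hv : NetValid R.val (m + n) (A ::ₘ (Γ + Θ))) :
    TrQ X S R (m + n) (A ::ₘ (Γ + Θ)) := by
  obtain ⟨e, rfl, Δ, t, F, L, h1, hL⟩ := h1
  obtain ⟨e', rfl, Δ', s, H, L', h2, hL'⟩ := h2
  obtain ⟨A', hA'⟩ := hA
  obtain ⟨M', hM'⟩ := hM
  obtain ⟨rfl, rfl⟩ := exists_of_pos hL ⟨.imp M' A', by simp [hA', hM', ImpType.toSymbol]⟩
    h1.invariants.2.2.2
  obtain ⟨rfl, rfl⟩ := exists_of_pos hL' ⟨M', by simp [hM']⟩ h2.invariants.2.2.2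
  have i1 := h1.invariants.2.2.1
  have i2 := h2.invariants.2.2.1
  obtain rfl : F = .imp M' A' := ImpType.toSymbol_injective (by
    rw [← i1]; simp [hA', hM', ImpType.toSymbol])
  obtain rfl : H = M' := ImpType.toSymbol_injective (by rw [← i2]; simp [hM'])
  obtain ⟨Δ'', s', h3, h4, h5⟩ := h2.exists_fresh (Δ.map LinkedAssumption.var).toFinset
  rw [← h4] at hv ⊢
  rw [← Multiset.map_add] at hv ⊢
  refine ⟨e.mul e', rfl, Δ + Δ'', .app t s', A', A, .app h1 h3 ?_ ?_, rfl⟩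
  · rw [Multiset.map_add, Multiset.nodup_add]
    refine ⟨h1.invariants.2.1, h3.invariants.2.1, Multiset.disjoint_left.2 fun {x} hx hx' => ?_⟩
    obtain ⟨b, hb, rfl⟩ := Multiset.mem_map.1 hx'
    exact h5 b hb (by simpa using hx)
  · exact (valid_iff _ _ _).2 hv

lemma TrQ.par {m : Net T Ind} {A B : TensorType P Ind} {Γ : Seq P Ind}
    (hA : A.sym.Pos) (hB : B.sym.Neg) (h : TrQ X S R m (A ::ₘ B ::ₘ Γ)) :
    TrQ X S R m (A.par B ::ₘ Γ) := by
  obtain ⟨e, rfl, Δ, t, F, L, h, hL⟩ := h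
  obtain ⟨rfl, h2⟩ := exists_of_pos hL hA h.invariants.2.2.2
  have : B ∈ links Δ := by rw [← h2]; simp
  obtain ⟨a, ha, rfl⟩ := Multiset.mem_map.1 this
  obtain ⟨Δ', rfl⟩ := Multiset.exists_cons_of_mem ha
  simp only [links, Multiset.map_cons, Multiset.cons_inj_right] at h2
  exact ⟨e, rfl, Δ', _, _, _, .lam (x := a.var) (A := a.type) h, by rw [h2]⟩

lemma TrQ.cut {m n : Net T Ind} {C : TensorType P Ind} {Γ Θ : Seq P Ind}
    (hC : C.sym.Pos) (h1 : TrQ X S R m (C ::ₘ Γ)) (h2 : TrQ X S R n (C.dual ::ₘ Θ))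
    (hv : NetValid R.val (m + n) (Γ + Θ)) : TrQ X S R (m + n) (Γ + Θ) := by
  have h2' := h2
  obtain ⟨e', rfl, Δ', s, H, L', h2, hL'⟩ := h2
  have hp : L'.sym.Pos := ⟨_, h2.invariants.2.2.1⟩
  obtain ⟨a, Δ, rfl, ha, rfl⟩ := exists_of_neg hL' hC.dual hp
  have h3 : TrQ X S R e'.flat (L'.par C.dual ::ₘ links Δ) := by
    refine TrQ.par hp hC.dual ?_
    rwa [Multiset.cons_swap]
  have h4 := TrQ.app (m := e'.flat) (n := m) (Γ := links Δ) (Θ := Γ) hp hC.dual h3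
    (by simpa using h1) (by
      rw [add_comm Γ, Multiset.cons_add, add_comm m] at hv
      exact hv)
  rw [add_comm m, add_comm Γ, Multiset.cons_add]
  exact h4

lemma TrQ.id (hv0 : ∀ p, R.val p ≠ 0) {D₁ D₂ : TensorType P Ind} (hs : D₂.sym = D₁.sym)
    (hp : D₁.sym.Pos) (hv : NetValid R.val (idNet D₁ D₂ : Net T Ind) {D₂, D₁.dual}) :
    TrQ X S R (idNet D₁ D₂) {D₂, D₁.dual} := by
  have hD' := hv.1 D₂ (by simp)
  have hD : D₁.FitsValency R.val := by simpa using hv.1 D₁.dual (by simp)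
  obtain ⟨F, hF⟩ := hp
  have hflat := flat_idTerm (T := T) hv0 hD hD' hs
  obtain ⟨x⟩ : Nonempty X := inferInstance
  have h1 : TensorType.mk F.toSymbol D₂.up D₂.lo = D₂ := by rw [← hF, ← hs]
  have h2 : TensorType.mk F.toSymbol.dual D₁.dual.up D₁.dual.lo = D₁.dual := by rw [← hF]; rfl
  have h3 := Translates.var (S := S) (R := R) x F (U := D₂.up) (L := D₂.lo) (U' := D₁.dual.up)
    (L' := D₁.dual.lo) (by rw [valid_iff, hflat, h1, h2]; exact hv)
  rw [h1, h2] at h3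
  exact ⟨_, hflat, _, _, _, _, h3, rfl⟩

lemma TrQ.tensor [Infinite Ind] (hv0 : ∀ p, R.val p ≠ 0) (hR : R.Equivariant) {m n : Net T Ind}
    {A B : TensorType P Ind} {Γ Θ : Seq P Ind} (hA : A.sym.Pos) (hB : B.sym.Neg)
    (h1 : TrQ X S R m (A ::ₘ Γ)) (h2 : TrQ X S R n (B ::ₘ Θ))
    (hv : NetValid R.val (m + n) (A.tensor B ::ₘ (Γ + Θ))) :
    TrQ X S R (m + n) (A.tensor B ::ₘ (Γ + Θ)) := by
  have hQ := TrQ.netPred (X := X) (S := S) hR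
  have v1 := hQ.valid h1
  have v2 := hQ.valid h2
  have hfit := hv.1 (A.tensor B) (by simp)
  obtain ⟨D, hD1, hD2, hD3⟩ := exists_fresh_type hfit (m + n) (A.tensor B ::ₘ (Γ + Θ))
  have cs := fun i => csup_idNet (T := T) hfit hD2 hD1 i
  have cb := fun i => csub_idNet (T := T) hfit hD2 hD1 i
  have counts : ∀ i, _ := fun i =>
    And.intro (hv.2 i) (And.intro (v1.2 i) (And.intro (v2.2 i) (hD3 i)))
  simp only [csup_add, csub_add, cup_cons, clo_cons, cup_add, clo_add, TensorType.up_tensor,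
    TensorType.lo_tensor, List.count_append] at counts
  simp only [TensorType.up_tensor, TensorType.lo_tensor, List.count_append] at cs cb
  have fΓ : ∀ C ∈ Γ, C.FitsValency R.val := fun C hC => v1.1 C (by simp [hC])
  have fΘ : ∀ C ∈ Θ, C.FitsValency R.val := fun C hC => v2.1 C (by simp [hC])
  have fA : A.FitsValency R.val := v1.1 A (by simp)
  have fB : B.FitsValency R.val := v2.1 B (by simp)
  rw [← hQ.idNet_iff hv0 (C' := D) hD1 hv]
  · -- the identity, applied to the first premise and cut with the second one
    have s1 : TrQ X S R (idNet (A.tensor B) D) (B.dual.par A.dual ::ₘ {D}) := by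
      rw [← TensorType.dual_tensor, ← idNet_dual hfit hD2 hD1]
      have hpos : (A.tensor B).sym.dual.Pos := by
        obtain ⟨F, hF⟩ := hA
        obtain ⟨H, hH⟩ := hB
        exact ⟨.imp F H, by simp [hF, hH, TypeSymbol.dual, ImpType.toSymbol]⟩
      have := TrQ.id (X := X) (S := S) (D₁ := D.dual) (D₂ := (A.tensor B).dual) hv0
        (by simp [hD1]) (by simpa [hD1] using hpos) ?_
      · simpa using this
      · rw [idNet_dual hfit hD2 hD1]
        refine ⟨by simp [hD2, hfit], fun i => ?_⟩
        obtain ⟨c1, c2, c3, c4, c5⟩ := counts i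
        have e1 := cs i
        have e2 := cb i
        simp
        rcases c5 with c5 | c5 <;> omega
    have s2 : TrQ X S R (idNet (A.tensor B) D + m) (B.dual ::ₘ ({D} + Γ)) := by
      refine TrQ.app hB.dual hA.dual s1 (by simpa using h1) ⟨?_, fun i => ?_⟩
      · simp only [Multiset.mem_cons, Multiset.mem_add, Multiset.mem_singleton,
          forall_eq_or_imp]
        exact ⟨by simpa using fB, hD2, fΓ⟩
      · obtain ⟨c1, c2, c3, c4, c5⟩ := counts i
        have e1 := cs i
        have e2 := cb i
        simp
        rcases c5 with c5 | c5 <;> omega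
    have s3 := TrQ.cut (Θ := Θ) (n := n) hB.dual s2 (by simpa using h2) (by
      refine ⟨?_, fun i => ?_⟩
      · simp only [Multiset.mem_add, Multiset.mem_singleton]
        rintro C ((rfl | hC) | hC)
        · exact hD2
        · exact fΓ _ hC
        · exact fΘ _ hC
      · obtain ⟨c1, c2, c3, c4, c5⟩ := counts i
        have e1 := cs i
        have e2 := cb i
        simp
        rcases c5 with c5 | c5 <;> omega)
    have e1 : idNet (A.tensor B) D + m + n = m + n + idNet (A.tensor B) D := by
      rw [add_assoc, add_comm]
    rw [e1, Multiset.singleton_add, Multiset.cons_add] at s3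
    exact s3
  · refine ⟨?_, fun i => ?_⟩
    · simp only [Multiset.mem_cons, Multiset.mem_add, forall_eq_or_imp]
      refine ⟨hD2, ?_⟩
      rintro C (hC | hC)
      · exact fΓ _ hC
      · exact fΘ _ hC
    · obtain ⟨c1, c2, c3, c4, c5⟩ := counts i
      have e1 := cs i
      have e2 := cb i
      simp
      rcases c5 with c5 | c5 <;> omega

theorem TrQ.polPred [Infinite Ind] (hv0 : ∀ p, R.val p ≠ 0) (hR : R.Equivariant) :
    PolPred R.val (TrQ X S R) where
  toNetPred := TrQ.netPred hR
  id := TrQ.id hv0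
  cut := TrQ.cut
  par := TrQ.par
  tensor := TrQ.tensor hv0 hR

end Classes

section TensorSide

variable {P C T X Ind : Type*} [DecidableEq X] [DecidableEq Ind]

/-- The judgements derivable in a tensor signature. -/
def DerQ (Sg : TensorSignature P T Ind) (m : Net T Ind) (Γ : Seq P Ind) : Prop :=
  ∃ e : TensorTerm T Ind, e.flat = m ∧ TensorDer Sg e Γ

def TensorSignature.Equivariant (Sg : TensorSignature P T Ind) : Prop :=
  ∀ (e : TensorTerm T Ind) (Γ : Seq P Ind) (f : Equiv.Perm Ind), ⟨e, Γ⟩ ∈ Sg.ax →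
    ⟨e.mapInd f, Γ.map (TensorType.mapInd f)⟩ ∈ Sg.ax

variable {Sg : TensorSignature P T Ind}

lemma TensorDer.netValid {e : TensorTerm T Ind} {Γ : Seq P Ind} (h : TensorDer Sg e Γ) :
    NetValid Sg.val e.flat Γ := by
  induction h with
  | ax _ h => exact (valid_iff _ _ _).1 h
  | id h => exact (valid_iff _ _ _).1 h
  | cut _ _ h => exact (valid_iff _ _ _).1 h
  | par _ ih => exact ih.par
  | tensor _ _ h => exact (valid_iff _ _ _).1 h
  | cong _ hc ih => exact ih.cong ⟨_, _, rfl, rfl, hc⟩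
  | @alpha t Γ i i' _ _ h1 h2 ih =>
    have h3 := ih.alpha (i := i) h1 h2
    rw [h3.1, h3.2, flat_mapInd]
    exact ih.mapInd _

lemma TensorDer.mapInd (hS : Sg.Equivariant) {e : TensorTerm T Ind} {Γ : Seq P Ind}
    (h : TensorDer Sg e Γ) (f : Equiv.Perm Ind) :
    TensorDer Sg (e.mapInd f) (Γ.map (TensorType.mapInd f)) := by
  have hval : ∀ {e : TensorTerm T Ind} {Γ : Seq P Ind}, TensorJudgement.Valid Sg.val ⟨e, Γ⟩ →
      TensorJudgement.Valid Sg.val ⟨e.mapInd f, Γ.map (TensorType.mapInd f)⟩ := by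
    intro e Γ h
    rw [valid_iff, flat_mapInd]
    exact ((valid_iff _ _ _).1 h).mapInd f
  induction h with
  | ax h1 h => exact .ax (hS _ _ f h1) (hval h)
  | id h =>
    have := hval h
    simp only [mapInd_idTerm, Multiset.insert_eq_cons, Multiset.map_cons,
      Multiset.map_singleton, TensorType.mapInd] at this ⊢
    exact .id this
  | cut _ _ h ih1 ih2 =>
    have := hval h
    rw [Multiset.map_add] at this ⊢
    rw [Multiset.map_cons] at ih1 ih2
    rw [TensorType.mapInd_dual] at ih2
    exact .cut ih1 ih2 this
  | par _ ih =>
    rw [Multiset.map_cons, TensorType.mapInd_par]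
    exact .par (by simpa using ih)
  | tensor _ _ h ih1 ih2 =>
    have := hval h
    rw [Multiset.map_cons, TensorType.mapInd_tensor, Multiset.map_add] at this ⊢
    exact .tensor (by simpa using ih1) (by simpa using ih2) this
  | cong _ hc ih => exact .cong ih (hc.mapInd f)
  | @alpha t Γ i i' _ hi h1 h2 ih =>
    have := TensorDer.alpha (i := f i) (i' := f i') ih ?_ ?_ ?_
    · rw [Multiset.map_map] at this ⊢
      simp only [TensorType.mapInd_mapInd, TensorTerm.mapInd_mapInd, Function.comp_def] at this ⊢
      have e1 := comp_replaceIndex f i i'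
      simp only [Function.comp_def] at e1
      rw [e1]
      exact this
    · simpa only [Set.mem_union, mem_freeSup_iff, mem_freeSub_iff, flat_mapInd, csup_mapInd,
        csub_mapInd] using hi
    · simpa [sups_mapInd] using h1
    · simpa [subs_mapInd] using h2

lemma DerQ.netPred (hS : Sg.Equivariant) : NetPred Sg.val (DerQ Sg) where
  valid := by
    rintro m Γ ⟨e, rfl, h⟩
    exact h.netValid
  cong := by
    rintro m n Γ ⟨e, rfl, h⟩ hc
    obtain ⟨e', rfl⟩ := Net.exists_term hc.symm.ne_zero
    exact ⟨e', rfl, h.cong hc.cong⟩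
  perm := by
    rintro m Γ ⟨e, rfl, h⟩ f
    exact ⟨e.mapInd f, by simp, h.mapInd hS f⟩

lemma DerQ.cut {m n : Net T Ind} {A : TensorType P Ind} {Γ Θ : Seq P Ind}
    (h1 : DerQ Sg m (A ::ₘ Γ)) (h2 : DerQ Sg n (A.dual ::ₘ Θ))
    (hv : NetValid Sg.val (m + n) (Γ + Θ)) : DerQ Sg (m + n) (Γ + Θ) := by
  obtain ⟨e, rfl, h1⟩ := h1
  obtain ⟨e', rfl, h2⟩ := h2
  exact ⟨e.mul e', rfl, .cut h1 h2 ((valid_iff _ _ _).2 hv)⟩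

lemma DerQ.tensor {m n : Net T Ind} {A B : TensorType P Ind} {Γ Θ : Seq P Ind}
    (h1 : DerQ Sg m (A ::ₘ Γ)) (h2 : DerQ Sg n (B ::ₘ Θ))
    (hv : NetValid Sg.val (m + n) (A.tensor B ::ₘ (Γ + Θ))) :
    DerQ Sg (m + n) (A.tensor B ::ₘ (Γ + Θ)) := by
  obtain ⟨e, rfl, h1⟩ := h1
  obtain ⟨e', rfl, h2⟩ := h2
  exact ⟨e.mul e', rfl, .tensor h1 h2 ((valid_iff _ _ _).2 hv)⟩

lemma DerQ.par {m : Net T Ind} {A B : TensorType P Ind} {Γ : Seq P Ind}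
    (h : DerQ Sg m (A ::ₘ B ::ₘ Γ)) : DerQ Sg m (A.par B ::ₘ Γ) := by
  obtain ⟨e, rfl, h⟩ := h
  exact ⟨e, rfl, .par h⟩

lemma TensorType.FitsValency.exists_split {v : P → ℕ × ℕ} {D : TensorType P Ind} (hD : D.FitsValency v)
    (a b : TypeSymbol P) (hs : D.sym.valency v = a.valency v + b.valency v) :
    ∃ D₁ D₂ : TensorType P Ind, D₁.sym = a ∧ D₂.sym = b ∧ D₁.FitsValency v ∧ D₂.FitsValency v ∧
      D.up = D₁.up ++ D₂.up ∧ D.lo = D₁.lo ++ D₂.lo := by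
  have h := hD.trans hs
  simp only [Prod.ext_iff, Prod.fst_add, Prod.snd_add] at h
  refine ⟨⟨a, D.up.take (a.valency v).1, D.lo.take (a.valency v).2⟩,
    ⟨b, D.up.drop (a.valency v).1, D.lo.drop (a.valency v).2⟩, rfl, rfl, ?_, ?_, by simp,
    by simp⟩
  · simp only [FitsValency, List.length_take, h]
    ext <;> simp
  · simp only [FitsValency, List.length_drop, h]
    ext <;> simp

lemma idNet_append {v : P → ℕ × ℕ} {D E D₁ D₂ E₁ E₂ : TensorType P Ind}
    (h₁ : D₁.FitsValency v) (h₂ : E₁.FitsValency v) (hs : D₁.sym = E₁.sym)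
    (hu : D.up = D₁.up ++ D₂.up) (hl : D.lo = D₁.lo ++ D₂.lo)
    (hu' : E.up = E₁.up ++ E₂.up) (hl' : E.lo = E₁.lo ++ E₂.lo) :
    (idNet D E : Net T Ind) = idNet D₁ E₁ + idNet D₂ E₂ := by
  have h := h₁.length_eq h₂ hs
  rw [idNet, idNet, idNet, hu, hl, hu', hl', List.zipWith_append h.1, List.zipWith_append h.2.symm,
    ← Multiset.coe_add, ← Multiset.coe_add]
  abel

lemma DerQ.id (hv0 : ∀ p, Sg.val p ≠ 0) {D E : TensorType P Ind} (hs : E.sym = D.sym)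
    (hv : NetValid Sg.val (idNet D E : Net T Ind) {E, D.dual}) :
    DerQ Sg (idNet D E) {E, D.dual} := by
  obtain ⟨a, ha⟩ : ∃ a, D.sym = a := ⟨_, rfl⟩
  induction a generalizing D E with
  | pos p =>
    have hE := hv.1 E (by simp)
    have hD : D.FitsValency Sg.val := by simpa using hv.1 D.dual (by simp)
    have hflat := flat_idTerm (T := T) hv0 hD hE hs
    refine ⟨_, hflat, ?_⟩
    have h1 : TensorType.mk (.pos p) E.up E.lo = E := by rw [← ha, ← hs]
    have h2 : TensorType.mk (.neg p) D.dual.up D.dual.lo = D.dual := by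
      simp [TensorType.dual, ha, TypeSymbol.dual]
    have := TensorDer.id (S := Sg) (p := p) (U := E.up) (L := E.lo) (U' := D.dual.up)
      (L' := D.dual.lo) (by rw [valid_iff, hflat, h1, h2, Multiset.pair_comm]; exact hv)
    rwa [h1, h2, Multiset.pair_comm] at this
  | neg p =>
    have hE := hv.1 E (by simp)
    have hD : D.FitsValency Sg.val := by simpa using hv.1 D.dual (by simp)
    have hflat := flat_idTerm (T := T) hv0 (C := E.dual) (C' := D.dual) (by simpa using hE)
      (by simpa using hD) (by simp [hs])
    rw [idNet_dual hD hE hs, TensorType.dual_dual] at hflat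
    refine ⟨_, hflat, ?_⟩
    have h1 : TensorType.mk (.neg p) E.up E.lo = E := by rw [← ha, ← hs]
    have h2 : TensorType.mk (.pos p) D.dual.up D.dual.lo = D.dual := by
      simp [TensorType.dual, ha, TypeSymbol.dual]
    have := TensorDer.id (S := Sg) (p := p) (U := D.dual.up) (L := D.dual.lo) (U' := E.up)
      (L' := E.lo) (by rw [valid_iff, hflat, h1, h2]; exact hv)
    rwa [h1, h2] at this
  | tensor a b iha ihb =>
    have hE := hv.1 E (by simp)
    have hD : D.FitsValency Sg.val := by simpa using hv.1 D.dual (by simp)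
    obtain ⟨D₁, D₂, a1, a2, a3, a4, a5, a6⟩ := TensorType.FitsValency.exists_split hD a b (by rw [ha]; rfl)
    obtain ⟨E₁, E₂, b1, b2, b3, b4, b5, b6⟩ := TensorType.FitsValency.exists_split hE a b (by rw [hs, ha]; rfl)
    have eD : D = D₁.tensor D₂ := by
      rw [TensorType.tensor, a1, a2, ← a5, ← a6, ← ha]
    have eE : E = E₁.tensor E₂ := by
      rw [TensorType.tensor, b1, b2, ← b5, ← b6, ← ha, ← hs]
    have e1 := idNet_append (T := T) a3 b3 (a1.trans b1.symm) a5 a6 b5 b6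
    have c1 := csup_idNet (T := T) a3 b3 (b1.trans a1.symm)
    have c2 := csup_idNet (T := T) a4 b4 (b2.trans a2.symm)
    have c3 := csub_idNet (T := T) a3 b3 (b1.trans a1.symm)
    have c4 := csub_idNet (T := T) a4 b4 (b2.trans a2.symm)
    have hc := hv.2
    simp only [eD, eE, Multiset.insert_eq_cons, cup_cons,
      clo_cons, cup_singleton, clo_singleton, TensorType.up_tensor, TensorType.lo_tensor,
      TensorType.up_dual, TensorType.lo_dual, List.count_reverse, List.count_append] at hc
    have h1 : DerQ Sg (idNet D₁ E₁) {E₁, D₁.dual} := by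
      refine iha (b1.trans a1.symm) ⟨by simp [a3, b3], fun i => ?_⟩ a1
      have := hc i
      simp [c1, c3]
      omega
    have h2 : DerQ Sg (idNet D₂ E₂) {E₂, D₂.dual} := by
      refine ihb (b2.trans a2.symm) ⟨by simp [a4, b4], fun i => ?_⟩ a2
      have := hc i
      simp [c2, c4]
      omega
    have h3 := DerQ.tensor h1 h2 (by
      refine ⟨by simp [a3, b3, a4, b4, TensorType.FitsValency.tensor], fun i => ?_⟩
      have := hc i
      simp [c1, c2, c3, c4]
      omega)
    rw [e1, eE, eD, TensorType.dual_tensor]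
    rw [Multiset.pair_comm]
    refine DerQ.par ?_
    convert h3 using 1
    simp only [← Multiset.singleton_add]
    abel
  | par a b iha ihb =>
    have hE := hv.1 E (by simp)
    have hD : D.FitsValency Sg.val := by simpa using hv.1 D.dual (by simp)
    obtain ⟨D₁, D₂, a1, a2, a3, a4, a5, a6⟩ := TensorType.FitsValency.exists_split hD a b (by rw [ha]; rfl)
    obtain ⟨E₁, E₂, b1, b2, b3, b4, b5, b6⟩ := TensorType.FitsValency.exists_split hE a b (by rw [hs, ha]; rfl)
    have eD : D = D₁.par D₂ := by
      rw [TensorType.par, a1, a2, ← a5, ← a6, ← ha]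
    have eE : E = E₁.par E₂ := by
      rw [TensorType.par, b1, b2, ← b5, ← b6, ← ha, ← hs]
    have e1 := idNet_append (T := T) a3 b3 (a1.trans b1.symm) a5 a6 b5 b6
    have c1 := csup_idNet (T := T) a3 b3 (b1.trans a1.symm)
    have c2 := csup_idNet (T := T) a4 b4 (b2.trans a2.symm)
    have c3 := csub_idNet (T := T) a3 b3 (b1.trans a1.symm)
    have c4 := csub_idNet (T := T) a4 b4 (b2.trans a2.symm)
    have hc := hv.2
    simp only [eD, eE, Multiset.insert_eq_cons, cup_cons,
      clo_cons, cup_singleton, clo_singleton, TensorType.up_par, TensorType.lo_par,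
      TensorType.up_dual, TensorType.lo_dual, List.count_reverse, List.count_append] at hc
    have h1 : DerQ Sg (idNet D₁ E₁) {E₁, D₁.dual} := by
      refine iha (b1.trans a1.symm) ⟨by simp [a3, b3], fun i => ?_⟩ a1
      have := hc i
      simp [c1, c3]
      omega
    have h2 : DerQ Sg (idNet D₂ E₂) {E₂, D₂.dual} := by
      refine ihb (b2.trans a2.symm) ⟨by simp [a4, b4], fun i => ?_⟩ a2
      have := hc i
      simp [c2, c4]
      omega
    rw [Multiset.pair_comm] at h1 h2
    have h3 := DerQ.tensor h2 h1 (by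
      refine ⟨by simp [a3, b3, a4, b4, TensorType.FitsValency.tensor], fun i => ?_⟩
      have := hc i
      simp [c1, c2, c3, c4]
      omega)
    rw [e1, eE, eD, TensorType.dual_par]
    refine DerQ.par ?_
    convert h3 using 1
    · rw [add_comm]
    · simp only [← Multiset.singleton_add]
      abel

lemma DerQ.app [Infinite Ind] (hv0 : ∀ p, Sg.val p ≠ 0) (hS : Sg.Equivariant) {m n : Net T Ind}
    {A M : TensorType P Ind} {Γ Θ : Seq P Ind} (h1 : DerQ Sg m (A.par M ::ₘ Γ))
    (h2 : DerQ Sg n (M.dual ::ₘ Θ)) (hv : NetValid Sg.val (m + n) (A ::ₘ (Γ + Θ))) :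
    DerQ Sg (m + n) (A ::ₘ (Γ + Θ)) := by
  have hQ := DerQ.netPred hS
  have v1 := hQ.valid h1
  have v2 := hQ.valid h2
  have hfit := hv.1 A (by simp)
  obtain ⟨D, hD1, hD2, hD3⟩ := exists_fresh_type hfit (m + n + m)
    (A ::ₘ M ::ₘ (Γ + Θ))
  have cs := fun i => csup_idNet (T := T) hfit hD2 hD1 i
  have cb := fun i => csub_idNet (T := T) hfit hD2 hD1 i
  have counts : ∀ i, _ := fun i =>
    And.intro (hv.2 i) (And.intro (v1.2 i) (And.intro (v2.2 i) (hD3 i)))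
  simp only [csup_add, csub_add, cup_cons, clo_cons, cup_add, clo_add, TensorType.up_par,
    TensorType.lo_par, List.count_append, TensorType.up_dual, TensorType.lo_dual,
    List.count_reverse] at counts
  have fΓ : ∀ C ∈ Γ, C.FitsValency Sg.val := fun C hC => v1.1 C (by simp [hC])
  have fΘ : ∀ C ∈ Θ, C.FitsValency Sg.val := fun C hC => v2.1 C (by simp [hC])
  have fM : M.FitsValency Sg.val := by simpa using v2.1 M.dual (by simp)
  rw [← hQ.idNet_iff hv0 (C' := D) hD1 hv]
  · have s1 : DerQ Sg (idNet A D) (A.dual ::ₘ {D}) := by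
      have := DerQ.id hv0 (T := T) hD1 (by
        refine ⟨by simp [hD2, hfit], fun i => ?_⟩
        obtain ⟨c1, c2, c3, c4, c5⟩ := counts i
        have e1 := cs i
        have e2 := cb i
        simp
        rcases c5 with c5 | c5 <;> omega)
      rw [Multiset.pair_comm] at this
      exact this
    have s2 := DerQ.tensor h2 s1 (by
      refine ⟨?_, fun i => ?_⟩
      · simp only [Multiset.mem_cons, Multiset.mem_add, Multiset.mem_singleton,
          forall_eq_or_imp]
        refine ⟨TensorType.FitsValency.tensor (by simpa) (by simpa), ?_⟩
        rintro C (hC | rfl)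
        · exact fΘ _ hC
        · exact hD2
      · obtain ⟨c1, c2, c3, c4, c5⟩ := counts i
        have e1 := cs i
        have e2 := cb i
        simp
        rcases c5 with c5 | c5 <;> omega)
    rw [← TensorType.dual_par] at s2
    have s3 := DerQ.cut h1 s2 (by
      refine ⟨?_, fun i => ?_⟩
      · simp only [Multiset.mem_add, Multiset.mem_singleton]
        rintro C (hC | hC | rfl)
        · exact fΓ _ hC
        · exact fΘ _ hC
        · exact hD2
      · obtain ⟨c1, c2, c3, c4, c5⟩ := counts i
        have e1 := cs i
        have e2 := cb i
        simp
        rcases c5 with c5 | c5 <;> omega)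
    have e1 : Γ + (Θ + {D}) = D ::ₘ (Γ + Θ) := by
      rw [← add_assoc, ← Multiset.singleton_add, add_comm]
    rw [← add_assoc, e1] at s3
    exact s3
  · refine ⟨?_, fun i => ?_⟩
    · simp only [Multiset.mem_cons, Multiset.mem_add, forall_eq_or_imp]
      refine ⟨hD2, ?_⟩
      rintro C (hC | hC)
      · exact fΓ _ hC
      · exact fΘ _ hC
    · obtain ⟨c1, c2, c3, c4, c5⟩ := counts i
      have e1 := cs i
      have e2 := cb i
      simp
      rcases c5 with c5 | c5 <;> omega

variable {S : LamSignature P C} {R : TensorTranslation P C T Ind}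

lemma TensorTranslation.Equivariant.signature (hR : R.Equivariant) : R.signature.Equivariant := by
  rintro e Γ f ⟨c, e', L, h, h2⟩
  simp only [TensorJudgement.mk.injEq] at h2
  obtain ⟨rfl, rfl⟩ := h2
  exact ⟨c, _, _, hR _ _ _ f h, by simp⟩

/-- Translations of derivable judgements are derivable. -/
theorem Translates.tensorDer [Infinite Ind] (hv0 : ∀ p, R.val p ≠ 0) (hR : R.Equivariant)
    {Δ : Multiset (LinkedAssumption P X Ind)} {t : LamTerm X C} {A : ImpType P}
    {e : TensorTerm T Ind} {L : TensorType P Ind} (h : Translates S R Δ t A e L) :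
    DerQ R.signature e.flat (L ::ₘ links Δ) := by
  have hQ := DerQ.netPred hR.signature
  induction h with
  | @var x A U L U' L' hv =>
    have hf := hv.fits
    simp only [Multiset.insert_eq_cons, Multiset.mem_cons, Multiset.mem_singleton,
      forall_eq_or_imp, forall_eq] at hf
    have e1 : TensorType.mk A.toSymbol.dual U' L' =
        (TensorType.mk A.toSymbol L'.reverse U'.reverse).dual := by
      simp [TensorType.dual]
    rw [e1] at hf hv
    have hflat := flat_idTerm (T := T) hv0 (C' := ⟨A.toSymbol, U, L⟩)
      (C := ⟨A.toSymbol, L'.reverse, U'.reverse⟩) (by simpa using hf.2) hf.1 rfl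
    simp only [TensorType.up_dual, TensorType.lo_dual, List.reverse_reverse] at hflat
    rw [valid_iff, hflat] at hv
    have := DerQ.id (Sg := R.signature) (D := ⟨A.toSymbol, L'.reverse, U'.reverse⟩)
      (E := ⟨A.toSymbol, U, L⟩) hv0 rfl hv
    simpa [links, hflat, e1] using this
  | con c h1 h2 h3 =>
    refine ⟨_, rfl, .ax ⟨c, _, _, h1, ?_⟩ (by simp only [links, Multiset.map_zero, Multiset.cons_zero]; exact h3)⟩
    simp [links]
  | lam _ ih =>
    rw [links, Multiset.map_cons] at ih
    exact ih.par
  | app _ _ hn hv ih1 ih2 =>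
    have := DerQ.app (Sg := R.signature) hv0 hR.signature ih1 ih2 (by
      rw [← Multiset.map_add]; exact (valid_iff _ _ _).1 hv)
    rwa [← Multiset.map_add] at this
  | cong _ hc ih => exact hQ.cong ih ⟨_, _, rfl, rfl, hc⟩
  | @alpha Δ t A e L i i' h hi h1 h2 ih =>
    have h3 := h.invariants.1.alpha (i := i) h1 h2
    have := hQ.perm ih (Equiv.swap i i')
    rw [← flat_mapInd, ← h3.1, ← h3.2, Multiset.map_cons] at this
    simpa [links, Function.comp_def] using this

end TensorSide

section PhaseSemantics

variable {P T Ind : Type*} [DecidableEq Ind]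

/-- Sets of judgements with a distinguished type. -/
abbrev JSet (P T Ind : Type*) := TensorType P Ind → Net T Ind → Seq P Ind → Prop

/-- The orthogonal of a set of judgements with respect to `Q`. -/
def Ortho (v : P → ℕ × ℕ) (Q : Net T Ind → Seq P Ind → Prop) (X : JSet P T Ind) :
    JSet P T Ind := fun D m Θ =>
  NetValid v m (D ::ₘ Θ) ∧ ∀ m' Θ', X D.dual m' Θ' → NetValid v (m + m') (Θ + Θ') →
    Q (m + m') (Θ + Θ')

def Tens (v : P → ℕ × ℕ) (X Y : JSet P T Ind) : JSet P T Ind := fun D m Θ =>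
  NetValid v m (D ::ₘ Θ) ∧ ∃ D₁ D₂ m₁ m₂ Θ₁ Θ₂, D = D₁.tensor D₂ ∧ m = m₁ + m₂ ∧
    Θ = Θ₁ + Θ₂ ∧ X D₁ m₁ Θ₁ ∧ Y D₂ m₂ Θ₂

/-- The interpretation of type symbols in the phase semantics given by `Q`. -/
def Interp (v : P → ℕ × ℕ) (Q : Net T Ind → Seq P Ind → Prop) : TypeSymbol P → JSet P T Ind
  | .pos p => fun D m Θ => D.sym = .pos p ∧ Q m (D ::ₘ Θ)
  | .neg p => fun D m Θ => D.sym = .neg p ∧ Q m (D ::ₘ Θ)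
  | .tensor a b => Ortho v Q (Ortho v Q (Tens v (Interp v Q a) (Interp v Q b)))
  | .par a b => Ortho v Q (Tens v (Ortho v Q (Interp v Q b)) (Ortho v Q (Interp v Q a)))

variable {v : P → ℕ × ℕ} {Q : Net T Ind → Seq P Ind → Prop}

lemma Ortho.congr {X Y : JSet P T Ind} {D : TensorType P Ind} {m : Net T Ind} {Θ : Seq P Ind}
    (h : ∀ m Θ, X D.dual m Θ ↔ Y D.dual m Θ) : Ortho v Q X D m Θ ↔ Ortho v Q Y D m Θ := by
  simp only [Ortho, h]

lemma Tens.congr {X Y X' Y' : JSet P T Ind} {a b : TypeSymbol P}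
    (hX : ∀ D m Θ, D.sym = a → (X D m Θ ↔ X' D m Θ))
    (hY : ∀ D m Θ, D.sym = b → (Y D m Θ ↔ Y' D m Θ)) {D : TensorType P Ind} {m : Net T Ind}
    {Θ : Seq P Ind} (hD : D.sym = .tensor a b) : Tens v X Y D m Θ ↔ Tens v X' Y' D m Θ := by
  refine and_congr_right fun _ => ?_
  constructor
  · rintro ⟨D₁, D₂, m₁, m₂, Θ₁, Θ₂, rfl, rfl, rfl, h1, h2⟩
    simp only [TensorType.sym_tensor, TypeSymbol.tensor.injEq] at hD
    exact ⟨D₁, D₂, m₁, m₂, Θ₁, Θ₂, rfl, rfl, rfl, (hX _ _ _ hD.1).1 h1, (hY _ _ _ hD.2).1 h2⟩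
  · rintro ⟨D₁, D₂, m₁, m₂, Θ₁, Θ₂, rfl, rfl, rfl, h1, h2⟩
    simp only [TensorType.sym_tensor, TypeSymbol.tensor.injEq] at hD
    exact ⟨D₁, D₂, m₁, m₂, Θ₁, Θ₂, rfl, rfl, rfl, (hX _ _ _ hD.1).2 h1, (hY _ _ _ hD.2).2 h2⟩

lemma Ortho.ortho_of_mem {X : JSet P T Ind} {D : TensorType P Ind} {m : Net T Ind}
    {Θ : Seq P Ind} (hX : NetValid v m (D ::ₘ Θ)) (h : X D m Θ) :
    Ortho v Q (Ortho v Q X) D m Θ := by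
  refine ⟨hX, fun m' Θ' h' hv => ?_⟩
  rw [add_comm m, add_comm Θ] at hv ⊢
  exact h'.2 m Θ (by rwa [TensorType.dual_dual]) hv

lemma Ortho.triple {X : JSet P T Ind} (hX : ∀ D m Θ, X D m Θ → NetValid v m (D ::ₘ Θ))
    {D : TensorType P Ind} {m : Net T Ind} {Θ : Seq P Ind} :
    Ortho v Q (Ortho v Q (Ortho v Q X)) D m Θ ↔ Ortho v Q X D m Θ := by
  constructor
  · rintro ⟨h1, h2⟩
    exact ⟨h1, fun m' Θ' h' hv => h2 m' Θ' (ortho_of_mem (hX _ _ _ h') h') hv⟩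
  · intro h
    exact ortho_of_mem h.1 h

lemma Tens.valid {X Y : JSet P T Ind} (D : TensorType P Ind) (m : Net T Ind) (Θ : Seq P Ind)
    (h : Tens v X Y D m Θ) : NetValid v m (D ::ₘ Θ) := h.1

lemma Interp.valid (hQ : NetPred v Q) {a : TypeSymbol P} {D : TensorType P Ind} {m : Net T Ind}
    {Θ : Seq P Ind} (h : Interp v Q a D m Θ) : NetValid v m (D ::ₘ Θ) := by
  cases a with
  | pos p => exact hQ.valid h.2
  | neg p => exact hQ.valid h.2
  | tensor a b => exact h.1
  | par a b => exact h.1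

lemma NetValid.exists_copy [Infinite Ind] {m : Net T Ind} {D : TensorType P Ind} {Θ : Seq P Ind}
    (h : NetValid v m (D ::ₘ Θ)) : ∃ D' : TensorType P Ind, D'.sym = D.sym ∧
      NetValid v (idNet D D' : Net T Ind) {D', D.dual} ∧
      NetValid v (m + idNet D D') (D' ::ₘ Θ) := by
  have hfit := h.1 D (by simp)
  have hΘ : ∀ C ∈ Θ, C.FitsValency v := fun C hC => h.1 C (by simp [hC])
  obtain ⟨D', h1, h2, h3⟩ := exists_fresh_type hfit m (D ::ₘ Θ)
  have cs := fun i => csup_idNet (T := T) hfit h2 h1 i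
  have cb := fun i => csub_idNet (T := T) hfit h2 h1 i
  have h4 := h.2
  simp only [cup_cons, clo_cons] at h3 h4
  refine ⟨D', h1, ⟨by simp [hfit, h2], fun i => ?_⟩, ⟨?_, fun i => ?_⟩⟩
  · obtain ⟨d1, d2⟩ := h3 i
    have d3 := h4 i
    simp [cs, cb]
    rcases d2 with d2 | d2 <;> omega
  · simp only [Multiset.mem_cons, forall_eq_or_imp]
    exact ⟨h2, hΘ⟩
  · obtain ⟨d1, d2⟩ := h3 i
    have d3 := h4 i
    simp [cs, cb]
    rcases d2 with d2 | d2 <;> omega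

lemma PolPred.id_of_pol (hQ : PolPred v Q) {D E : TensorType P Ind} (hs : E.sym = D.sym)
    (hp : D.sym.Pos ∨ D.sym.Neg) (hv : NetValid v (idNet D E : Net T Ind) {E, D.dual}) :
    Q (idNet D E) {E, D.dual} := by
  rcases hp with hp | hp
  · exact hQ.id hs hp hv
  · have hE := hv.1 E (by simp)
    have hD : D.FitsValency v := by simpa using hv.1 D.dual (by simp)
    rw [← idNet_dual hD hE hs, Multiset.pair_comm] at hv ⊢
    have := hQ.id (C := E.dual) (C' := D.dual) (by simp [hs]) (by simpa [hs] using hp.dual)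
    simp only [TensorType.dual_dual] at this
    exact this hv

/-- The interpretation of the dual is the orthogonal. -/
lemma Interp.dual [Infinite Ind] (hv0 : ∀ p, v p ≠ 0) (hQ : PolPred v Q) (a : TypeSymbol P) :
    (∀ D m Θ, D.sym = a.dual → (Interp v Q a.dual D m Θ ↔ Ortho v Q (Interp v Q a) D m Θ)) ∧
    (∀ D m Θ, D.sym = a → (Interp v Q a D m Θ ↔ Ortho v Q (Interp v Q a.dual) D m Θ)) := by
  have lit : ∀ (D : TensorType P Ind) (m : Net T Ind) (Θ : Seq P Ind), D.sym.Pos ∨ D.sym.Neg →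
      (Q m (D ::ₘ Θ) ↔ Ortho v Q (fun E n Ξ => E.sym = D.sym.dual ∧ Q n (E ::ₘ Ξ)) D m Θ) := by
    intro D m Θ hD
    constructor
    · intro h
      refine ⟨hQ.valid h, fun m' Θ' h' hv => ?_⟩
      rcases hD with hD | hD
      · exact hQ.cut hD h h'.2 hv
      · rw [add_comm m, add_comm Θ] at hv ⊢
        exact hQ.cut (C := D.dual) (by simpa using hD.dual) h'.2 (by simpa using h) hv
    · rintro ⟨h1, h2⟩
      obtain ⟨D', e1, e2, e3⟩ := h1.exists_copy
      rw [← hQ.idNet_iff hv0 e1 h1 e3]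
      have := h2 (idNet D D') {D'} ⟨rfl, by
        have := hQ.id_of_pol e1 hD e2
        rwa [Multiset.pair_comm] at this⟩
      rw [add_comm Θ, Multiset.singleton_add] at this
      exact this e3
  induction a with
  | pos p =>
    constructor
    · intro D m Θ hD
      have hn : D.sym.Neg := ⟨.atom p, hD⟩
      have := lit D m Θ (.inr hn)
      simpa [TypeSymbol.dual, Interp, hD] using this
    · intro D m Θ hD
      have hn : D.sym.Pos := ⟨.atom p, hD⟩
      have := lit D m Θ (.inl hn)
      simpa [TypeSymbol.dual, Interp, hD] using this
  | neg p =>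
    constructor
    · intro D m Θ hD
      have hn : D.sym.Pos := ⟨.atom p, hD⟩
      have := lit D m Θ (.inl hn)
      simpa [TypeSymbol.dual, Interp, hD] using this
    · intro D m Θ hD
      have hn : D.sym.Neg := ⟨.atom p, hD⟩
      have := lit D m Θ (.inr hn)
      simpa [TypeSymbol.dual, Interp, hD] using this
  | tensor a b iha ihb =>
    have key : ∀ D m Θ, D.sym = (TypeSymbol.tensor a b).dual →
        (Interp v Q (TypeSymbol.tensor a b).dual D m Θ ↔
          Ortho v Q (Tens v (Interp v Q a) (Interp v Q b)) D m Θ) := by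
      intro D m Θ hD
      refine Ortho.congr fun m Θ => Tens.congr (fun E m Θ hE => (iha.2 E m Θ hE).symm)
        (fun E m Θ hE => (ihb.2 E m Θ hE).symm) (by simp [hD])
    constructor
    · intro D m Θ hD
      rw [key D m Θ hD, Interp, Ortho.triple Tens.valid]
    · intro D m Θ hD
      exact Ortho.congr fun m Θ => (key D.dual m Θ (by simp [hD])).symm
  | par a b iha ihb =>
    have tc : ∀ D m Θ, D.sym = .tensor b.dual a.dual →
        (Tens v (Interp v Q b.dual) (Interp v Q a.dual) D m Θ ↔
          Tens v (Ortho v Q (Interp v Q b)) (Ortho v Q (Interp v Q a)) D m Θ) :=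
      fun D m Θ hD => Tens.congr ihb.1 iha.1 hD
    constructor
    · intro D m Θ hD
      refine Ortho.congr fun m Θ => Ortho.congr fun m Θ => tc _ _ _ ?_
      simpa [TypeSymbol.dual] using hD
    · intro D m Θ hD
      have : Ortho v Q (Interp v Q (TypeSymbol.par a b).dual) D m Θ ↔
          Ortho v Q (Tens v (Interp v Q b.dual) (Interp v Q a.dual)) D m Θ :=
        Ortho.triple Tens.valid
      rw [this]
      exact (Ortho.congr fun m Θ => tc _ _ _ (by simp [hD, TypeSymbol.dual])).symm

lemma TensorType.tensor_inj {D₁ D₂ E₁ E₂ : TensorType P Ind} (hD : D₁.FitsValency v)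
    (hE : E₁.FitsValency v) (h : D₁.tensor D₂ = E₁.tensor E₂) : D₁ = E₁ ∧ D₂ = E₂ := by
  obtain ⟨a, u, l⟩ := D₁
  obtain ⟨a', u', l'⟩ := D₂
  obtain ⟨b, w, k⟩ := E₁
  obtain ⟨b', w', k'⟩ := E₂
  simp only [tensor, mk.injEq, TypeSymbol.tensor.injEq] at h
  obtain ⟨⟨rfl, rfl⟩, h1, h2⟩ := h
  have hl := hD.length_eq hE rfl
  obtain ⟨rfl, rfl⟩ := List.append_inj h1 hl.1
  obtain ⟨rfl, rfl⟩ := List.append_inj h2 hl.2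
  exact ⟨rfl, rfl⟩

lemma TensorType.eq_par_of_sym {D : TensorType P Ind} (hD : D.FitsValency v) {a b : TypeSymbol P}
    (hs : D.sym = .par a b) : ∃ D₁ D₂ : TensorType P Ind, D = D₁.par D₂ ∧ D₁.sym = a ∧
      D₂.sym = b ∧ D₁.FitsValency v ∧ D₂.FitsValency v := by
  obtain ⟨D₁, D₂, a1, a2, a3, a4, a5, a6⟩ :=
    TensorType.FitsValency.exists_split hD a b (by rw [hs]; rfl)
  exact ⟨D₁, D₂, by rw [TensorType.par, a1, a2, ← a5, ← a6, ← hs], a1, a2, a3, a4⟩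

lemma Interp.reify [Infinite Ind] (hv0 : ∀ p, v p ≠ 0) (hQ : PolPred v Q) (F : ImpType P) :
    (∀ D m Θ, D.sym = F.toSymbol → Interp v Q F.toSymbol D m Θ → Q m (D ::ₘ Θ)) ∧
    (∀ D m Θ, D.sym = F.toSymbol.dual → Interp v Q F.toSymbol.dual D m Θ → Q m (D ::ₘ Θ)) := by
  induction F with
  | atom p => exact ⟨fun D m Θ _ h => h.2, fun D m Θ _ h => h.2⟩
  | imp A B ihA ihB =>
    constructor
    · intro D m Θ hD h
      have hv := h.1
      obtain ⟨D', e1, e2, e3⟩ := hv.exists_copy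
      have hfit := hv.1 D (by simp)
      have hfit' := e3.1 D' (by simp)
      obtain ⟨D₁, D₂, rfl, a1, a2, a3, a4⟩ := TensorType.eq_par_of_sym hfit hD
      obtain ⟨E₁, E₂, rfl, b1, b2, b3, b4⟩ := TensorType.eq_par_of_sym hfit' (e1.trans hD)
      rw [← hQ.idNet_iff hv0 e1 hv e3]
      have ei := idNet_append (T := T) (D := D₁.par D₂) (E := E₁.par E₂) a3 b3
        (a1.trans b1.symm) rfl rfl rfl rfl
      have c1 := csup_idNet (T := T) a3 b3 (b1.trans a1.symm)
      have c2 := csup_idNet (T := T) a4 b4 (b2.trans a2.symm)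
      have c3 := csub_idNet (T := T) a3 b3 (b1.trans a1.symm)
      have c4 := csub_idNet (T := T) a4 b4 (b2.trans a2.symm)
      have hc := e2.2
      simp only [Multiset.insert_eq_cons, cup_cons,
        clo_cons, cup_singleton, clo_singleton, TensorType.up_par, TensorType.lo_par,
        TensorType.up_dual, TensorType.lo_dual, List.count_reverse, List.count_append] at hc
      have t1 : Ortho v Q (Interp v Q B.toSymbol) D₁.dual (idNet D₁ E₁) {E₁} := by
        refine ⟨⟨by simp [a3, b3], fun i => ?_⟩, fun n Ξ h1 h2 => ?_⟩
        · have := hc i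
          simp [c1, c3]
          omega
        · rw [TensorType.dual_dual] at h1
          rw [add_comm, Multiset.singleton_add] at h2 ⊢
          exact (hQ.idNet_iff hv0 (b1.trans a1.symm) (h1.valid hQ.toNetPred) h2).2
            (ihB.1 _ _ _ a1 h1)
      have t2 : Ortho v Q (Interp v Q A.toSymbol.dual) D₂.dual (idNet D₂ E₂) {E₂} := by
        refine ⟨⟨by simp [a4, b4], fun i => ?_⟩, fun n Ξ h1 h2 => ?_⟩
        · have := hc i
          simp [c2, c4]
          omega
        · rw [TensorType.dual_dual] at h1
          rw [add_comm, Multiset.singleton_add] at h2 ⊢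
          exact (hQ.idNet_iff hv0 (b2.trans a2.symm) (h1.valid hQ.toNetPred) h2).2
            (ihA.2 _ _ _ a2 h1)
      have hΘ : ∀ C ∈ Θ, C.FitsValency v := fun C hC => hv.1 C (by simp [hC])
      have h3 := h.2 (idNet D₂ E₂ + idNet D₁ E₁) ({E₂} + {E₁}) ⟨⟨?_, fun i => ?_⟩,
        D₂.dual, D₁.dual, _, _, _, _, TensorType.dual_par _ _, rfl, rfl, t2, t1⟩ ⟨?_, fun i => ?_⟩
      · rw [ei]
        refine hQ.par ⟨B, b1⟩ ⟨A, b2⟩ ?_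
        convert h3 using 1
        · rw [add_comm (idNet D₁ E₁)]
        · simp only [← Multiset.singleton_add]
          abel
      · simp [a3, a4, b3, b4, TensorType.FitsValency.par]
      · have := hc i
        simp [c1, c2, c3, c4]
        omega
      · simp only [Multiset.mem_add, Multiset.mem_singleton]
        rintro C (hC | rfl | rfl)
        · exact hΘ _ hC
        · exact b4
        · exact b3
      · have := e3.2 i
        rw [ei] at this
        simp [c1, c2, c3, c4] at this ⊢
        omega
    · intro D m Θ hD h
      have hv := h.1
      obtain ⟨D', e1, e2, e3⟩ := hv.exists_copy
      rw [← hQ.idNet_iff hv0 e1 hv e3]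
      have h3 := h.2 (idNet D D') {D'} ⟨by rwa [Multiset.pair_comm] at e2, ?_⟩ ?_
      · rwa [add_comm Θ, Multiset.singleton_add] at h3
      · rintro n Ξ ⟨h4, D₁, D₂, m₁, m₂, Θ₁, Θ₂, hDD, rfl, rfl, h5, h6⟩ h7
        rw [TensorType.dual_dual] at hDD h4
        subst hDD
        simp only [ImpType.toSymbol, TypeSymbol.dual, TypeSymbol.dual_dual, TensorType.sym_tensor,
          TypeSymbol.tensor.injEq] at hD
        rw [TypeSymbol.dual_dual] at h5
        rw [add_comm, Multiset.singleton_add] at h7 ⊢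
        refine (hQ.idNet_iff hv0 e1 h4 h7).2 ?_
        exact hQ.tensor ⟨A, hD.1⟩ ⟨B, hD.2⟩ (ihA.1 _ _ _ hD.1 h5) (ihB.2 _ _ _ hD.2 h6) h4
      · rwa [add_comm Θ, Multiset.singleton_add]

lemma Interp.reify_of_pol [Infinite Ind] (hv0 : ∀ p, v p ≠ 0) (hQ : PolPred v Q)
    {D : TensorType P Ind} {m : Net T Ind} {Θ : Seq P Ind} (hD : D.sym.Pos ∨ D.sym.Neg)
    (h : Interp v Q D.sym D m Θ) : Q m (D ::ₘ Θ) := by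
  rcases hD with ⟨F, hF⟩ | ⟨F, hF⟩
  · exact (Interp.reify hv0 hQ F).1 D m Θ hF (hF ▸ h)
  · exact (Interp.reify hv0 hQ F).2 D m Θ hF (hF ▸ h)

lemma Net.mapInd_inv (f : Equiv.Perm Ind) (m : Net T Ind) :
    (m.map (Factor.mapInd (f⁻¹ : Equiv.Perm Ind))).map (Factor.mapInd f) = m := by
  simp [Function.comp_def]

lemma Seq.mapInd_inv (f : Equiv.Perm Ind) (Γ : Seq P Ind) :
    (Γ.map (TensorType.mapInd (f⁻¹ : Equiv.Perm Ind))).map (TensorType.mapInd f) = Γ := by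
  simp [Function.comp_def]

def JSet.Equivariant (X : JSet P T Ind) : Prop := ∀ D m Θ (f : Equiv.Perm Ind), X D m Θ →
  X (D.mapInd f) (m.map (Factor.mapInd f)) (Θ.map (TensorType.mapInd f))

lemma Ortho.equivariant (hQ : NetPred v Q) {X : JSet P T Ind} (hX : X.Equivariant) :
    JSet.Equivariant (Ortho v Q X) := by
  rintro D m Θ f ⟨h1, h2⟩
  refine ⟨by simpa using h1.mapInd f, fun m' Θ' h' hv => ?_⟩
  have h3 := hX _ _ _ f⁻¹ h'
  rw [← TensorType.mapInd_dual, TensorType.mapInd_mapInd] at h3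
  have e1 : ((f⁻¹ : Equiv.Perm Ind) ∘ f : Ind → Ind) = id := by funext x; simp
  rw [e1, TensorType.mapInd_id] at h3
  have e2 : m.map (Factor.mapInd f) + m' =
      (m + m'.map (Factor.mapInd (f⁻¹ : Equiv.Perm Ind))).map (Factor.mapInd f) := by
    rw [Multiset.map_add, Net.mapInd_inv]
  have e3 : Θ.map (TensorType.mapInd f) + Θ' =
      (Θ + Θ'.map (TensorType.mapInd (f⁻¹ : Equiv.Perm Ind))).map (TensorType.mapInd f) := by
    rw [Multiset.map_add, Seq.mapInd_inv]
  have h4 := hv.mapInd f⁻¹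
  rw [Multiset.map_add, Multiset.map_add] at h4
  have e4 := Net.mapInd_inv f⁻¹ m
  have e5 := Seq.mapInd_inv f⁻¹ Θ
  rw [inv_inv] at e4 e5
  rw [e4, e5] at h4
  rw [e2, e3]
  exact hQ.perm (h2 _ _ h3 h4) f

lemma Tens.equivariant {X Y : JSet P T Ind} (hX : X.Equivariant)
    (hY : Y.Equivariant) : JSet.Equivariant (Tens v X Y) := by
  rintro D m Θ f ⟨h1, D₁, D₂, m₁, m₂, Θ₁, Θ₂, rfl, rfl, rfl, h2, h3⟩
  exact ⟨by simpa using h1.mapInd f, _, _, _, _, _, _, TensorType.mapInd_tensor _ _ _,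
    Multiset.map_add _ _ _, Multiset.map_add _ _ _, hX _ _ _ f h2, hY _ _ _ f h3⟩

lemma Interp.equivariant (hQ : NetPred v Q) (a : TypeSymbol P) :
    JSet.Equivariant (Interp v Q a) := by
  induction a with
  | pos p => exact fun D m Θ f h => ⟨h.1, by simpa using hQ.perm h.2 f⟩
  | neg p => exact fun D m Θ f h => ⟨h.1, by simpa using hQ.perm h.2 f⟩
  | tensor a b iha ihb => exact Ortho.equivariant hQ (Ortho.equivariant hQ (Tens.equivariant iha ihb))
  | par a b iha ihb =>
    exact Ortho.equivariant hQ (Tens.equivariant (Ortho.equivariant hQ ihb)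
      (Ortho.equivariant hQ iha))

/-- Environments for a sequent: one element of the interpretation of the dual for each type. -/
inductive Env (v : P → ℕ × ℕ) (Q : Net T Ind → Seq P Ind → Prop) :
    Seq P Ind → Net T Ind → Seq P Ind → Prop
  | nil : Env v Q 0 0 0
  | cons {D : TensorType P Ind} {Γ Θ Ξ : Seq P Ind} {m n : Net T Ind} :
      Interp v Q D.dual.sym D.dual m Θ → Env v Q Γ n Ξ → Env v Q (D ::ₘ Γ) (m + n) (Θ + Ξ)

lemma Env.balance (hQ : NetPred v Q) {Γ Ξ : Seq P Ind} {n : Net T Ind} (h : Env v Q Γ n Ξ) :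
    (∀ A ∈ Ξ, A.FitsValency v) ∧
      ∀ i, csup n i + clo Γ i + cup Ξ i = csub n i + cup Γ i + clo Ξ i := by
  induction h with
  | nil => simp
  | cons h1 _ ih =>
    have h2 := h1.valid hQ
    refine ⟨?_, fun i => ?_⟩
    · intro A hA
      rcases Multiset.mem_add.1 hA with hA | hA
      · exact h2.1 A (by simp [hA])
      · exact ih.1 A hA
    · have h3 := h2.2 i
      have h4 := ih.2 i
      simp at h3 ⊢
      omega

lemma Env.exists_of_cons {D : TensorType P Ind} {Γ Ξ : Seq P Ind} {n : Net T Ind}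
    (h : Env v Q (D ::ₘ Γ) n Ξ) : ∃ m' n' Θ' Ξ', Interp v Q D.dual.sym D.dual m' Θ' ∧
      Env v Q Γ n' Ξ' ∧ n = m' + n' ∧ Ξ = Θ' + Ξ' := by
  obtain ⟨Λ, hΛ⟩ : ∃ Λ, Λ = D ::ₘ Γ := ⟨_, rfl⟩
  rw [← hΛ] at h
  induction h generalizing Γ with
  | nil => exact absurd hΛ.symm (Multiset.cons_ne_zero)
  | @cons D' Γ' Θ Ξ m n h1 h2 ih =>
    rcases Multiset.cons_eq_cons.1 hΛ with ⟨rfl, rfl⟩ | ⟨-, Λ', rfl, rfl⟩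
    · exact ⟨m, n, Θ, Ξ, h1, h2, rfl, rfl⟩
    · obtain ⟨m', n', Θ', Ξ', h3, h4, rfl, rfl⟩ := ih rfl
      exact ⟨m', m + n', Θ', Θ + Ξ', h3, .cons h1 h4, by abel, by abel⟩

lemma Env.exists_of_add {Γ Γ' Ξ : Seq P Ind} {n : Net T Ind}
    (h : Env v Q (Γ + Γ') n Ξ) : ∃ n₁ n₂ Ξ₁ Ξ₂, Env v Q Γ n₁ Ξ₁ ∧
      Env v Q Γ' n₂ Ξ₂ ∧ n = n₁ + n₂ ∧ Ξ = Ξ₁ + Ξ₂ := by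
  induction Γ using Multiset.induction generalizing n Ξ with
  | empty => exact ⟨0, n, 0, Ξ, .nil, by simpa using h, by simp, by simp⟩
  | cons a s ih =>
    rw [Multiset.cons_add] at h
    obtain ⟨m', n', Θ', Ξ', h3, h4, rfl, rfl⟩ := h.exists_of_cons
    obtain ⟨n₁, n₂, Ξ₁, Ξ₂, h5, h6, rfl, rfl⟩ := ih h4
    exact ⟨m' + n₁, n₂, Θ' + Ξ₁, Ξ₂, .cons h3 h5, h6, by abel, by abel⟩

lemma Env.eq_zero {Ξ : Seq P Ind} {n : Net T Ind} (h : Env v Q 0 n Ξ) : n = 0 ∧ Ξ = 0 := by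
  obtain ⟨Λ, hΛ⟩ : ∃ Λ : Seq P Ind, Λ = 0 := ⟨_, rfl⟩
  rw [← hΛ] at h
  cases h with
  | nil => exact ⟨rfl, rfl⟩
  | cons => exact absurd hΛ (Multiset.cons_ne_zero)

lemma Env.mapInd (hQ : NetPred v Q) {Γ Ξ : Seq P Ind} {n : Net T Ind} (h : Env v Q Γ n Ξ)
    (f : Equiv.Perm Ind) : Env v Q (Γ.map (TensorType.mapInd f)) (n.map (Factor.mapInd f))
      (Ξ.map (TensorType.mapInd f)) := by
  induction h with
  | nil => exact .nil
  | cons h1 _ ih =>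
    rw [Multiset.map_cons, Multiset.map_add, Multiset.map_add]
    refine .cons ?_ ih
    have := Interp.equivariant hQ _ _ _ _ f h1
    rwa [TensorType.mapInd_dual] at this

/-- Soundness of a judgement with respect to the phase semantics. -/
def Sound (v : P → ℕ × ℕ) (Q : Net T Ind → Seq P Ind → Prop) (m : Net T Ind) (Γ : Seq P Ind) :
    Prop := ∀ n Ξ, Env v Q Γ n Ξ → NetValid v (m + n) Ξ → Q (m + n) Ξ

lemma Sound.mapInd (hQ : NetPred v Q) {m : Net T Ind} {Γ : Seq P Ind} (h : Sound v Q m Γ)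
    (f : Equiv.Perm Ind) :
    Sound v Q (m.map (Factor.mapInd f)) (Γ.map (TensorType.mapInd f)) := by
  intro n Ξ hE hv
  have h1 := hE.mapInd hQ f⁻¹
  have h2 := hv.mapInd f⁻¹
  have e4 := Net.mapInd_inv f⁻¹ m
  have e5 := Seq.mapInd_inv f⁻¹ Γ
  rw [inv_inv] at e4 e5
  rw [Multiset.map_add, e4] at h2
  rw [e5] at h1
  have h3 := hQ.perm (h _ _ h1 h2) f
  rwa [Multiset.map_add, Net.mapInd_inv, Seq.mapInd_inv] at h3

lemma Sound.ortho {m n : Net T Ind} {A : TensorType P Ind} {Γ Ξ : Seq P Ind}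
    (h : Sound v Q m (A ::ₘ Γ)) (hE : Env v Q Γ n Ξ) (hv : NetValid v (m + n) (A ::ₘ Ξ)) :
    Ortho v Q (Interp v Q A.dual.sym) A (m + n) Ξ := by
  refine ⟨hv, fun m' Θ' h' hv' => ?_⟩
  have e1 : m + n + m' = m + (m' + n) := by abel
  rw [e1, add_comm Ξ] at hv' ⊢
  exact h _ _ (.cons h' hE) hv'

lemma Sound.cong [Infinite Ind] (hQ : NetPred v Q) {m m' : Net T Ind}
    {Γ : Seq P Ind} (h : Sound v Q m Γ) (hm : NetValid v m Γ) (hc : NetCong m m') :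
    Sound v Q m' Γ := by
  intro n Ξ hE hv
  obtain ⟨f, hf1, hf2⟩ := exists_perm_avoid
    (m.names.filter fun i => 0 < csup m i ∧ 0 < csub m i)
    (m.names ∪ m'.names ∪ n.names ∪ Ξ.names)
  simp only [Finset.mem_filter, Finset.mem_union, Net.mem_names, Seq.mem_names] at hf1 hf2
  have hfree : ∀ i, csup m i ≠ csub m i → f i = i := by
    intro i hi
    have := hm.2 i
    exact hf2 i (by omega) (by omega)
  have hΓ : Γ.map (TensorType.mapInd f) = Γ := Seq.mapInd_eq_self fun i hi => hfree i (by
    have := hm.2 i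
    omega)
  have h1 := h.mapInd hQ f
  rw [hΓ] at h1
  have hnet : NetCong (m.map (Factor.mapInd f)) m' := by
    obtain ⟨m₀, h2, h3⟩ := NetCong.exists_reduced hc.ne_zero hm.wf
    have e : m₀.map (Factor.mapInd f) = m₀ := Net.mapInd_eq_self fun i hi => hfree i (by
      have := h2.count i
      have := h3 i
      omega)
    have h4 := h2.mapInd f
    rw [e] at h4
    exact h4.trans (h2.symm.trans hc)
  have hv' : NetValid v (m.map (Factor.mapInd f) + n) Ξ := by
    refine ⟨hv.1, fun i => ?_⟩
    obtain ⟨j, rfl⟩ := f.surjective i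
    have d1 := hv.2 (f j)
    have d2 := hm.2 (f j)
    have d3 := hc.count (f j)
    have d4 := hm.2 j
    simp only [csup_add, csub_add, csup_mapInd, csub_mapInd] at d1 ⊢
    obtain ⟨d11, d12, d13, d14⟩ := d1
    obtain ⟨d41, d42, -, -⟩ := d4
    by_cases hj : 0 < csup m j ∧ 0 < csub m j
    · have := hf1 j ⟨.inl hj.1, hj⟩
      simp only [not_or, not_lt, Nat.le_zero] at this
      obtain ⟨⟨-, e1, e2⟩, e3, e4⟩ := this
      clear hf1 hf2 hfree
      rw [e1, e2, e3, e4]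
      exact ⟨by omega, by omega, by omega, by omega⟩
    · by_cases hne : f j = j
      · rw [hne] at d2 d3 d11 d12 d13 d14 ⊢
        clear hf1 hf2 hfree
        exact ⟨by omega, by omega, by omega, by omega⟩
      · have hj0 := mt (fun h => hf2 j h (fun h => hj h.2)) hne
        have hj1 : csup m (f j) = csub m (f j) := by
          by_contra hcon
          exact hne (f.injective (hfree _ hcon))
        simp only [not_or, not_lt, Nat.le_zero] at hj0
        obtain ⟨⟨⟨⟨e1, e2⟩, -⟩, -⟩, -⟩ := hj0
        clear hf1 hf2 hfree
        rw [e1, e2]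
        exact ⟨by omega, by omega, by omega, by omega⟩
  exact hQ.cong (h1 n Ξ hE hv') (hnet.add hv'.wf hv.wf)

lemma balanced_sum_le_one {t t' n n' m m' a a' g g' x x' c c' : ℕ}
    (v : a + g + (a' + g') ≤ 1) (vb : t + (a + g) = t' + (a' + g'))
    (b : n + g' + x = n' + g + x')
    (w : a' + c + (a + c') ≤ 1) (wb : m + (a' + c) = m' + (a + c'))
    (h₁ : t + n + m ≤ 1) (h₂ : t' + n' + m' ≤ 1) (hx : x + x' ≤ 1) :
    t + n ≤ 1 ∧ t' + n' ≤ 1 ∧ a + x + (a' + x') ≤ 1 ∧ t + n + (a + x) = t' + n' + (a' + x') := by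
  refine ⟨by omega, by omega, ?_, by omega⟩
  have : (a = 0 ∧ a' = 0) ∨ (a = 1 ∧ a' = 0) ∨ (a = 0 ∧ a' = 1) := by omega
  rcases this with ⟨rfl, rfl⟩ | ⟨rfl, rfl⟩ | ⟨rfl, rfl⟩
  · omega
  · obtain ⟨rfl, rfl⟩ : m = 1 ∧ m' = 0 := by omega
    omega
  · obtain ⟨rfl, rfl⟩ : m = 0 ∧ m' = 1 := by omega
    omega

lemma balanced_add_le_one {t t' s s' a a' b b' x x' y y' m m' c c' : ℕ}
    (w : a' + b' + c + (a + b + c') ≤ 1) (wb : m + (a' + b' + c) = m' + (a + b + c'))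
    (b₁ : t + (a + x) = t' + (a' + x')) (b₂ : s + (b + y) = s' + (b' + y'))
    (c₁ : a + x + (a' + x') ≤ 1) (c₂ : b + y + (b' + y') ≤ 1) (ht : m + (t + s) ≤ 1)
    (ht' : m' + (t' + s') ≤ 1) (hx : x + y + (x' + y') ≤ 1) :
    t + s ≤ 1 ∧ t' + s' ≤ 1 ∧ a + b + (x + y) + (a' + b' + (x' + y')) ≤ 1 ∧
      t + s + (a + b + (x + y)) = t' + s' + (a' + b' + (x' + y')) := by
  refine ⟨by omega, by omega, ?_, by omega⟩
  have : (a = 0 ∧ a' = 0 ∧ b = 0 ∧ b' = 0) ∨ (a = 1 ∧ a' = 0 ∧ b = 0 ∧ b' = 0) ∨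
      (a = 0 ∧ a' = 1 ∧ b = 0 ∧ b' = 0) ∨ (a = 0 ∧ a' = 0 ∧ b = 1 ∧ b' = 0) ∨
      (a = 0 ∧ a' = 0 ∧ b = 0 ∧ b' = 1) := by
    omega
  rcases this with h | h | h | h | h <;> omega

lemma Sound.tensor (hQ : NetPred v Q) {t s : Net T Ind} {Γ Θ : Seq P Ind}
    {A B : TensorType P Ind} (ih1 : Sound v Q t (A ::ₘ Γ)) (ih2 : Sound v Q s (B ::ₘ Θ))
    (v1 : NetValid v t (A ::ₘ Γ)) (v2 : NetValid v s (B ::ₘ Θ))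
    (v3 : NetValid v (t + s) (A.tensor B ::ₘ (Γ + Θ))) :
    Sound v Q (t + s) (A.tensor B ::ₘ (Γ + Θ)) := by
  intro n Ξ hE hv
  obtain ⟨m₀, n', Θ₀, Ξ', h4, h5, rfl, rfl⟩ := hE.exists_of_cons
  obtain ⟨n₁, n₂, Ξ₁, Ξ₂, E1, E2, rfl, rfl⟩ := h5.exists_of_add
  have b1 := E1.balance hQ
  have b2 := E2.balance hQ
  have w0 := h4.valid hQ
  have hcount : ∀ i, _ := fun i => And.intro (v1.2 i) (And.intro (v2.2 i) (And.intro (v3.2 i)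
    (And.intro (b1.2 i) (And.intro (b2.2 i) (And.intro (w0.2 i) (hv.2 i))))))
  simp only [csup_add, csub_add, cup_cons, clo_cons, cup_add, clo_add,
    TensorType.up_tensor, TensorType.lo_tensor, TensorType.up_dual, TensorType.lo_dual,
    List.count_append, List.count_reverse] at hcount
  have o1 := ih1.ortho E1 (by
    refine ⟨?_, fun i => ?_⟩
    · simp only [Multiset.mem_cons, forall_eq_or_imp]
      exact ⟨v1.1 A (by simp), b1.1⟩
    · obtain ⟨⟨g11, g12, g13, g14⟩, -, -, b, -, ⟨g41, g42, g43, g44⟩, g51, g52, g53, -⟩ := hcount i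
      clear hcount
      simp only [csup_add, csub_add, cup_cons, clo_cons]
      have := balanced_sum_le_one (m := csup m₀ i) (m' := csub m₀ i)
        (c := B.lo.count i + cup Θ₀ i) (c' := B.up.count i + clo Θ₀ i) g13 g14 b
        (by linarith) (by linarith) (by linarith) (by linarith) (by linarith)
      exact this)
  have o2 := ih2.ortho E2 (by
    refine ⟨?_, fun i => ?_⟩
    · simp only [Multiset.mem_cons, forall_eq_or_imp]
      exact ⟨v2.1 B (by simp), b2.1⟩
    · obtain ⟨-, ⟨g11, g12, g13, g14⟩, -, -, b, ⟨g41, g42, g43, g44⟩, g51, g52, g53, -⟩ := hcount i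
      clear hcount
      simp only [csup_add, csub_add, cup_cons, clo_cons]
      have := balanced_sum_le_one (m := csup m₀ i) (m' := csub m₀ i)
        (c := A.lo.count i + cup Θ₀ i) (c' := A.up.count i + clo Θ₀ i) g13 g14 b
        (by linarith) (by linarith) (by linarith) (by linarith) (by linarith)
      exact this)
  have e1 : (t + s) + (m₀ + (n₁ + n₂)) = m₀ + (t + n₁ + (s + n₂)) := by
    abel
  rw [e1] at hv ⊢
  refine h4.2 _ _ ⟨⟨?_, fun i => ?_⟩, A, B, _, _, _, _, TensorType.dual_dual _, rfl, rfl, o1, o2⟩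
    hv
  · rw [TensorType.dual_dual]
    simp only [Multiset.mem_cons, forall_eq_or_imp]
    refine ⟨TensorType.FitsValency.tensor (v1.1 A (by simp)) (v2.1 B (by simp)), ?_⟩
    intro C hC
    rcases Multiset.mem_add.1 hC with hC | hC
    · exact b1.1 C hC
    · exact b2.1 C hC
  · obtain ⟨-, -, ⟨-, -, g33, -⟩, -, -, ⟨g41, g42, g43, g44⟩, g51, g52, g53, -⟩ := hcount i
    obtain ⟨-, -, c1, b1⟩ := o1.1.2 i
    obtain ⟨-, -, c2, b2⟩ := o2.1.2 i
    clear hcount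
    simp only [csup_add, csub_add, cup_cons, clo_cons] at b1 b2 c1 c2
    simp only [csup_add, csub_add, cup_cons, clo_cons, cup_add, clo_add, TensorType.dual_dual,
      TensorType.up_tensor, TensorType.lo_tensor, List.count_append]
    have := balanced_add_le_one g43 g44 b1 b2 c1 c2 (by linarith) (by linarith) (by linarith)
    exact this

/-- Derivable judgements are sound. -/
theorem TensorDer.sound [Infinite Ind] {Sg : TensorSignature P T Ind} (hv0 : ∀ p, Sg.val p ≠ 0)
    (hQ : PolPred Sg.val Q)
    (hax : ∀ e Γ, ⟨e, Γ⟩ ∈ Sg.ax → TensorJudgement.Valid Sg.val ⟨e, Γ⟩ →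
      ∃ L : TensorType P Ind, Γ = {L} ∧ L.sym.Pos ∧ Q e.flat {L})
    {e : TensorTerm T Ind} {Γ : Seq P Ind} (h : TensorDer Sg e Γ) :
    Sound Sg.val Q e.flat Γ := by
  induction h with
  | ax h1 h2 =>
    obtain ⟨L, rfl, hL, hq⟩ := hax _ _ h1 h2
    intro n Ξ hE hv
    obtain ⟨m', n', Θ', Ξ', h3, h4, rfl, rfl⟩ := hE.exists_of_cons (Γ := 0)
    obtain ⟨rfl, rfl⟩ := h4.eq_zero
    have h5 := Interp.reify_of_pol hv0 hQ (.inr (by simpa using hL.dual)) h3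
    have h6 := hQ.cut (Γ := 0) hL hq h5
    simp only [zero_add, add_zero] at h6 hv ⊢
    exact h6 hv
  | @id p U L U' L' hval =>
    obtain ⟨N, hN⟩ : ∃ N : TensorType P Ind, N = ⟨.pos p, L'.reverse, U'.reverse⟩ := ⟨_, rfl⟩
    obtain ⟨E, hE'⟩ : ∃ E : TensorType P Ind, E = ⟨.pos p, U, L⟩ := ⟨_, rfl⟩
    have e1 : TensorType.mk (.neg p) U' L' = N.dual := by
      simp [hN, TensorType.dual, TypeSymbol.dual]
    have hs : E.sym = N.sym := by simp [hN, hE']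
    have hval' := (valid_iff _ _ _).1 hval
    rw [e1, ← hE'] at hval'
    have f1 := hval'.1 E (by simp)
    have f2 : N.FitsValency Sg.val := by simpa using hval'.1 N.dual (by simp)
    have hflat := flat_idTerm (T := T) hv0 f2 f1 hs
    have hU : N.dual.up = U' := by simp [hN]
    have hL : N.dual.lo = L' := by simp [hN]
    rw [hU, hL, hE'] at hflat
    simp only at hflat
    rw [hflat, ← hE'] at hval' ⊢
    rw [e1]
    intro n Ξ hE hv
    obtain ⟨m₁, n', Θ₁, Ξ', h3, h4, rfl, rfl⟩ := hE.exists_of_cons (Γ := {E})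
    obtain ⟨m₂, n', Θ₂, Ξ', h5, h6, rfl, rfl⟩ := h4.exists_of_cons (Γ := 0)
    obtain ⟨rfl, rfl⟩ := h6.eq_zero
    have hp : N.sym.Pos := ⟨.atom p, by simp [hN, ImpType.toSymbol]⟩
    have q1 := Interp.reify_of_pol hv0 hQ (.inl (by simpa using hp)) h3
    rw [TensorType.dual_dual] at q1
    have q2 := Interp.reify_of_pol hv0 hQ (.inr (by simpa [hs] using hp.dual)) h5
    have w1 := hQ.valid q1
    have w2 := hQ.valid q2
    have fΘ : ∀ C ∈ Θ₁, C.FitsValency Sg.val := fun C hC => w1.1 C (by simp [hC])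
    simp only [add_zero] at hv ⊢
    have c1 := csup_idNet (T := T) f2 f1 hs
    have c2 := csub_idNet (T := T) f2 f1 hs
    have q3 := (hQ.idNet_iff hv0 hs w1 (by
      refine ⟨?_, fun i => ?_⟩
      · simp only [Multiset.mem_cons, forall_eq_or_imp]
        exact ⟨f1, fΘ⟩
      · have g1 := hval'.2 i
        have g2 := w1.2 i
        have g3 := w2.2 i
        have g4 := hv.2 i
        simp only [Multiset.insert_eq_cons, c1, c2, csup_add, csub_add, cup_cons, clo_cons, cup_add,
          clo_add, cup_singleton, clo_singleton, TensorType.up_dual, TensorType.lo_dual,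
          List.count_reverse] at g1 g2 g3 g4 ⊢
        obtain ⟨g11, g12, g13, g14⟩ := g1
        obtain ⟨g21, g22, g23, g24⟩ := g2
        obtain ⟨g31, g32, g33, g34⟩ := g3
        obtain ⟨g41, g42, g43, -⟩ := g4
        have : (E.up.count i = 0 ∧ E.lo.count i = 0) ∨ (E.up.count i = 1 ∧ E.lo.count i = 0) ∨
          (E.up.count i = 0 ∧ E.lo.count i = 1) := by omega
        refine ⟨by omega, by omega, ?_, by omega⟩
        rcases this with this | this | this <;> omega)).2 q1
    have e2 : idNet N E + (m₁ + m₂) = m₁ + idNet N E + m₂ := by abel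
    rw [e2] at hv ⊢
    exact hQ.cut (hs ▸ hp) q3 q2 hv
  | @cut t s Γ Θ A h1 h2 h3 ih1 ih2 =>
    intro n Ξ hE hv
    obtain ⟨n₁, n₂, Ξ₁, Ξ₂, E1, E2, rfl, rfl⟩ := hE.exists_of_add
    have v1 := h1.netValid
    have v2 := h2.netValid
    have b1 := E1.balance hQ.toNetPred
    have b2 := E2.balance hQ.toNetPred
    have o1 := ih1.ortho E1 (by
      refine ⟨?_, fun i => ?_⟩
      · simp only [Multiset.mem_cons, forall_eq_or_imp]
        exact ⟨v1.1 A (by simp), b1.1⟩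
      · have g1 := v1.2 i
        have g2 := v2.2 i
        have g3 := b1.2 i
        have g4 := b2.2 i
        have g5 := hv.2 i
        simp only [flat, csup_add, csub_add, cup_cons, clo_cons, cup_add, clo_add,
          TensorType.up_dual, TensorType.lo_dual, List.count_reverse] at g1 g2 g5 ⊢
        obtain ⟨g11, g12, g13, g14⟩ := g1
        obtain ⟨g21, g22, g23, g24⟩ := g2
        obtain ⟨g51, g52, g53, -⟩ := g5
        have : (A.up.count i = 0 ∧ A.lo.count i = 0) ∨ (A.up.count i = 1 ∧ A.lo.count i = 0) ∨
          (A.up.count i = 0 ∧ A.lo.count i = 1) := by omega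
        refine ⟨by omega, by omega, ?_, by omega⟩
        rcases this with this | this | this <;> omega)
    have i1 := ((Interp.dual hv0 hQ A.sym).2 A _ _ rfl).2 o1
    have e1 : (t.mul s).flat + (n₁ + n₂) = s.flat + (t.flat + n₁ + n₂) := by
      simp only [flat]
      abel
    rw [e1] at hv ⊢
    exact ih2 _ _ (.cons (by simpa using i1) E2) hv
  | @par t Γ A B h1 ih =>
    intro n Ξ hE hv
    obtain ⟨m₀, n', Θ₀, Ξ', h3, h4, rfl, rfl⟩ := hE.exists_of_cons
    have v1 := h1.netValid
    have b1 := h4.balance hQ.toNetPred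
    have w0 := h3.valid hQ.toNetPred
    have e1 : t.flat + (m₀ + n') = m₀ + (t.flat + n') := by abel
    rw [e1] at hv ⊢
    refine h3.2 (t.flat + n') Ξ' ⟨⟨?_, fun i => ?_⟩, fun z Z hz hvz => ?_⟩ hv
    · rw [TensorType.dual_dual]
      simp only [Multiset.mem_cons, forall_eq_or_imp]
      exact ⟨TensorType.FitsValency.par (v1.1 A (by simp)) (v1.1 B (by simp)), b1.1⟩
    · have g1 := v1.2 i
      have g3 := b1.2 i
      have g4 := w0.2 i
      have g5 := hv.2 i
      simp only [csup_add, csub_add, cup_cons, clo_cons, cup_add, clo_add, TensorType.dual_dual,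
        TensorType.up_par, TensorType.lo_par, List.count_append, TensorType.up_dual,
        TensorType.lo_dual, List.count_reverse] at g1 g3 g4 g5 ⊢
      obtain ⟨g11, g12, g13, g14⟩ := g1
      obtain ⟨g41, g42, g43, g44⟩ := g4
      obtain ⟨g51, g52, g53, -⟩ := g5
      have : (A.up.count i + B.up.count i = 0 ∧ A.lo.count i + B.lo.count i = 0) ∨
        (A.up.count i + B.up.count i = 1 ∧ A.lo.count i + B.lo.count i = 0) ∨
        (A.up.count i + B.up.count i = 0 ∧ A.lo.count i + B.lo.count i = 1) := by omega
      refine ⟨by omega, by omega, ?_, by omega⟩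
      rcases this with this | this | this <;> omega
    · rw [TensorType.dual_dual, TensorType.dual_par] at hz
      obtain ⟨hzv, D₁, D₂, z₁, z₂, Z₁, Z₂, hD, rfl, rfl, hz1, hz2⟩ := hz
      have hfB : B.dual.FitsValency Sg.val := by simpa using v1.1 B (by simp)
      obtain ⟨rfl, rfl⟩ := TensorType.tensor_inj hfB ((hz1.valid hQ.toNetPred).1 D₁ (by simp)) hD
      have e2 : t.flat + n' + (z₁ + z₂) = t.flat + (z₂ + (z₁ + n')) := by abel
      have e3 : Ξ' + (Z₁ + Z₂) = Z₂ + (Z₁ + Ξ') := by abel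
      rw [e2, e3] at hvz ⊢
      exact ih _ _ (.cons hz2 (.cons hz1 h4)) hvz
  | tensor h1 h2 h3 ih1 ih2 =>
    exact ih1.tensor hQ.toNetPred ih2 h1.netValid h2.netValid ((valid_iff _ _ _).1 h3)
  | cong h hc ih => exact ih.cong hQ.toNetPred h.netValid ⟨_, _, rfl, rfl, hc⟩
  | @alpha t Γ i i' h hi h1 h2 ih =>
    have h3 := h.netValid.alpha (i := i) h1 h2
    rw [h3.1, h3.2, flat_mapInd]
    exact ih.mapInd hQ.toNetPred _

/-- Derivable polarized judgements belong to any class that contains the axioms and is closed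
under the polarized rules. -/
theorem TensorDer.mem_polPred [Infinite Ind] {Sg : TensorSignature P T Ind}
    (hv0 : ∀ p, Sg.val p ≠ 0) (hQ : PolPred Sg.val Q)
    (hax : ∀ e Γ, ⟨e, Γ⟩ ∈ Sg.ax → TensorJudgement.Valid Sg.val ⟨e, Γ⟩ →
      ∃ L : TensorType P Ind, Γ = {L} ∧ L.sym.Pos ∧ Q e.flat {L})
    {e : TensorTerm T Ind} {Γ : Seq P Ind} (h : TensorDer Sg e Γ)
    (hΓ : ∀ D ∈ Γ, D.sym.Pos ∨ D.sym.Neg) : Q e.flat Γ := by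
  have key : ∀ (Γ Θ : Seq P Ind) (m : Net T Ind), (∀ D ∈ Γ, D.sym.Pos ∨ D.sym.Neg) →
      (∀ n Ξ, Env Sg.val Q Γ n Ξ → NetValid Sg.val (m + n) (Θ + Ξ) → Q (m + n) (Θ + Ξ)) →
      NetValid Sg.val m (Γ + Θ) → Q m (Γ + Θ) := by
    intro Γ
    induction Γ using Multiset.induction with
    | empty =>
      intro Θ m _ h hv
      simpa using h 0 0 .nil (by simpa using hv)
    | cons D Γ ih =>
      intro Θ m hp h hv
      rw [Multiset.cons_add, ← Multiset.add_cons] at hv ⊢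
      refine ih (D ::ₘ Θ) m (fun E hE => hp E (by simp [hE])) (fun n Ξ hE hv' => ?_) hv
      rw [Multiset.cons_add] at hv' ⊢
      refine Interp.reify_of_pol hv0 hQ (hp D (by simp)) ?_
      refine ((Interp.dual hv0 hQ D.sym).2 D _ _ rfl).2 ⟨hv', fun n' Ξ' h' hv'' => ?_⟩
      have e1 : m + n + n' = m + (n' + n) := by abel
      have e2 : Θ + Ξ + Ξ' = Θ + (Ξ' + Ξ) := by abel
      rw [e1, e2] at hv'' ⊢
      exact h _ _ (.cons h' hE) hv''
  have := key Γ 0 e.flat hΓ (fun n Ξ hE hv => by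
    simp only [zero_add] at hv ⊢
    exact h.sound hv0 hQ hax n Ξ hE hv) (by simpa using h.netValid)
  simpa using this

end PhaseSemantics

namespace LamTerm

variable {X C C' : Type*}

/-- The free variables of a lambda-term. -/
def fv : LamTerm X C → Set X
  | bvar _ => ∅
  | fvar x => {x}
  | con _ => ∅
  | app t s => fv t ∪ fv s
  | abs t => fv t

lemma ClosedAt.mono {t : LamTerm X C} {k l : ℕ} (h : ClosedAt k t) (hl : k ≤ l) :
    ClosedAt l t := by
  induction t generalizing k l with
  | bvar n => exact lt_of_lt_of_le h hl
  | fvar => trivial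
  | con => trivial
  | app t s iht ihs => exact ⟨iht h.1 hl, ihs h.2 hl⟩
  | abs t ih => exact ih (k := k + 1) h (by omega)

variable [DecidableEq X]

lemma ClosedAt.closeAt {t : LamTerm X C} {k : ℕ} (x : X) (h : ClosedAt k t) :
    ClosedAt (k + 1) (closeAt x k t) := by
  induction t generalizing k with
  | bvar n => exact Nat.lt_succ_of_lt h
  | fvar y =>
    rw [LamTerm.closeAt]
    split
    · exact Nat.lt_succ_self k
    · trivial
  | con => trivial
  | app t s iht ihs => exact ⟨iht h.1, ihs h.2⟩
  | abs t ih => exact ih (k := k + 1) h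

lemma ClosedAt.lam {t : LamTerm X C} (x : X) (h : ClosedAt 0 t) : ClosedAt 0 (lam x t) :=
  h.closeAt x

lemma fv_closeAt (x : X) (k : ℕ) (t : LamTerm X C) : (closeAt x k t).fv = t.fv \ {x} := by
  induction t generalizing k with
  | bvar n => simp [closeAt, fv]
  | fvar y =>
    rw [closeAt]
    split
    · simp_all [fv]
    · rename_i h
      simp only [fv]
      exact (sdiff_eq_left.2 (by simpa using h)).symm
  | con => simp [closeAt, fv]
  | app t s iht ihs => simp [closeAt, fv, iht, ihs, Set.union_sdiff_distrib]
  | abs t ih => exact ih (k + 1)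

lemma fv_lam (x : X) (t : LamTerm X C) : (lam x t).fv = t.fv \ {x} := fv_closeAt x 0 t

lemma closeAt_of_notMem {x : X} {t : LamTerm X C} (h : x ∉ t.fv) (k : ℕ) : closeAt x k t = t := by
  induction t generalizing k with
  | bvar n => rfl
  | fvar y =>
    rw [closeAt, if_neg]
    rintro rfl
    exact h rfl
  | con => rfl
  | app t s iht ihs =>
    simp only [fv, Set.mem_union, not_or] at h
    rw [closeAt, iht h.1, ihs h.2]
  | abs t ih => rw [closeAt, ih h]

lemma mapCon_closeAt {g : C → LamTerm X C'} {x : X} (hg : ∀ c, x ∉ (g c).fv) (k : ℕ)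
    (t : LamTerm X C) : mapCon g (closeAt x k t) = closeAt x k (mapCon g t) := by
  induction t generalizing k with
  | bvar n => rfl
  | fvar y =>
    simp only [closeAt, mapCon]
    split <;> rfl
  | con c => exact (closeAt_of_notMem (hg c) k).symm
  | app t s iht ihs => simp only [closeAt, mapCon, iht, ihs]
  | abs t ih => simp only [closeAt, mapCon, ih]

end LamTerm

section Derivations

variable {P C X : Type*} [DecidableEq X] {S : LamSignature P C}

lemma LamDer.closedAt {Γ : Multiset (X × ImpType P)} {t : LamTerm X C} {A : ImpType P}
    (h : LamDer S Γ t A) : t.ClosedAt 0 := by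
  induction h with
  | var => trivial
  | con => trivial
  | app _ _ _ ih1 ih2 => exact ⟨ih1, ih2⟩
  | lam _ ih => exact ih.lam _

lemma LamDer.fv_subset {Γ : Multiset (X × ImpType P)} {t : LamTerm X C} {A : ImpType P}
    (h : LamDer S Γ t A) : t.fv ⊆ {x | x ∈ Γ.map Prod.fst} := by
  induction h with
  | var x A => simp [LamTerm.fv]
  | con => simp [LamTerm.fv]
  | app _ _ _ ih1 ih2 =>
    rintro x (hx | hx)
    · simpa using .inl (by simpa using ih1 hx)
    · simpa using .inr (by simpa using ih2 hx)
  | lam _ ih =>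
    rw [LamTerm.fv_lam]
    rintro x ⟨hx, hne⟩
    have := ih hx
    simp only [Multiset.map_cons, Set.mem_ofPred_eq, Multiset.mem_cons] at this
    exact this.resolve_left hne

end Derivations

lemma strTranslation_equivariant (T Ind : Type*) : (strTranslation T Ind).Equivariant := by
  rintro c e L f ⟨i, j, hij, rfl, rfl⟩
  exact ⟨f i, f j, f.injective.ne hij, rfl, rfl⟩

lemma strTranslation_val_ne_zero (T Ind : Type*) (p : Unit) : (strTranslation T Ind).val p ≠ 0 := by
  simp [strTranslation]

namespace StringACG

variable {P C T X Ind : Type*} [DecidableEq X] [DecidableEq Ind] (G : StringACG P C T X)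

lemma onSymbol_dual (A : TypeSymbol P) : G.onSymbol A.dual = (G.onSymbol A).dual := by
  induction A with
  | pos p => rfl
  | neg p => exact (TypeSymbol.dual_dual _).symm
  | tensor A B ihA ihB => simp only [TypeSymbol.dual, onSymbol, ihA, ihB]
  | par A B ihA ihB => simp only [TypeSymbol.dual, onSymbol, ihA, ihB]

lemma onSymbol_toSymbol (A : ImpType P) : G.onSymbol A.toSymbol = (G.lexicon.onType A).toSymbol := by
  induction A with
  | atom p => rfl
  | imp A B ihA ihB =>
    rw [G.lexicon.onType_imp, ImpType.toSymbol, ImpType.toSymbol, onSymbol, onSymbol_dual, ihA, ihB]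

lemma valency_onSymbol (A : TypeSymbol P) :
    (G.onSymbol A).valency (strTranslation T Ind).val = A.valency G.val := by
  induction A with
  | pos p => rfl
  | neg p => exact TypeSymbol.valency_dual _
  | tensor A B ihA ihB => simp only [TypeSymbol.valency, onSymbol, ihA, ihB]
  | par A B ihA ihB => simp only [TypeSymbol.valency, onSymbol, ihA, ihB]

lemma val_ne_zero (p : P) : G.val p ≠ 0 :=
  TypeSymbol.valency_ne_zero (fun _ => by simp) _

lemma netValid_onTensorType {m : Net T Ind} {Γ : Seq P Ind} (h : NetValid G.val m Γ) :
    NetValid (strTranslation T Ind).val m (Γ.map G.onTensorType) := by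
  refine ⟨fun D hD => ?_, fun i => ?_⟩
  · obtain ⟨A, hA, rfl⟩ := Multiset.mem_map.1 hD
    exact (h.1 A hA).trans (G.valency_onSymbol A.sym).symm
  · have := h.2 i
    rw [cup, clo, Multiset.bind_map, Multiset.bind_map]
    exact this

lemma onTensorType_dual (A : TensorType P Ind) :
    G.onTensorType A.dual = (G.onTensorType A).dual := by
  simp only [onTensorType, TensorType.dual, onSymbol_dual]

lemma translation_equivariant : (G.translation Ind).Equivariant := by
  rintro c e L f ⟨h1, L', h2, h3⟩
  refine ⟨h1, L'.mapInd f, ?_, ?_⟩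
  · exact h2.mapInd (strTranslation_equivariant T Ind) f
  · have := congrArg (Multiset.map (TensorType.mapInd f)) h3
    simp only [Multiset.map_singleton, Multiset.map_cons] at this
    exact this

theorem translates_onTerm {Δ : Multiset (LinkedAssumption P X Ind)} {t : LamTerm X C}
    {A : ImpType P} {e : TensorTerm T Ind} {L : TensorType P Ind}
    (h : Translates G.abstractSig (G.translation Ind) Δ t A e L) :
    Translates (strLam T) (strTranslation T Ind) (Δ.map G.onAssumption) (G.onTerm t)
      (G.lexicon.onType A) e (G.onTensorType L) := by
  have hval : ∀ {e : TensorTerm T Ind} {Γ : Seq P Ind}, TensorJudgement.Valid G.val ⟨e, Γ⟩ →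
      TensorJudgement.Valid (strTranslation T Ind).val ⟨e, Γ.map G.onTensorType⟩ := fun h =>
    (valid_iff _ _ _).2 (G.netValid_onTensorType ((valid_iff _ _ _).1 h))
  induction h with
  | @var x A U L U' L' hv =>
    have := hval hv
    simp only [Multiset.insert_eq_cons, Multiset.map_cons, Multiset.map_singleton, onTensorType,
      onSymbol_dual, onSymbol_toSymbol] at this
    have := Translates.var (S := strLam T) x (G.lexicon.onType A) this
    simp only [Multiset.map_singleton, onAssumption, onTensorType, onSymbol_dual,
      onSymbol_toSymbol]
    exact this
  | con c h1 h2 h3 =>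
    obtain ⟨-, L', h4, h5⟩ := h1
    simp only [Multiset.map_zero, Multiset.cons_zero, Multiset.singleton_inj] at h5
    rw [h5]
    exact h4
  | @lam Δ x t A B e L M _ ih =>
    rw [G.lexicon.onType_imp]
    rw [Multiset.map_cons] at ih
    have := ih.lam
    have e1 : G.onTerm (.lam x t) = .lam x (G.onTerm t) := by
      refine congrArg _ (LamTerm.mapCon_closeAt (fun c hc => ?_) 0 t)
      simpa using (G.lexicon.onCon_der c).fv_subset hc
    rw [e1]
    exact this
  | @app Δ Δ' t s A B e e' L M _ _ hn hv ih1 ih2 =>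
    rw [G.lexicon.onType_imp] at ih1
    rw [onTensorType_dual] at ih2
    rw [Multiset.map_add]
    refine Translates.app (M := G.onTensorType M) ih1 ih2 ?_ ?_
    · rw [← Multiset.map_add, Multiset.map_map]
      exact hn
    · have := hval hv
      rw [← Multiset.map_add, Multiset.map_map]
      rwa [Multiset.map_cons, Multiset.map_map] at this
  | cong _ hc ih => exact ih.cong hc
  | alpha _ hi h1 h2 ih =>
    have := ih.alpha hi h1 h2
    rw [Multiset.map_map] at this ⊢
    exact this

theorem exists_translatesTo [Infinite X] [Infinite Ind] {e : TensorTerm T Ind} {Γ : Seq P Ind}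
    (hpol : Polarized Γ) (h : TensorDer (G.translation Ind).signature e Γ) :
    ∃ (Δ : Multiset (LinkedAssumption P X Ind)) (t : LamTerm X C) (A : ImpType P)
      (L : TensorType P Ind), Translates G.abstractSig (G.translation Ind) Δ t A e L ∧
        Γ = L ::ₘ links Δ := by
  have hQ := TrQ.polPred (X := X) (S := G.abstractSig) (R := G.translation Ind) G.val_ne_zero
    G.translation_equivariant
  obtain ⟨e', he, Δ, t, A, L, h1, h2⟩ := h.mem_polPred (Q := TrQ X G.abstractSig (G.translation Ind))
    G.val_ne_zero hQ (by
      rintro e Γ ⟨c, e, L, hc, ⟨⟩⟩ hv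
      exact ⟨L, rfl, ⟨_, hc.1⟩, e, rfl, 0, _, _, L, .con c hc hc.1 hv, rfl⟩) (by
      obtain ⟨A, Θ, rfl, hA, hΘ⟩ := hpol
      intro D hD
      rcases Multiset.mem_cons.1 hD with rfl | hD
      · exact .inl hA
      · exact .inr (hΘ D hD))
  exact ⟨Δ, t, A, L, h1.cong (cong_of_flat_eq ((valid_iff _ _ _).2 h1.invariants.1).wf he), h2⟩

theorem tensorDer_iff [Infinite X] [Infinite Ind] {π : TensorJudgement P T Ind}
    (hpol : Polarized π.sequent) :
    TensorDer (G.translation Ind).signature π.term π.sequent ↔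
      ∃ (Δ : Multiset (LinkedAssumption P X Ind)) (t : LamTerm X C) (A : ImpType P),
        LamDer G.abstractSig (Δ.map LinkedAssumption.assumption) t A ∧
        TranslatesTo G.abstractSig (G.translation Ind) Δ t A π ∧
        TranslatesTo (strLam T) (strTranslation T Ind) (Δ.map G.onAssumption) (G.onTerm t)
          (G.lexicon.onType A) (G.onTensorJudgement π) := by
  constructor
  · intro h
    obtain ⟨Δ, t, A, L, h1, h2⟩ := G.exists_translatesTo (X := X) hpol h
    refine ⟨Δ, t, A, h1.lamDer, ⟨L, h1, h2⟩, G.onTensorType L, G.translates_onTerm h1, ?_⟩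
    rw [onTensorJudgement, h2, Multiset.map_cons, links, Multiset.map_map, Multiset.map_map]
    rfl
  · rintro ⟨Δ, t, A, -, ⟨L, h1, h2⟩, -⟩
    obtain ⟨e', he, h3⟩ := h1.tensorDer G.val_ne_zero G.translation_equivariant
    rw [h2]
    exact h3.cong (cong_of_flat_eq ((valid_iff _ _ _).2 h3.netValid).wf he)

end StringACG

namespace LamTerm

variable {X C : Type*}

/-- Simultaneous substitution of proper terms for the free variables. -/
def subst (θ : X → LamTerm X C) : LamTerm X C → LamTerm X C
  | bvar n => bvar n
  | fvar x => θ x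
  | con c => con c
  | app t s => app (subst θ t) (subst θ s)
  | abs t => abs (subst θ t)

lemma subst_congr {θ θ' : X → LamTerm X C} {t : LamTerm X C} (h : ∀ x ∈ t.fv, θ x = θ' x) :
    subst θ t = subst θ' t := by
  induction t with
  | bvar n => rfl
  | fvar x => exact h x rfl
  | con => rfl
  | app t s iht ihs =>
    rw [subst, subst, iht fun x hx => h x (.inl hx), ihs fun x hx => h x (.inr hx)]
  | abs t ih => rw [subst, subst, ih h]

lemma subst_fvar (t : LamTerm X C) : subst fvar t = t := by
  induction t with
  | bvar n => rfl
  | fvar x => rfl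
  | con => rfl
  | app t s iht ihs => rw [subst, iht, ihs]
  | abs t ih => rw [subst, ih]

lemma subst_eq_self {θ : X → LamTerm X C} {t : LamTerm X C} (h : ∀ x ∈ t.fv, θ x = fvar x) :
    subst θ t = t := (subst_congr h).trans (subst_fvar t)

lemma subst_subst (θ τ : X → LamTerm X C) (t : LamTerm X C) :
    subst θ (subst τ t) = subst (fun x => subst θ (τ x)) t := by
  induction t with
  | bvar n => rfl
  | fvar x => rfl
  | con => rfl
  | app t s iht ihs => simp only [subst, iht, ihs]
  | abs t ih => simp only [subst, ih]

lemma ClosedAt.subst {θ : X → LamTerm X C} {t : LamTerm X C} {k : ℕ} (h : ClosedAt k t)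
    (hθ : ∀ x, ClosedAt 0 (θ x)) : ClosedAt k (subst θ t) := by
  induction t generalizing k with
  | bvar n => exact h
  | fvar x => exact (hθ x).mono (Nat.zero_le k)
  | con => trivial
  | app t s iht ihs => exact ⟨iht h.1, ihs h.2⟩
  | abs t ih => exact ih (k := k + 1) h

lemma mem_fv_subst {θ : X → LamTerm X C} {t : LamTerm X C} {y : X} (h : y ∈ (subst θ t).fv) :
    ∃ x ∈ t.fv, y ∈ (θ x).fv := by
  induction t with
  | bvar n => exact absurd h (Set.notMem_empty y)
  | fvar x => exact ⟨x, rfl, h⟩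
  | con => exact absurd h (Set.notMem_empty y)
  | app t s iht ihs =>
    rcases h with h | h
    · obtain ⟨x, hx, hy⟩ := iht h
      exact ⟨x, .inl hx, hy⟩
    · obtain ⟨x, hx, hy⟩ := ihs h
      exact ⟨x, .inr hx, hy⟩
  | abs t ih => exact ih h

lemma openAt_of_closedAt {s t : LamTerm X C} {k : ℕ} (h : ClosedAt k t) : openAt s k t = t := by
  induction t generalizing k with
  | bvar n => exact if_neg (Nat.ne_of_lt h)
  | fvar x => rfl
  | con => rfl
  | app t s iht ihs => rw [openAt, iht h.1, ihs h.2]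
  | abs t ih => rw [openAt, ih h]

variable [DecidableEq X]

lemma openAt_subst_closeAt {θ : X → LamTerm X C} (hθ : ∀ x, ClosedAt 0 (θ x)) {t : LamTerm X C}
    {k : ℕ} (h : ClosedAt k t) (s : LamTerm X C) (x : X) :
    openAt s k (subst θ (closeAt x k t)) = subst (Function.update θ x s) t := by
  induction t generalizing k with
  | bvar n => exact if_neg (Nat.ne_of_lt h)
  | fvar y =>
    rw [closeAt]
    split
    · rename_i hy
      subst hy
      simp [subst, openAt]
    · rename_i hy
      simp only [subst, Function.update_of_ne hy]
      exact openAt_of_closedAt ((hθ y).mono (Nat.zero_le k))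
  | con => rfl
  | app t u iht ihu => simp only [closeAt, subst, openAt, iht h.1, ihu h.2]
  | abs t ih => simp only [closeAt, subst, openAt, ih h]

lemma subst_closeAt {θ : X → LamTerm X C} {y : X} (hy : θ y = fvar y) {t : LamTerm X C}
    (h : ∀ x ∈ t.fv, x ≠ y → y ∉ (θ x).fv) (k : ℕ) :
    subst θ (closeAt y k t) = closeAt y k (subst θ t) := by
  induction t generalizing k with
  | bvar n => rfl
  | fvar x =>
    rw [closeAt]
    split
    · rename_i hx
      subst hx
      simp [subst, hy, closeAt]
    · rename_i hx
      exact (closeAt_of_notMem (h x rfl hx) k).symm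
  | con => rfl
  | app t s iht ihs =>
    simp only [closeAt, subst, iht fun x hx => h x (.inl hx), ihs fun x hx => h x (.inr hx)]
  | abs t ih => simp only [closeAt, subst, ih h]

lemma subst_lam {θ : X → LamTerm X C} {y : X} (hy : θ y = fvar y) {t : LamTerm X C}
    (h : ∀ x ∈ t.fv, x ≠ y → y ∉ (θ x).fv) : subst θ (lam y t) = lam y (subst θ t) :=
  congrArg abs (subst_closeAt hy h 0)

/-- Beta-reduction of a substituted abstraction. -/
lemma betaEta_app_subst_lam {θ : X → LamTerm X C} (hθ : ∀ x, ClosedAt 0 (θ x)) {t s : LamTerm X C}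
    (ht : ClosedAt 0 t) (hs : ClosedAt 0 s) (x : X) :
    BetaEta (app (subst θ (lam x t)) s) (subst (Function.update θ x s) t) := by
  rw [← openAt_subst_closeAt hθ ht]
  exact .beta ((ht.closeAt x).subst hθ) hs

lemma betaEta_app_lam {t s : LamTerm X C} (ht : ClosedAt 0 t) (hs : ClosedAt 0 s) (x : X) :
    BetaEta (app (lam x t) s) (subst (Function.update fvar x s) t) := by
  have := betaEta_app_subst_lam (θ := fvar) (fun _ => trivial) ht hs x
  rwa [subst_fvar] at this

lemma betaEta_lam_app {t : LamTerm X C} (ht : ClosedAt 0 t) {x : X} (hx : x ∉ t.fv) :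
    BetaEta (LamTerm.lam x (app t (fvar x))) t := by
  have := BetaEta.eta ht
  have e : closeAt x 0 (app t (fvar x)) = app t (bvar 0) := by
    simp [closeAt, closeAt_of_notMem hx]
  rwa [lam, e]

/-- Iterated application. -/
def apps (t : LamTerm X C) (l : List (LamTerm X C)) : LamTerm X C := l.foldl app t

/-- Iterated abstraction. -/
def lams (l : List X) (t : LamTerm X C) : LamTerm X C := l.foldr lam t

lemma betaEta_apps {t t' : LamTerm X C} (h : BetaEta t t') (l : List (LamTerm X C)) :
    BetaEta (apps t l) (apps t' l) := by
  induction l generalizing t t' with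
  | nil => exact h
  | cons s l ih => exact ih (.app h (.refl s))

lemma subst_apps (θ : X → LamTerm X C) (t : LamTerm X C) (l : List (LamTerm X C)) :
    subst θ (apps t l) = apps (subst θ t) (l.map (subst θ)) := by
  induction l generalizing t with
  | nil => rfl
  | cons s l ih => exact ih _

lemma ClosedAt.apps {t : LamTerm X C} {l : List (LamTerm X C)} (ht : ClosedAt 0 t)
    (hl : ∀ s ∈ l, ClosedAt 0 s) : ClosedAt 0 (apps t l) := by
  induction l generalizing t with
  | nil => exact ht
  | cons s l ih => exact ih ⟨ht, hl s (by simp)⟩ fun u hu => hl u (by simp [hu])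

lemma mem_fv_apps {t : LamTerm X C} {l : List (LamTerm X C)} {x : X} (h : x ∈ (apps t l).fv) :
    x ∈ t.fv ∨ ∃ s ∈ l, x ∈ s.fv := by
  induction l generalizing t with
  | nil => exact .inl h
  | cons s l ih =>
    rcases ih h with (h | h) | ⟨u, hu, h⟩
    · exact .inl h
    · exact .inr ⟨s, by simp, h⟩
    · exact .inr ⟨u, by simp [hu], h⟩

lemma ClosedAt.lams {t : LamTerm X C} (ht : ClosedAt 0 t) (l : List X) : ClosedAt 0 (lams l t) := by
  induction l with
  | nil => exact ht
  | cons x l ih => exact ih.lam x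

lemma fv_lams (l : List X) (t : LamTerm X C) : (lams l t).fv = t.fv \ {x | x ∈ l} := by
  induction l with
  | nil => simp [lams]
  | cons x l ih =>
    have : (lams (x :: l) t).fv = (lams l t).fv \ {x} := fv_lam x _
    rw [this, ih]
    ext y
    simp only [Set.mem_sdiff, Set.mem_ofPred_eq, Set.mem_singleton_iff, List.mem_cons, not_or]
    tauto

lemma subst_lams {θ : X → LamTerm X C} {l : List X} (hy : ∀ y ∈ l, θ y = fvar y)
    (h : ∀ x, ∀ y ∈ l, x ≠ y → y ∉ (θ x).fv) (t : LamTerm X C) :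
    subst θ (lams l t) = lams l (subst θ t) := by
  induction l with
  | nil => rfl
  | cons y l ih =>
    have := subst_lam (hy y (by simp)) (t := lams l t) fun x _ hx => h x y (by simp) hx
    rw [ih (fun y hy' => hy y (by simp [hy'])) fun x y hy' => h x y (by simp [hy'])] at this
    exact this

/-- Iterated beta-reduction. -/
lemma betaEta_apps_lams {θ : X → LamTerm X C} (hθ : ∀ x, ClosedAt 0 (θ x)) {l : List X}
    (hl : l.Nodup) (hfv : ∀ x, (θ x).fv ⊆ {x}) (hfix : ∀ x ∉ l, θ x = fvar x) {t : LamTerm X C}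
    (ht : ClosedAt 0 t) : BetaEta (LamTerm.apps (LamTerm.lams l t) (l.map θ)) (subst θ t) := by
  induction l generalizing θ t with
  | nil => rw [subst_eq_self fun x _ => hfix x (by simp)]; exact .refl t
  | cons x l ih =>
    rw [List.nodup_cons] at hl
    have h1 := betaEta_apps (betaEta_app_lam (ht.lams l) (hθ x) x) (l.map θ)
    have hup : ∀ z, (Function.update fvar x (θ x) z : LamTerm X C).fv ⊆ {z} := fun z => by
      by_cases hz : z = x
      · subst hz
        simpa using hfv z
      · simp [Function.update_of_ne hz, fv]
    rw [subst_lams (fun y hy => Function.update_of_ne (by rintro rfl; exact hl.1 hy) _ _)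
      (fun z y hy hzy hmem => hzy (hup z hmem).symm)] at h1
    refine BetaEta.trans h1 ?_
    have ht' : ClosedAt 0 (subst (Function.update fvar x (θ x)) t) := ht.subst fun z => by
      by_cases hz : z = x
      · subst hz
        simpa using hθ z
      · simp [Function.update_of_ne hz, ClosedAt]
    have h2 := ih (θ := Function.update θ x (fvar x)) (fun z => by
      by_cases hz : z = x
      · subst hz
        simp [ClosedAt]
      · simpa [Function.update_of_ne hz] using hθ z) hl.2 (fun z => by
      by_cases hz : z = x
      · subst hz
        simp [fv]
      · simpa [Function.update_of_ne hz] using hfv z) (fun z hz => by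
      by_cases hzx : z = x
      · subst hzx
        simp
      · rw [Function.update_of_ne hzx]
        exact hfix z (by simp [hzx, hz])) ht'
    have e1 : l.map (Function.update θ x (fvar x)) = l.map θ :=
      List.map_congr_left fun z hz => Function.update_of_ne (by rintro rfl; exact hl.1 hz) _ _
    rw [e1, subst_subst] at h2
    have e2 : (fun z => subst (Function.update θ x (fvar x)) (Function.update fvar x (θ x) z)) =
        θ := by
      funext z
      by_cases hz : z = x
      · subst hz
        rw [Function.update_self]
        refine subst_eq_self fun w hw => ?_
        obtain rfl : w = z := hfv z hw
        simp
      · rw [Function.update_of_ne hz, subst, Function.update_of_ne hz]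
    rwa [e2] at h2

/-- Solvability of finite systems of equations, up to beta-eta-equivalence. -/
theorem exists_solution [Infinite X] {I : Type*} [DecidableEq I] (N : List I) (Y : List X)
    (hY : Y.Nodup) (F : I → (I → LamTerm X C) → LamTerm X C)
    (hsubst : ∀ i (θ : X → LamTerm X C) ρ, (∀ y ∈ Y, θ y = fvar y) →
      (∀ x, ∀ y ∈ Y, x ≠ y → y ∉ (θ x).fv) → subst θ (F i ρ) = F i fun j => subst θ (ρ j))
    (hclosed : ∀ i ρ, (∀ j, ClosedAt 0 (ρ j)) → ClosedAt 0 (F i ρ))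
    (hfv : ∀ i ρ x, x ∈ (F i ρ).fv → x ∈ Y ∨ ∃ j, x ∈ (ρ j).fv) :
    ∃ ρ : I → LamTerm X C, (∀ j, ClosedAt 0 (ρ j)) ∧ ∀ i ∈ N, BetaEta (ρ i) (F i ρ) := by
  obtain ⟨r, hr⟩ : ∃ r : N.toFinset → X, Function.Injective r ∧ ∀ i, r i ∉ Y := by
    obtain ⟨f⟩ : Nonempty (N.toFinset ↪ {x // x ∉ Y.toFinset}) := by
      have : Infinite {x // x ∉ Y.toFinset} := (Y.toFinset.finite_toSet.infinite_compl).to_subtype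
      exact ⟨(Fintype.equivFin _).toEmbedding.trans
        (Fin.valEmbedding.trans (Infinite.natEmbedding _))⟩
    exact ⟨fun i => f i, fun i j h => f.injective (Subtype.ext h), fun i => by
      simpa using (f i).2⟩
  let V : List X := N.toFinset.attach.toList.map r ++ Y
  have hV : V.Nodup := by
    refine List.nodup_append.2 ⟨(Finset.nodup_toList _).map hr.1, hY, ?_⟩
    rintro _ ha _ hb rfl
    obtain ⟨i, -, rfl⟩ := List.mem_map.1 ha
    exact hr.2 i hb
  have hrV : ∀ i, r i ∈ V := fun i => List.mem_append.2 (.inl (List.mem_map.2 ⟨i, by simp, rfl⟩))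
  let ρ₀ : I → LamTerm X C := fun i =>
    if h : i ∈ N.toFinset then apps (fvar (r ⟨i, h⟩)) (V.map fvar) else abs (bvar 0)
  have hρ₀ : ∀ j, ClosedAt 0 (ρ₀ j) := fun j => by
    dsimp only [ρ₀]
    split
    · exact ClosedAt.apps trivial (by simp [ClosedAt])
    · exact Nat.zero_lt_one
  let K : I → LamTerm X C := fun i => lams V (F i ρ₀)
  have hK : ∀ i, (K i).fv = ∅ := fun i => by
    rw [fv_lams]
    refine sdiff_eq_bot_iff.2 fun x hx => ?_
    rcases hfv i ρ₀ x hx with h | ⟨j, h⟩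
    · exact List.mem_append.2 (.inr h)
    · dsimp only [ρ₀] at h
      split at h
      · rcases mem_fv_apps h with h | ⟨s, hs, h⟩
        · rw [show x = _ from h]
          exact hrV _
        · obtain ⟨y, hy, rfl⟩ := List.mem_map.1 hs
          rw [show x = y from h]
          exact hy
      · exact absurd h (Set.notMem_empty x)
  have hKc : ∀ i, ClosedAt 0 (K i) := fun i => (hclosed i ρ₀ hρ₀).lams V
  classical
  let θ : X → LamTerm X C := fun x => if h : ∃ i, r i = x then K h.choose.1 else fvar x
  have hθr : ∀ i, θ (r i) = K i.1 := fun i => by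
    have h : ∃ j, r j = r i := ⟨i, rfl⟩
    dsimp only [θ]
    rw [dif_pos h, hr.1 h.choose_spec]
  have hθY : ∀ x, (∀ i, r i ≠ x) → θ x = fvar x := fun x hx => dif_neg (by simpa using hx)
  have hθfv : ∀ x, (θ x).fv ⊆ {x} := fun x => by
    by_cases h : ∃ i, r i = x
    · obtain ⟨i, rfl⟩ := h
      rw [hθr, hK]
      exact Set.empty_subset _
    · rw [hθY x (by simpa using h)]
      exact subset_rfl
  have hθc : ∀ x, ClosedAt 0 (θ x) := fun x => by
    by_cases h : ∃ i, r i = x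
    · obtain ⟨i, rfl⟩ := h
      rw [hθr]
      exact hKc _
    · rw [hθY x (by simpa using h)]
      trivial
  refine ⟨fun j => subst θ (ρ₀ j), fun j => (hρ₀ j).subst hθc, fun i hi => ?_⟩
  rw [← hsubst i θ ρ₀ (fun y hy => hθY y fun j hj => hr.2 j (hj ▸ hy))
    (fun x y _ hxy hmem => hxy (hθfv x hmem).symm)]
  have hi' : i ∈ N.toFinset := by simpa using hi
  have e : subst θ (ρ₀ i) = apps (K i) (V.map θ) := by
    dsimp only [ρ₀]
    rw [dif_pos hi', subst_apps, subst, hθr, List.map_map]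
    rfl
  show BetaEta (subst θ (ρ₀ i)) _
  rw [e]
  refine betaEta_apps_lams hθc hV hθfv (fun x hx => hθY x ?_) (hclosed i ρ₀ hρ₀)
  rintro j rfl
  exact hx (hrV j)

end LamTerm

open LamTerm (BetaEta ClosedAt)

section Decorated

variable {Ind Ind' : Type*}

namespace ImpType

/-- The underlying type over a single atom. -/
def skel : ImpType Ind → ImpType Unit
  | atom _ => .atom ()
  | imp A B => .imp A.skel B.skel

/-- The upper and the lower indices of the tensor type denoted by an implicational type whose atoms
are indices. -/
def indices : ImpType Ind → List Ind × List Ind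
  | atom i => ([i], [])
  | imp A B => (B.indices.1 ++ A.indices.2.reverse, B.indices.2 ++ A.indices.1.reverse)

def up (D : ImpType Ind) : List Ind := D.indices.1

def lo (D : ImpType Ind) : List Ind := D.indices.2

@[simp] lemma up_atom (i : Ind) : (atom i).up = [i] := rfl
@[simp] lemma lo_atom (i : Ind) : (atom i).lo = [] := rfl
@[simp] lemma up_imp (A B : ImpType Ind) : (imp A B).up = B.up ++ A.lo.reverse := rfl
@[simp] lemma lo_imp (A B : ImpType Ind) : (imp A B).lo = B.lo ++ A.up.reverse := rfl

def mapAtom (f : Ind → Ind') : ImpType Ind → ImpType Ind'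
  | atom i => .atom (f i)
  | imp A B => .imp (A.mapAtom f) (B.mapAtom f)

lemma skel_mapAtom (f : Ind → Ind') (D : ImpType Ind) : (D.mapAtom f).skel = D.skel := by
  induction D with
  | atom i => rfl
  | imp A B ihA ihB => rw [mapAtom, skel, ihA, ihB, skel]

lemma up_lo_mapAtom (f : Ind → Ind') (D : ImpType Ind) :
    (D.mapAtom f).up = D.up.map f ∧ (D.mapAtom f).lo = D.lo.map f := by
  induction D with
  | atom i => exact ⟨rfl, rfl⟩
  | imp A B ihA ihB =>
    simp only [mapAtom, up_imp, lo_imp, ihA, ihB, List.map_append, List.map_reverse, and_self]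

lemma length_eq_of_skel {D E : ImpType Ind} (h : D.skel = E.skel) :
    D.up.length = E.up.length ∧ D.lo.length = E.lo.length := by
  induction D generalizing E with
  | atom i =>
    cases E with
    | atom j => simp
    | imp => cases h
  | imp A B ihA ihB =>
    cases E with
    | atom j => cases h
    | imp A' B' =>
      simp only [skel, imp.injEq] at h
      simp [ihA h.1, ihB h.2]

/-- The string tensor type with given indices. -/
def deco (D : ImpType Ind) : TensorType Unit Ind := ⟨D.skel.toSymbol, D.up, D.lo⟩

@[simp] lemma up_deco (D : ImpType Ind) : D.deco.up = D.up := rfl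
@[simp] lemma lo_deco (D : ImpType Ind) : D.deco.lo = D.lo := rfl

lemma deco_imp (A B : ImpType Ind) : (imp A B).deco = B.deco.par A.deco.dual := rfl

lemma deco_mapAtom (f : Ind → Ind) (D : ImpType Ind) :
    (D.mapAtom f).deco = D.deco.mapInd f := by
  rw [deco, skel_mapAtom, (up_lo_mapAtom f D).1, (up_lo_mapAtom f D).2]
  rfl

lemma fitsValency_deco [DecidableEq Ind] (D : ImpType Ind) :
    D.deco.FitsValency (fun _ => (1, 0)) := by
  induction D with
  | atom i => rfl
  | imp A B ihA ihB => exact ihB.par (TensorType.fits_dual.2 ihA)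

lemma exists_deco [DecidableEq Ind] {A : ImpType Unit} {L : TensorType Unit Ind} (hL : L.sym = A.toSymbol)
    (hv : L.FitsValency fun _ => (1, 0)) : ∃ D : ImpType Ind, D.deco = L := by
  induction A generalizing L with
  | atom p =>
    obtain ⟨s, U, V⟩ := L
    obtain rfl : s = .pos p := hL
    simp only [TensorType.FitsValency, TypeSymbol.valency, Prod.mk.injEq, List.length_eq_one_iff,
      List.length_eq_zero_iff] at hv
    obtain ⟨⟨i, rfl⟩, rfl⟩ := hv
    exact ⟨.atom i, rfl⟩
  | imp A B ihA ihB =>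
    obtain ⟨L₁, L₂, rfl, h1, h2, h3, h4⟩ := TensorType.eq_par_of_sym hv hL
    obtain ⟨E, rfl⟩ := ihB h1 h3
    obtain ⟨D, hD⟩ := ihA (L := L₂.dual) (by simp [h2]) (TensorType.fits_dual.2 h4)
    exact ⟨.imp D E, by rw [deco_imp, hD, TensorType.dual_dual]⟩

lemma deco_injective [DecidableEq Ind] : Function.Injective (deco (Ind := Ind)) := by
  intro D E h
  induction D generalizing E with
  | atom i =>
    cases E with
    | atom j =>
      have : [i] = [j] := congrArg TensorType.up h
      simpa using this
    | imp A B => exact absurd (congrArg TensorType.sym h) (by simp [deco, skel, toSymbol])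
  | imp A B ihA ihB =>
    cases E with
    | atom j => exact absurd (congrArg TensorType.sym h) (by simp [deco, skel, toSymbol])
    | imp A' B' =>
      have h1 : (imp A B).deco.dual = (imp A' B').deco.dual := by rw [h]
      rw [deco_imp, deco_imp, TensorType.dual_par, TensorType.dual_par, TensorType.dual_dual,
        TensorType.dual_dual] at h1
      obtain ⟨h2, h3⟩ := TensorType.tensor_inj A.fitsValency_deco A'.fitsValency_deco h1
      have h4 : B.deco = B'.deco := by rw [← B.deco.dual_dual, h3, TensorType.dual_dual]
      rw [ihA h2, ihB h4]

/-- Types of the same shape with related atoms. -/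
def Match (R : Ind → Ind → Prop) : ImpType Ind → ImpType Ind → Prop
  | atom i, atom j => R i j
  | imp A B, imp A' B' => A.Match R A' ∧ B.Match R B'
  | _, _ => False

lemma Match.of_forall₂ {R : Ind → Ind → Prop} {D E : ImpType Ind} (h : D.skel = E.skel)
    (hup : List.Forall₂ R D.up E.up) (hlo : List.Forall₂ R D.lo E.lo) : D.Match R E := by
  induction D generalizing E with
  | atom i =>
    cases E with
    | atom j => simpa [Match] using hup
    | imp => cases h
  | imp A B ihA ihB =>
    cases E with
    | atom j => cases h
    | imp A' B' =>
      simp only [skel, imp.injEq] at h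
      have lA := length_eq_of_skel h.1
      have lB := length_eq_of_skel h.2
      rw [up_imp, up_imp, List.forall₂_iff_zip, List.zip_append lB.1] at hup
      rw [lo_imp, lo_imp, List.forall₂_iff_zip, List.zip_append lB.2] at hlo
      refine ⟨ihA h.1 ?_ ?_, ihB h.2 ?_ ?_⟩
      · rw [← List.forall₂_reverse_iff, List.forall₂_iff_zip]
        exact ⟨by simp [lA.1], fun h => hlo.2 (List.mem_append.2 (.inr h))⟩
      · rw [← List.forall₂_reverse_iff, List.forall₂_iff_zip]
        exact ⟨by simp [lA.2], fun h => hup.2 (List.mem_append.2 (.inr h))⟩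
      · exact List.forall₂_iff_zip.2 ⟨lB.1, fun h => hup.2 (List.mem_append.2 (.inl h))⟩
      · exact List.forall₂_iff_zip.2 ⟨lB.2, fun h => hlo.2 (List.mem_append.2 (.inl h))⟩

end ImpType

end Decorated

section Relation

variable {T X Ind : Type*} [DecidableEq X]

/-- The term `s` is proper, its variables are among `K`, and `K` is compatible with the variables
assigned to the indices of `D`. -/
structure Bounded (ν : Ind → Set X) (D : ImpType Ind) (K : Set X) (s : LamTerm X T) : Prop where
  closed : s.ClosedAt 0
  fv : s.fv ⊆ K
  up : ∀ i ∈ D.up, ν i ⊆ K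
  lo : ∀ i ∈ D.lo, Disjoint K (ν i)

/-- The logical relation between lambda-terms and tensor types, with respect to a valuation `ρ` of
the indices. -/
def Realizes (ρ : Ind → LamTerm X T) (ν : Ind → Set X) :
    ImpType Ind → Set X → LamTerm X T → Prop
  | .atom i, K, s => Bounded ν (.atom i) K s ∧ BetaEta s (ρ i)
  | .imp A B, K, s => Bounded ν (.imp A B) K s ∧ ∀ K' u, Realizes ρ ν A K' u → Disjoint K K' →
      (∀ i ∈ B.lo, Disjoint K' (ν i)) → Realizes ρ ν B (K ∪ K') (.app s u)

variable {ρ ρ' : Ind → LamTerm X T} {ν ν' : Ind → Set X}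

lemma Realizes.bounded {D : ImpType Ind} {K : Set X} {s : LamTerm X T} (h : Realizes ρ ν D K s) :
    Bounded ν D K s := by
  cases D with
  | atom i => exact h.1
  | imp A B => exact h.1

lemma Bounded.congr {D : ImpType Ind} {K : Set X} {s : LamTerm X T}
    (hν : ∀ i, i ∈ D.up ∨ i ∈ D.lo → ν i = ν' i) (h : Bounded ν D K s) : Bounded ν' D K s where
  closed := h.closed
  fv := h.fv
  up i hi := hν i (.inl hi) ▸ h.up i hi
  lo i hi := hν i (.inr hi) ▸ h.lo i hi

lemma Realizes.congr {D : ImpType Ind} (hρ : ∀ i, i ∈ D.up ∨ i ∈ D.lo → ρ i = ρ' i)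
    (hν : ∀ i, i ∈ D.up ∨ i ∈ D.lo → ν i = ν' i) {K : Set X} {s : LamTerm X T} :
    Realizes ρ ν D K s ↔ Realizes ρ' ν' D K s := by
  have hb : ∀ {D : ImpType Ind} {K : Set X} {s : LamTerm X T},
      (∀ i, i ∈ D.up ∨ i ∈ D.lo → ν i = ν' i) → (Bounded ν D K s ↔ Bounded ν' D K s) :=
    fun h => ⟨.congr h, .congr fun i hi => (h i hi).symm⟩
  induction D generalizing K s with
  | atom i => rw [Realizes, Realizes, hb hν, hρ i (by simp)]
  | imp A B ihA ihB =>
    have hA : ∀ i, i ∈ A.up ∨ i ∈ A.lo → i ∈ (ImpType.imp A B).up ∨ i ∈ (ImpType.imp A B).lo := by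
      simp
      tauto
    have hB : ∀ i, i ∈ B.up ∨ i ∈ B.lo → i ∈ (ImpType.imp A B).up ∨ i ∈ (ImpType.imp A B).lo := by
      simp
      tauto
    rw [Realizes, Realizes, hb hν]
    refine and_congr_right fun _ => forall_congr' fun K' => forall_congr' fun u => ?_
    refine imp_congr (ihA (fun i hi => hρ i (hA i hi)) fun i hi => hν i (hA i hi))
      (imp_congr_right fun _ => imp_congr ?_
        (ihB (fun i hi => hρ i (hB i hi)) fun i hi => hν i (hB i hi)))
    refine forall_congr' fun i => forall_congr' fun hi => ?_
    rw [hν i (by simp [hi])]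

lemma Bounded.mapAtom {Ind' : Type*} {ν : Ind' → Set X} (f : Ind → Ind') {D : ImpType Ind}
    {K : Set X} {s : LamTerm X T} : Bounded ν (D.mapAtom f) K s ↔ Bounded (ν ∘ f) D K s := by
  have h := ImpType.up_lo_mapAtom f D
  constructor
  · intro hb
    refine ⟨hb.closed, hb.fv, fun i hi => hb.up (f i) ?_, fun i hi => hb.lo (f i) ?_⟩
    · rw [h.1]
      exact List.mem_map_of_mem hi
    · rw [h.2]
      exact List.mem_map_of_mem hi
  · intro hb
    refine ⟨hb.closed, hb.fv, fun i hi => ?_, fun i hi => ?_⟩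
    · rw [h.1] at hi
      obtain ⟨j, hj, rfl⟩ := List.mem_map.1 hi
      exact hb.up j hj
    · rw [h.2] at hi
      obtain ⟨j, hj, rfl⟩ := List.mem_map.1 hi
      exact hb.lo j hj

lemma Realizes.mapAtom {Ind' : Type*} {ρ : Ind' → LamTerm X T} {ν : Ind' → Set X} (f : Ind → Ind')
    {D : ImpType Ind} {K : Set X} {s : LamTerm X T} :
    Realizes ρ ν (D.mapAtom f) K s ↔ Realizes (ρ ∘ f) (ν ∘ f) D K s := by
  induction D generalizing K s with
  | atom i =>
    rw [Realizes, ← Bounded.mapAtom]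
    rfl
  | imp A B ihA ihB =>
    rw [Realizes, ← Bounded.mapAtom]
    refine and_congr_right fun _ => forall_congr' fun K' => forall_congr' fun u => ?_
    refine imp_congr ihA (imp_congr_right fun _ => imp_congr ?_ ihB)
    rw [(ImpType.up_lo_mapAtom f B).2]
    exact List.forall_mem_map

lemma Realizes.betaEta {D : ImpType Ind} {K : Set X} {s s' : LamTerm X T}
    (h : Realizes ρ ν D K s) (hs : BetaEta s' s) (hb : Bounded ν D K s') :
    Realizes ρ ν D K s' := by
  induction D generalizing K s s' with
  | atom i => exact ⟨hb, hs.trans h.2⟩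
  | imp A B ihA ihB =>
    refine ⟨hb, fun K' u hu h1 h2 => ?_⟩
    have h3 := h.2 K' u hu h1 h2
    refine ihB h3 (.app hs (.refl u)) ⟨⟨hb.closed, hu.bounded.closed⟩, ?_, h3.bounded.up,
      h3.bounded.lo⟩
    exact Set.union_subset_union hb.fv hu.bounded.fv

/-- Realizers of `E` are realizers of `D`, provided that the upper indices of `D` and the lower
indices of `E` own no variables. -/
def Transports (ρ : Ind → LamTerm X T) (ν : Ind → Set X) (D E : ImpType Ind) : Prop :=
  (∀ i ∈ D.up, ν i = ∅) → (∀ i ∈ E.lo, ν i = ∅) → ∀ (K : Set X) (s : LamTerm X T),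
    Realizes ρ ν E K s → (∀ i ∈ D.lo, Disjoint K (ν i)) → Realizes ρ ν D K s

lemma Transports.atom {i j : Ind} (h : BetaEta (ρ i) (ρ j)) :
    Transports ρ ν (.atom j) (.atom i) := fun hD _ _ _ hs hK =>
  ⟨⟨hs.1.closed, hs.1.fv, fun i hi => by simp [hD i hi], hK⟩, hs.2.trans h⟩

lemma Transports.imp {A B A' B' : ImpType Ind} (hA : Transports ρ ν A' A)
    (hB : Transports ρ ν B B') : Transports ρ ν (.imp A B) (.imp A' B') := by
  intro hD hE K s h hK
  have hup := h.1.up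
  simp only [ImpType.up_imp, ImpType.lo_imp, List.mem_append, List.mem_reverse] at hD hE hK hup
  refine ⟨⟨h.1.closed, h.1.fv, fun i hi => ?_, fun i hi => ?_⟩, fun K' u hu h1 h2 => ?_⟩
  · simp only [ImpType.up_imp, List.mem_append, List.mem_reverse] at hi
    simp [hD i hi]
  · simp only [ImpType.lo_imp, List.mem_append, List.mem_reverse] at hi
    exact hK i hi
  · refine hB (fun i hi => hD i (.inl hi)) (fun i hi => hE i (.inl hi)) _ _ (h.2 K' u ?_ h1 ?_) ?_
    · exact hA (fun i hi => hE i (.inr hi)) (fun i hi => hD i (.inr hi)) _ _ hu fun i hi =>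
        h1.symm.mono_right (hup i (.inr hi))
    · intro i hi
      simp [hE i (.inl hi)]
    · intro i hi
      exact Set.disjoint_union_left.2 ⟨hK i (.inl hi), h2 i hi⟩

lemma ImpType.Match.transports {D E : ImpType Ind}
    (hm : D.Match (fun i j => BetaEta (ρ i) (ρ j)) E) :
    Transports ρ ν D E ∧ Transports ρ ν E D := by
  induction D generalizing E with
  | atom i =>
    cases E with
    | atom j => exact ⟨.atom (BetaEta.symm hm), .atom hm⟩
    | imp => exact hm.elim
  | imp A B ihA ihB =>
    cases E with
    | atom j => exact hm.elim
    | imp A' B' =>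
      have h1 := ihA hm.1
      have h2 := ihB hm.2
      exact ⟨.imp h1.2 h2.1, .imp h1.1 h2.2⟩

/-- Iterated application of constants. -/
def LamTerm.word (w : List T) (s : LamTerm X T) : LamTerm X T :=
  w.foldr (fun c u => .app (.con c) u) s

lemma LamTerm.word_append (w w' : List T) (s : LamTerm X T) :
    word (w ++ w') s = word w (word w' s) := List.foldr_append

lemma LamTerm.ClosedAt.word {s : LamTerm X T} {k : ℕ} (h : s.ClosedAt k) (w : List T) :
    (LamTerm.word w s).ClosedAt k := by
  induction w with
  | nil => exact h
  | cons c w ih => exact ⟨trivial, ih⟩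

lemma LamTerm.betaEta_word {s s' : LamTerm X T} (h : BetaEta s s') (w : List T) :
    BetaEta (word w s) (word w s') := by
  induction w with
  | nil => exact h
  | cons c w ih => exact .app (.refl _) ih

lemma LamTerm.openAt_word (u s : LamTerm X T) (k : ℕ) (w : List T) :
    openAt u k (word w s) = word w (openAt u k s) := by
  induction w with
  | nil => rfl
  | cons c w ih => exact congrArg (LamTerm.app (.con c)) ih

lemma LamTerm.exists_word_fixpoint (w : List T) :
    ∃ s : LamTerm X T, s.ClosedAt 0 ∧ BetaEta s (word w s) := by
  let W : LamTerm X T := .abs (word w (.app (.bvar 0) (.bvar 0)))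
  have h1 : (word w (.app (.bvar 0) (.bvar 0)) : LamTerm X T).ClosedAt 1 :=
    ClosedAt.word (s := .app (.bvar 0) (.bvar 0)) (And.intro Nat.zero_lt_one Nat.zero_lt_one) w
  have hW : W.ClosedAt 0 := h1
  refine ⟨.app W W, ⟨hW, hW⟩, ?_⟩
  have := BetaEta.beta h1 hW
  rw [openAt_word] at this
  exact this

/-- The valuation `ρ` satisfies the equations given by a tensor term. -/
def Sat (ρ : Ind → LamTerm X T) : TensorTerm T Ind → Prop
  | .edge w i j => BetaEta (ρ j) (.word w (ρ i))
  | .loop _ => True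
  | .mul t s => Sat ρ t ∧ Sat ρ s

lemma sat_iff {e : TensorTerm T Ind} :
    Sat ρ e ↔ ∀ w i j, Factor.edge w i j ∈ e.flat → BetaEta (ρ j) (.word w (ρ i)) := by
  induction e with
  | edge w i j =>
    simp only [Sat, flat, Multiset.mem_singleton, Factor.edge.injEq]
    exact ⟨by rintro h _ _ _ ⟨rfl, rfl, rfl⟩; exact h, fun h => h w i j ⟨rfl, rfl, rfl⟩⟩
  | loop w => simp [Sat, flat]
  | mul t s iht ihs =>
    simp only [Sat, iht, ihs, flat, Multiset.mem_add]
    exact ⟨fun h w i j hm => hm.elim (h.1 w i j) (h.2 w i j),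
      fun h => ⟨fun w i j hm => h w i j (.inl hm), fun w i j hm => h w i j (.inr hm)⟩⟩

lemma Sat.of_mapInd {f : Ind → Ind} {e : TensorTerm T Ind} (h : Sat ρ (e.mapInd f)) :
    Sat (ρ ∘ f) e := by
  induction e with
  | edge w i j => exact h
  | loop w => trivial
  | mul t s iht ihs => exact ⟨iht h.1, ihs h.2⟩

variable [DecidableEq Ind]

lemma Sat.congr {e : TensorTerm T Ind} (h : ∀ i, 0 < csup e.flat i ∨ 0 < csub e.flat i →
    ρ i = ρ' i) (hs : Sat ρ e) : Sat ρ' e := by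
  induction e with
  | edge w i j =>
    rw [Sat, ← h i (by simp [flat, Factor.sup]), ← h j (by simp [flat, Factor.sub])]
    exact hs
  | loop w => trivial
  | mul t s iht ihs =>
    simp only [flat, csup_add, csub_add] at h
    exact ⟨iht (fun i hi => h i (by omega)) hs.1, ihs (fun i hi => h i (by omega)) hs.2⟩

/-- Every solution of the equations of `e` can be changed to one of `e'` without changing the values
at the free indices. -/
def SatLe (X : Type*) [DecidableEq X] (e e' : TensorTerm T Ind) : Prop :=
  ∀ ρ : Ind → LamTerm X T, (∀ i, (ρ i).ClosedAt 0) → Sat ρ e →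
    ∃ ρ' : Ind → LamTerm X T, (∀ i, (ρ' i).ClosedAt 0) ∧ Sat ρ' e' ∧
      ∀ i, csup e.flat i ≠ csub e.flat i → ρ' i = ρ i

lemma SatLe.of_imp {e e' : TensorTerm T Ind} (h : ∀ ρ : Ind → LamTerm X T, Sat ρ e → Sat ρ e') :
    SatLe X e e' := fun ρ hc hs => ⟨ρ, hc, h ρ hs, fun _ _ => rfl⟩

lemma SatLe.mul {t s k : TensorTerm T Ind} (h : SatLe X t s) (hts : t.Cong s)
    (h2 : WF (s.mul k)) : SatLe X (t.mul k) (s.mul k) := by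
  intro ρ hc hs
  obtain ⟨ρ', hc', hs', hf⟩ := h ρ hc hs.1
  have hwf : ∀ i, csup s.flat i + csup k.flat i ≤ 1 ∧ csub s.flat i + csub k.flat i ≤ 1 := by
    intro i
    have := (wf_iff _).1 h2 i
    simpa [flat] using this
  refine ⟨fun i => if 0 < csup s.flat i ∨ 0 < csub s.flat i then ρ' i else ρ i, fun i => ?_,
    ⟨hs'.congr fun i hi => (if_pos hi).symm, hs.2.congr fun i hi => ?_⟩, fun i hi => ?_⟩
  · dsimp only
    split
    · exact hc' i
    · exact hc i
  · have h3 := hwf i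
    have h4 := hts.count i
    split
    · exact (hf i (by omega)).symm
    · rfl
  · have h3 := hwf i
    have h4 := hts.count i
    simp only [flat, csup_add, csub_add] at hi
    dsimp only
    split
    · exact hf i (by omega)
    · rfl

lemma TensorTerm.Cong.satLe {e e' : TensorTerm T Ind} (h : e.Cong e') :
    SatLe X e e' ∧ SatLe X e' e := by
  induction h with
  | assoc => exact ⟨.of_imp fun ρ h => ⟨h.1.1, h.1.2, h.2⟩, .of_imp fun ρ h => ⟨⟨h.1, h.2.1⟩, h.2.2⟩⟩
  | comm => exact ⟨.of_imp fun ρ h => ⟨h.2, h.1⟩, .of_imp fun ρ h => ⟨h.2, h.1⟩⟩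
  | mul h h1 h2 ih => exact ⟨ih.1.mul h h2, ih.2.mul h.symm h1⟩
  | @glue u v i j k h =>
    have hik : j ≠ k := by
      rintro rfl
      have := h.1
      simp [sups] at this
    have hij : j ≠ i := by
      rintro rfl
      have := h.2
      simp [subs] at this
    refine ⟨.of_imp fun ρ h => ?_, fun ρ hc h => ?_⟩
    · rw [Sat, LamTerm.word_append]
      exact h.1.trans (LamTerm.betaEta_word h.2 u)
    · refine ⟨Function.update ρ j (.word v (ρ k)), fun l => ?_, ⟨?_, ?_⟩, fun l hl => ?_⟩
      · by_cases hl : l = j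
        · subst hl
          simpa using (hc k).word v
        · simpa [hl] using hc l
      · rw [Sat, Function.update_self, Function.update_of_ne hij.symm, ← LamTerm.word_append]
        exact h
      · rw [Sat, Function.update_self, Function.update_of_ne hik.symm]
        exact .refl _
      · refine Function.update_of_ne ?_ _ _
        rintro rfl
        simp [flat, Factor.sup, Factor.sub, hik, hij] at hl
  | loop u i =>
    refine ⟨.of_imp fun _ _ => trivial, fun ρ hc _ => ?_⟩
    obtain ⟨s, h1, h2⟩ := LamTerm.exists_word_fixpoint (X := X) u
    exact ⟨fun _ => s, fun _ => h1, h2, fun i hi => by simp [flat, Factor.sup, Factor.sub] at hi⟩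
  | rotate => exact ⟨.of_imp fun _ _ => trivial, .of_imp fun _ _ => trivial⟩
  | refl => exact ⟨.of_imp fun _ => id, .of_imp fun _ => id⟩
  | symm _ ih => exact ih.symm
  | trans c1 c2 ih1 ih2 =>
    refine ⟨fun ρ hc h => ?_, fun ρ hc h => ?_⟩
    · obtain ⟨ρ', a1, a2, a3⟩ := ih1.1 ρ hc h
      obtain ⟨ρ'', b1, b2, b3⟩ := ih2.1 ρ' a1 a2
      refine ⟨ρ'', b1, b2, fun i hi => ?_⟩
      have := c1.count i
      rw [b3 i (by omega), a3 i hi]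
    · obtain ⟨ρ', a1, a2, a3⟩ := ih2.2 ρ hc h
      obtain ⟨ρ'', b1, b2, b3⟩ := ih1.2 ρ' a1 a2
      refine ⟨ρ'', b1, b2, fun i hi => ?_⟩
      have := c2.count i
      rw [b3 i (by omega), a3 i hi]

end Relation

section Fundamental

variable {T X Ind : Type*} [DecidableEq X] [DecidableEq Ind]

lemma NetValid.notMem {P : Type*} {v : P → ℕ × ℕ} {m : Net T Ind} {D C : TensorType P Ind}
    {Γ : Seq P Ind} (h : NetValid v m (D ::ₘ Γ)) (hC : C ∈ Γ) {i : Ind} (hi : i ∈ C.up ∨ i ∈ C.lo) :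
    i ∉ D.up ∧ i ∉ D.lo := by
  obtain ⟨Γ', rfl⟩ := Multiset.exists_cons_of_mem hC
  have h1 := (h.2 i).2.2.1
  simp only [cup_cons, clo_cons] at h1
  rw [← List.count_pos_iff, ← List.count_pos_iff] at hi
  rw [← List.count_pos_iff, ← List.count_pos_iff]
  omega

lemma forall₂_of_forall_zipWith {α β γ : Type*} {f : α → β → γ} {Q : γ → Prop} {l : List α}
    {l' : List β} (hl : l.length = l'.length) (h : ∀ c ∈ List.zipWith f l l', Q c) :
    List.Forall₂ (fun a b => Q (f a b)) l l' := by
  induction l generalizing l' with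
  | nil =>
    cases l' with
    | nil => exact .nil
    | cons => simp at hl
  | cons a l ih =>
    cases l' with
    | nil => simp at hl
    | cons b l' =>
      exact .cons (h _ (by simp)) (ih (by simpa using hl) fun c hc => h c (by simp [hc]))

/-- The variables owned by the values substituted for the variables of a context. -/
def support {P : Type*} (κ : X → Set X) (Δ : Multiset (LinkedAssumption P X Ind)) : Set X :=
  {y | ∃ a ∈ Δ, y ∈ κ a.var}

lemma support_add {P : Type*} (κ : X → Set X) (Δ Δ' : Multiset (LinkedAssumption P X Ind)) :
    support κ (Δ + Δ') = support κ Δ ∪ support κ Δ' := by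
  ext y
  simp only [support, Multiset.mem_add, Set.mem_union, Set.mem_ofPred_eq]
  constructor
  · rintro ⟨a, ha | ha, hy⟩
    · exact .inl ⟨a, ha, hy⟩
    · exact .inr ⟨a, ha, hy⟩
  · rintro (⟨a, ha, hy⟩ | ⟨a, ha, hy⟩)
    · exact ⟨a, .inl ha, hy⟩
    · exact ⟨a, .inr ha, hy⟩

lemma LamDer.fv_subst_subset {P C : Type*} {S : LamSignature P C}
    {Δ : Multiset (LinkedAssumption P X Ind)} {t : LamTerm X C} {A : ImpType P}
    (h : LamDer S (Δ.map LinkedAssumption.assumption) t A) {σ : X → LamTerm X C} {κ : X → Set X}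
    (hσ : ∀ a ∈ Δ, (σ a.var).fv ⊆ κ a.var) : (LamTerm.subst σ t).fv ⊆ support κ Δ := by
  intro y hy
  obtain ⟨x, hx, hxy⟩ := LamTerm.mem_fv_subst hy
  have := h.fv_subset hx
  rw [Multiset.map_map] at this
  obtain ⟨a, ha, rfl⟩ := Multiset.mem_map.1 this
  exact ⟨a, ha, hσ a ha hxy⟩

/-- A substitution for the variables of `Δ` by realizers of the linked types, which is compatible
with a goal type `L`. -/
structure Realization (ρ : Ind → LamTerm X T) (ν : Ind → Set X) (σ : X → LamTerm X T)
    (κ : X → Set X) (Δ : Multiset (LinkedAssumption Unit X Ind)) (L : TensorType Unit Ind) :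
    Prop where
  closed : ∀ x, (σ x).ClosedAt 0
  up : ∀ i ∈ L.up, ν i = ∅
  link_up : ∀ a ∈ Δ, ∀ i ∈ a.link.up, ν i = ∅
  realizes : ∀ a ∈ Δ, ∃ E : ImpType Ind, E.deco.dual = a.link ∧
    Realizes ρ ν E (κ a.var) (σ a.var)
  disjoint : ∀ a ∈ Δ, ∀ b ∈ Δ, a.var ≠ b.var → Disjoint (κ a.var) (κ b.var)
  lo : ∀ a ∈ Δ, ∀ i ∈ L.lo, Disjoint (κ a.var) (ν i)

variable {ρ ρ' : Ind → LamTerm X T} {ν ν' : Ind → Set X} {σ : X → LamTerm X T} {κ : X → Set X}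
  {Δ : Multiset (LinkedAssumption Unit X Ind)} {L : TensorType Unit Ind}

lemma Realization.congr (h : Realization ρ ν σ κ Δ L)
    (hρ : ∀ a ∈ Δ, ∀ i, i ∈ a.link.up ∨ i ∈ a.link.lo → ρ i = ρ' i) :
    Realization ρ' ν σ κ Δ L where
  closed := h.closed
  up := h.up
  link_up := h.link_up
  realizes a ha := by
    obtain ⟨E, h1, h2⟩ := h.realizes a ha
    refine ⟨E, h1, (Realizes.congr (fun i hi => hρ a ha i ?_) fun _ _ => rfl).1 h2⟩
    rw [← h1]
    simpa [or_comm] using hi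
  disjoint := h.disjoint
  lo := h.lo

lemma Realization.bounded {S : LamSignature Unit T} {t : LamTerm X T} {A : ImpType Unit}
    (h : Realization ρ ν σ κ Δ L)
    (ht : LamDer S (Δ.map LinkedAssumption.assumption) t A) {D : ImpType Ind} (hD : D.deco = L) :
    Bounded ν D (support κ Δ) (LamTerm.subst σ t) where
  closed := ht.closedAt.subst h.closed
  fv := ht.fv_subst_subset fun a ha => by
    obtain ⟨E, -, h2⟩ := h.realizes a ha
    exact h2.bounded.fv
  up i hi := by
    rw [h.up i (by rw [← hD]; exact hi)]
    exact Set.empty_subset _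
  lo i hi := by
    rw [Set.disjoint_left]
    rintro y ⟨a, ha, hy⟩ hy'
    exact Set.disjoint_left.1 (h.lo a ha i (by rw [← hD]; exact hi)) hy hy'

/-- The part of a realization that concerns a premise of an application; `M` is the cut type. -/
lemma Realization.restrict (h : Realization ρ ν σ κ Δ L)
    {Δ' : Multiset (LinkedAssumption Unit X Ind)} {L' M : TensorType Unit Ind} (hΔ : Δ' ≤ Δ)
    (hM : ∀ a ∈ Δ', ∀ i, i ∈ a.link.up ∨ i ∈ a.link.lo → i ∉ M.up ∧ i ∉ M.lo)
    (hup : ∀ i ∈ L'.up, i ∈ L.up ∨ i ∈ M.up ∨ i ∈ M.lo)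
    (hlo : ∀ i ∈ L'.lo, i ∈ L.lo ∨ i ∈ M.up ∨ i ∈ M.lo) :
    Realization ρ (fun i => if i ∈ M.up ∨ i ∈ M.lo then ∅ else ν i) σ κ Δ' L' where
  closed := h.closed
  up i hi := by
    split
    · rfl
    · exact h.up i ((hup i hi).resolve_right ‹_›)
  link_up a ha i hi := by
    rw [if_neg (by simpa using hM a ha i (.inl hi))]
    exact h.link_up a (Multiset.mem_of_le hΔ ha) i hi
  realizes a ha := by
    obtain ⟨E, h1, h2⟩ := h.realizes a (Multiset.mem_of_le hΔ ha)
    refine ⟨E, h1, (Realizes.congr (fun _ _ => rfl) fun i hi => ?_).1 h2⟩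
    rw [if_neg (by simpa using hM a ha i (by rw [← h1]; simpa [or_comm] using hi))]
  disjoint a ha b hb :=
    h.disjoint a (Multiset.mem_of_le hΔ ha) b (Multiset.mem_of_le hΔ hb)
  lo a ha i hi := by
    split
    · exact Set.disjoint_empty _
    · exact h.lo a (Multiset.mem_of_le hΔ ha) i ((hlo i hi).resolve_right ‹_›)

/-- The fundamental lemma of the logical relation. -/
theorem Translates.realizes {t : LamTerm X T} {A : ImpType Unit} {e : TensorTerm T Ind}
    (h : Translates (strLam T) (strTranslation T Ind) Δ t A e L) :
    ∀ (ρ : Ind → LamTerm X T) (ν : Ind → Set X) (σ : X → LamTerm X T) (κ : X → Set X)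
      (D : ImpType Ind), (∀ i, (ρ i).ClosedAt 0) → Sat ρ e → D.deco = L →
      Realization ρ ν σ κ Δ L → Realizes ρ ν D (support κ Δ) (LamTerm.subst σ t) := by
  induction h with
  | @var x A U L U' L' hv =>
    intro ρ ν σ κ D hρ hs hD hr
    obtain ⟨E, h1, h2⟩ := hr.realizes _ (Multiset.mem_singleton_self _)
    have hsup : support κ {(⟨x, A, ⟨A.toSymbol.dual, U', L'⟩⟩ : LinkedAssumption Unit X Ind)} =
        κ x := by
      ext y
      simp [support]
    rw [hsup]
    have hsym : E.deco.sym = D.deco.sym := by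
      have := congrArg TensorType.sym h1
      simp only [TensorType.sym_dual] at this
      rw [hD, ← TypeSymbol.dual_dual E.deco.sym, this, TypeSymbol.dual_dual]
    have hskel : D.skel = E.skel := ImpType.toSymbol_injective hsym.symm
    have hlen := ImpType.length_eq_of_skel hskel
    have hflat := flat_idTerm (T := T) (strTranslation_val_ne_zero T Ind) E.fitsValency_deco
      D.fitsValency_deco hsym.symm
    rw [h1, hD] at hflat
    rw [sat_iff, hflat, idNet] at hs
    simp only [Multiset.mem_add, Multiset.mem_coe] at hs
    have m1 := forall₂_of_forall_zipWith (f := Factor.edge (T := T) [])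
      (Q := fun c => ∀ w i j, c = Factor.edge w i j → BetaEta (ρ j) (.word w (ρ i))) (l := L)
      (l' := E.deco.lo) (by
        have := congrArg TensorType.lo hD
        simp only [ImpType.lo_deco] at this
        rw [ImpType.lo_deco, ← hlen.2, this])
      (fun c hc w i j e => hs w i j (.inl (e ▸ hc)))
    have m2 := forall₂_of_forall_zipWith (f := Factor.edge (T := T) [])
      (Q := fun c => ∀ w i j, c = Factor.edge w i j → BetaEta (ρ j) (.word w (ρ i)))
      (l := E.deco.up) (l' := U) (by
        have := congrArg TensorType.up hD
        simp only [ImpType.up_deco] at this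
        rw [ImpType.up_deco, ← hlen.1, this])
      (fun c hc w i j e => hs w i j (.inr (e ▸ hc)))
    have hU : D.up = U := congrArg TensorType.up hD
    have hL : D.lo = L := congrArg TensorType.lo hD
    have hm : D.Match (fun i j => BetaEta (ρ i) (ρ j)) E := by
      refine .of_forall₂ hskel ?_ ?_
      · rw [hU]
        exact (m2.imp fun i j h => h _ _ _ rfl).flip
      · rw [hL]
        exact m1.imp fun i j h => (h _ _ _ rfl).symm
    refine hm.transports.1 (fun i hi => hr.up i (hU ▸ hi)) (fun i hi => ?_) _ _ h2 fun i hi =>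
      hr.lo _ (Multiset.mem_singleton_self _) i (hL ▸ hi)
    refine hr.link_up _ (Multiset.mem_singleton_self _) i ?_
    rw [← h1]
    simpa using hi
  | con c h1 h2 h3 =>
    intro ρ ν σ κ D hρ hs hD hr
    obtain ⟨i, j, hij, rfl, rfl⟩ := h1
    obtain rfl : D = .imp (.atom j) (.atom i) := ImpType.deco_injective (by
      rw [hD]
      rfl)
    refine ⟨hr.bounded (S := strLam T) (A := strType) (.con c) hD, fun K' u hu h4 h5 => ?_⟩
    refine ⟨⟨⟨trivial, hu.1.closed⟩, ?_, ?_, by simp⟩, (BetaEta.app (.refl _) hu.2).trans hs.symm⟩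
    · exact Set.union_subset_union (Set.empty_subset _) hu.1.fv
    · intro k hk
      simp only [ImpType.up_atom, List.mem_singleton] at hk
      subst hk
      rw [hr.up k (by simp)]
      exact Set.empty_subset _
  | @lam Δ x t A B e L M h ih =>
    intro ρ ν σ κ D hρ hs hD hr
    have hi := h.invariants
    obtain ⟨B', rfl⟩ := ImpType.exists_deco hi.2.2.1 (hi.1.1 L (by simp))
    obtain ⟨A', hA'⟩ := ImpType.exists_deco (A := A) (L := M.dual)
      (by
        have hM : M.sym = A.toSymbol.dual := hi.2.2.2 ⟨x, A, M⟩ (Multiset.mem_cons_self _ _)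
        rw [TensorType.sym_dual, hM, TypeSymbol.dual_dual])
      (TensorType.fits_dual.2 (hi.1.1 M (by simp [links])))
    obtain rfl : M = A'.deco.dual := by rw [hA', TensorType.dual_dual]
    obtain rfl : D = .imp A' B' := ImpType.deco_injective hD
    have hb := hr.bounded h.lam.lamDer hD
    refine ⟨hb, fun K' u hu h4 h5 => ?_⟩
    have hn := hi.2.1
    rw [Multiset.map_cons, Multiset.nodup_cons] at hn
    have hne : ∀ a ∈ Δ, a.var ≠ x := fun a ha hax =>
      hn.1 (Multiset.mem_map.2 ⟨a, ha, hax⟩)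
    have hKa : ∀ a ∈ Δ, Disjoint K' (κ a.var) := fun a ha =>
      h4.symm.mono_right fun y (hy : y ∈ κ a.var) => show y ∈ support κ Δ from ⟨a, ha, hy⟩
    have hsup : support (Function.update κ x K') (⟨x, A, A'.deco.dual⟩ ::ₘ Δ) =
        support κ Δ ∪ K' := by
      ext y
      simp only [support, Multiset.mem_cons, exists_eq_or_imp, Function.update_self,
        Set.mem_ofPred_eq, Set.mem_union, or_comm (a := y ∈ K')]
      refine or_congr_left (exists_congr fun a => and_congr_right fun ha => ?_)
      rw [Function.update_of_ne (hne a ha)]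
    have hr' : Realization ρ ν (Function.update σ x u) (Function.update κ x K')
        (⟨x, A, A'.deco.dual⟩ ::ₘ Δ) B'.deco := by
      refine ⟨fun y => ?_, fun i hi => hr.up i (by simpa using .inl (by simpa using hi)), ?_, ?_, ?_, ?_⟩
      · by_cases hy : y = x
        · subst hy
          simpa using hu.bounded.closed
        · simpa [hy] using hr.closed y
      · rintro a ha i hi
        rcases Multiset.mem_cons.1 ha with rfl | ha
        · exact hr.up i (by simpa using .inr (by simpa using hi))
        · exact hr.link_up a ha i hi
      · rintro a ha
        rcases Multiset.mem_cons.1 ha with rfl | ha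
        · exact ⟨A', rfl, by simpa using hu⟩
        · obtain ⟨E, h6, h7⟩ := hr.realizes a ha
          refine ⟨E, h6, ?_⟩
          rwa [Function.update_of_ne (hne a ha), Function.update_of_ne (hne a ha)]
      · intro a ha b hb hab
        rcases Multiset.mem_cons.1 ha with rfl | ha <;> rcases Multiset.mem_cons.1 hb with rfl | hb
        · exact absurd rfl hab
        · rw [Function.update_self, Function.update_of_ne (hne b hb)]
          exact hKa b hb
        · rw [Function.update_self, Function.update_of_ne (hne a ha)]
          exact (hKa a ha).symm
        · rw [Function.update_of_ne (hne b hb), Function.update_of_ne (hne a ha)]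
          exact hr.disjoint a ha b hb hab
      · intro a ha i hi
        rcases Multiset.mem_cons.1 ha with rfl | ha
        · rw [Function.update_self]
          exact h5 i hi
        · rw [Function.update_of_ne (hne a ha)]
          exact hr.lo a ha i (by simpa using .inl hi)
    have h6 := ih ρ ν _ _ B' hρ hs rfl hr'
    rw [hsup] at h6
    refine h6.betaEta (LamTerm.betaEta_app_subst_lam hr.closed h.lamDer.closedAt
      hu.bounded.closed x) ⟨⟨hb.closed, hu.bounded.closed⟩, ?_, h6.bounded.up, h6.bounded.lo⟩
    exact Set.union_subset_union hb.fv hu.bounded.fv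
  | @app Δ Δ' t s A B e e' L M h1 h2 hn hv ih1 ih2 =>
    intro ρ ν σ κ D hρ hs hD hr
    subst hD
    have i1 := h1.invariants
    have i2 := h2.invariants
    obtain ⟨A', hA'⟩ := ImpType.exists_deco i2.2.2.1 (i2.1.1 _ (by simp))
    obtain rfl : M = A'.deco.dual := by rw [hA', TensorType.dual_dual]
    rw [TensorType.dual_dual] at *
    have i3 := (valid_iff _ _ _).1 hv
    have n1 : ∀ a ∈ Δ, ∀ i, i ∈ a.link.up ∨ i ∈ a.link.lo →
        i ∉ A'.deco.up ∧ i ∉ A'.deco.lo := by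
      intro a ha i hi
      have := i1.1.notMem (Multiset.mem_map_of_mem LinkedAssumption.link ha) hi
      simp only [TensorType.up_par, TensorType.lo_par, TensorType.up_dual, TensorType.lo_dual,
        List.mem_append, List.mem_reverse, not_or] at this
      exact ⟨this.2.2, this.1.2⟩
    have n2 : ∀ a ∈ Δ', ∀ i, i ∈ a.link.up ∨ i ∈ a.link.lo →
        i ∉ A'.deco.up ∧ i ∉ A'.deco.lo := fun a ha i hi =>
      i2.1.notMem (Multiset.mem_map_of_mem LinkedAssumption.link ha) hi
    have n3 : ∀ i, i ∈ D.up ∨ i ∈ D.lo → ¬(i ∈ A'.deco.up ∨ i ∈ A'.deco.lo) := by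
      intro i hi hi'
      have := (i1.1.2 i).2.2.1
      simp only [cup_cons, clo_cons, TensorType.up_par, TensorType.lo_par, TensorType.up_dual,
        TensorType.lo_dual, List.count_append, List.count_reverse] at this
      rw [← ImpType.up_deco, ← ImpType.lo_deco, ← List.count_pos_iff, ← List.count_pos_iff] at hi
      rw [← List.count_pos_iff, ← List.count_pos_iff] at hi'
      omega
    have r1 := ih1 ρ _ σ κ (.imp A' D) hρ hs.1 rfl (hr.restrict (M := A'.deco)
      (Multiset.le_add_right Δ Δ') n1 (by simp; tauto) (by simp; tauto))
    have r2 := ih2 ρ _ σ κ A' hρ hs.2 rfl (hr.restrict (M := A'.deco)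
      (Multiset.le_add_left Δ' Δ) n2 (by simp; tauto) (by simp; tauto))
    have r3 := r1.2 _ _ r2 (by
      rw [Set.disjoint_left]
      rintro y ⟨a, ha, hy⟩ ⟨b, hb, hy'⟩
      rw [Multiset.map_add, Multiset.nodup_add] at hn
      refine Set.disjoint_left.1 (hr.disjoint a (by simp [ha]) b (by simp [hb]) fun hab => ?_)
        hy hy'
      refine Multiset.disjoint_left.1 hn.2.2 (Multiset.mem_map_of_mem _ ha) ?_
      rw [hab]
      exact Multiset.mem_map_of_mem _ hb) (by
      intro i hi
      dsimp only
      rw [if_neg (n3 i (.inr hi)), Set.disjoint_left]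
      rintro y ⟨a, ha, hy⟩ hy'
      exact Set.disjoint_left.1 (hr.lo a (by simp [ha]) i hi) hy hy')
    rw [support_add]
    refine (Realizes.congr (fun _ _ => rfl) fun i hi => ?_).1 r3
    exact if_neg (n3 i hi)
  | @cong Δ t A e e' L h hc ih =>
    intro ρ ν σ κ D hρ hs hD hr
    obtain ⟨ρ', h1, h2, h3⟩ := (hc.satLe (X := X)).2 ρ hρ hs
    have hv := h.invariants.1
    have hagree : ∀ C ∈ L ::ₘ links Δ, ∀ i, i ∈ C.up ∨ i ∈ C.lo → ρ i = ρ' i := by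
      intro C hC i hi
      refine (h3 i ?_).symm
      obtain ⟨Γ', hΓ'⟩ := Multiset.exists_cons_of_mem hC
      rw [hΓ'] at hv
      have h4 := hv.2 i
      have h5 := hc.count i
      simp only [cup_cons, clo_cons] at h4
      rw [← List.count_pos_iff, ← List.count_pos_iff] at hi
      omega
    have h4 := ih ρ' ν σ κ D h1 h2 hD (hr.congr fun a ha i hi =>
      hagree _ (Multiset.mem_cons_of_mem (Multiset.mem_map_of_mem _ ha)) i hi)
    refine (Realizes.congr (fun i hi => ?_) fun _ _ => rfl).2 h4
    exact hagree L (Multiset.mem_cons_self _ _) i (by rw [← hD]; exact hi)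
  | @alpha Δ t A e L i i' h hi h1 h2 ih =>
    intro ρ ν σ κ D hρ hs hD hr
    have hv := h.invariants
    obtain ⟨E, rfl⟩ := ImpType.exists_deco hv.2.2.1 (hv.1.1 L (by simp))
    rw [← ImpType.deco_mapAtom] at hD
    obtain rfl := ImpType.deco_injective hD
    have hsup : support κ (Δ.map fun a => (⟨a.var, a.type, a.link.mapInd (replaceIndex i i')⟩ :
        LinkedAssumption Unit X Ind)) = support κ Δ := by
      ext y
      simp [support]
    have hmem := fun a (ha : a ∈ Δ) => Multiset.mem_map_of_mem (fun a =>
      (⟨a.var, a.type, a.link.mapInd (replaceIndex i i')⟩ : LinkedAssumption Unit X Ind)) ha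
    rw [hsup, Realizes.mapAtom]
    refine ih (ρ ∘ replaceIndex i i') (ν ∘ replaceIndex i i') σ κ E (fun j => hρ _) hs.of_mapInd rfl
      ⟨hr.closed, fun j hj => hr.up _ (List.mem_map_of_mem hj), fun a ha j hj =>
        hr.link_up _ (Multiset.mem_map_of_mem _ ha) _ (List.mem_map_of_mem hj), fun a ha => ?_,
        fun a ha b hb hab => 
          hr.disjoint _ (hmem a ha) ⟨b.var, b.type, b.link.mapInd (replaceIndex i i')⟩ (hmem b hb)
          hab, fun a ha j hj =>
        hr.lo _ (Multiset.mem_map_of_mem _ ha) _ (List.mem_map_of_mem hj)⟩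
    obtain ⟨F, hF, hF'⟩ := hr.realizes _ (Multiset.mem_map_of_mem _ ha)
    obtain ⟨F₀, h3⟩ := ImpType.exists_deco (A := a.type) (L := a.link.dual)
      (by simp [hv.2.2.2 a ha])
      (TensorType.fits_dual.2 (hv.1.1 a.link
        (Multiset.mem_cons_of_mem (Multiset.mem_map_of_mem _ ha))))
    obtain rfl : F = F₀.mapAtom (replaceIndex i i') := ImpType.deco_injective (by
      rw [ImpType.deco_mapAtom, h3, TensorType.mapInd_dual]
      exact (TensorType.dual_dual _).symm.trans (congrArg TensorType.dual hF))
    exact ⟨F₀, by rw [h3, TensorType.dual_dual], Realizes.mapAtom _ |>.1 hF'⟩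

end Fundamental

section Canonical

variable {T X Ind : Type*} [DecidableEq X]

namespace ImpType

/-- The target atom. -/
def hd : ImpType Ind → Ind
  | atom i => i
  | imp _ B => B.hd

lemma exists_up_eq (D : ImpType Ind) : ∃ l, D.up = D.hd :: l := by
  induction D with
  | atom i => exact ⟨[], rfl⟩
  | imp A B _ ihB =>
    obtain ⟨l, hl⟩ := ihB
    exact ⟨l ++ A.lo.reverse, by rw [up_imp, hl]; rfl⟩

lemma hd_mem_up (D : ImpType Ind) : D.hd ∈ D.up := by
  obtain ⟨l, hl⟩ := D.exists_up_eq
  rw [hl]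
  exact List.mem_cons_self

/-- The types of the variables that are bound in a long normal form of the given type, and in the
arguments of a variable of the given type in a long normal form. -/
def binders : ImpType Ind → List (ImpType Ind) × List (ImpType Ind)
  | atom _ => ([], [])
  | imp A B => (A :: A.binders.2 ++ B.binders.1, A.binders.1 ++ B.binders.2)

lemma map_hd_binders (D : ImpType Ind) : (D.binders.1.map hd).Perm D.lo ∧
    ((D :: D.binders.2).map hd).Perm D.up := by
  induction D with
  | atom i => exact ⟨.refl _, .refl _⟩
  | imp A B ihA ihB =>
    constructor
    · rw [binders, List.map_append, lo_imp]
      exact (ihA.2.append ihB.1).trans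
        (List.perm_append_comm.trans ((List.reverse_perm _).symm.append_left _))
    · have h : ((imp A B :: (imp A B).binders.2).map hd).Perm
          ((B :: B.binders.2).map hd ++ A.binders.1.map hd) := by
        simp only [List.map_cons, binders, hd, List.map_append, List.cons_append]
        exact List.perm_append_comm.cons _
      rw [up_imp]
      exact h.trans (ihB.2.append (ihA.1.trans (List.reverse_perm _).symm))

/-- The long normal form of the given type, the values of the atoms being given. -/
def canon (ρ : Ind → LamTerm X T) (g : Ind → X) : ImpType Ind → LamTerm X T
  | atom i => ρ i
  | imp A B => .lam (g A.hd) (canon ρ g B)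

/-- Application to long normal forms. -/
def appCanon (ρ : Ind → LamTerm X T) (g : Ind → X) : ImpType Ind → LamTerm X T → LamTerm X T
  | atom _, s => s
  | imp A B, s => appCanon ρ g B (.app s (A.canon ρ g))

variable {ρ : Ind → LamTerm X T} {g : Ind → X}

lemma betaEta_appCanon {s s' : LamTerm X T} (h : BetaEta s s') (D : ImpType Ind) :
    BetaEta (D.appCanon ρ g s) (D.appCanon ρ g s') := by
  induction D generalizing s s' with
  | atom i => exact h
  | imp A B _ ihB => exact ihB (.app h (.refl _))

lemma closedAt_canon (hρ : ∀ i, (ρ i).ClosedAt 0) (D : ImpType Ind) : (D.canon ρ g).ClosedAt 0 := by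
  induction D with
  | atom i => exact hρ i
  | imp A B _ ihB => exact LamTerm.ClosedAt.lam _ ihB

lemma closedAt_appCanon (hρ : ∀ i, (ρ i).ClosedAt 0) (D : ImpType Ind) {s : LamTerm X T}
    (hs : s.ClosedAt 0) : (D.appCanon ρ g s).ClosedAt 0 := by
  induction D generalizing s with
  | atom i => exact hs
  | imp A B _ ihB => exact ihB ⟨hs, A.closedAt_canon hρ⟩

lemma exists_mem_fv_of_canon {D : ImpType Ind} {x : X} (h : x ∈ (D.canon ρ g).fv) :
    ∃ i, x ∈ (ρ i).fv := by
  induction D with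
  | atom i => exact ⟨i, h⟩
  | imp A B _ ihB =>
    rw [canon, LamTerm.fv_lam] at h
    exact ihB h.1

lemma exists_mem_fv_of_appCanon {D : ImpType Ind} {s : LamTerm X T} {x : X}
    (h : x ∈ (D.appCanon ρ g s).fv) : x ∈ s.fv ∨ ∃ i, x ∈ (ρ i).fv := by
  induction D generalizing s with
  | atom i => exact .inl h
  | imp A B _ ihB =>
    rcases ihB h with (h | h) | h
    · exact .inl h
    · exact .inr (exists_mem_fv_of_canon h)
    · exact .inr h

lemma subst_canon {θ : X → LamTerm X T} (h1 : ∀ i, θ (g i) = .fvar (g i))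
    (h2 : ∀ x i, x ≠ g i → g i ∉ (θ x).fv) (D : ImpType Ind) :
    LamTerm.subst θ (D.canon ρ g) = D.canon (fun i => LamTerm.subst θ (ρ i)) g := by
  induction D with
  | atom i => rfl
  | imp A B _ ihB =>
    rw [canon, LamTerm.subst_lam (h1 _) (fun x _ hx => h2 x _ hx), ihB, canon]

lemma subst_appCanon {θ : X → LamTerm X T} (h1 : ∀ i, θ (g i) = .fvar (g i))
    (h2 : ∀ x i, x ≠ g i → g i ∉ (θ x).fv) (D : ImpType Ind) (s : LamTerm X T) :
    LamTerm.subst θ (D.appCanon ρ g s) =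
      D.appCanon (fun i => LamTerm.subst θ (ρ i)) g (LamTerm.subst θ s) := by
  induction D generalizing s with
  | atom i => rfl
  | imp A B _ ihB => rw [appCanon, ihB, LamTerm.subst, subst_canon h1 h2, appCanon]

end ImpType

/-- The value of the target atom of `E` is the application of the variable chosen for `E` to long
normal forms. -/
def Solves (ρ : Ind → LamTerm X T) (g : Ind → X) (E : ImpType Ind) : Prop :=
  BetaEta (ρ E.hd) (E.appCanon ρ g (.fvar (g E.hd)))

lemma Realizes.reify_reflect {ρ : Ind → LamTerm X T} {g : Ind → X} {ν : Ind → Set X}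
    (D : ImpType Ind) :
    (∀ (K : Set X) (s : LamTerm X T), (∀ E ∈ D.binders.1, Solves ρ g E) → (∀ i ∈ D.up, ν i = ∅) →
      (∀ i ∈ D.lo, ν i = {g i}) → (D.lo.map g).Nodup → Realizes ρ ν D K s →
      BetaEta s (D.canon ρ g)) ∧
    (∀ (K : Set X) (s : LamTerm X T), (∀ E ∈ D.binders.2, Solves ρ g E) →
      (∀ i ∈ D.up, ν i = {g i}) → (∀ i ∈ D.lo, ν i = ∅) → (D.up.map g).Nodup →
      Bounded ν D K s → BetaEta (D.appCanon ρ g s) (ρ D.hd) → Realizes ρ ν D K s) := by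
  induction D with
  | atom i => exact ⟨fun K s _ _ _ _ h => h.2, fun K s _ _ _ _ h1 h2 => ⟨h1, h2⟩⟩
  | imp A B ihA ihB =>
    constructor
    · intro K s hE hup hlo hn h
      simp only [ImpType.binders, List.cons_append, List.mem_cons, List.mem_append] at hE
      have hK := h.1.lo
      simp only [ImpType.up_imp, ImpType.lo_imp, List.mem_append, List.mem_reverse] at hup hlo hK
      rw [ImpType.lo_imp, List.map_append, List.map_reverse, List.nodup_append,
        List.nodup_reverse] at hn
      have hdisj : Disjoint K {x | ∃ i ∈ A.up, g i = x} := by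
        rw [Set.disjoint_left]
        rintro _ hx ⟨i, hi, rfl⟩
        have := hK i (.inr hi)
        rw [hlo i (.inr hi), Set.disjoint_singleton_right] at this
        exact this hx
      have h1 := ihA.2 {x | ∃ i ∈ A.up, g i = x} (.fvar (g A.hd))
        (fun E h => hE E (.inr (.inl h))) (fun i hi => hlo i (.inr hi))
        (fun i hi => hup i (.inr hi)) hn.2.1
        ⟨trivial, by
          rintro _ rfl
          exact ⟨A.hd, A.hd_mem_up, rfl⟩, fun i hi => by
          rw [hlo i (.inr hi)]
          rintro _ rfl
          exact ⟨i, hi, rfl⟩, fun i hi => by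
          rw [hup i (.inr hi)]
          exact Set.disjoint_empty _⟩ (hE A (.inl rfl)).symm
      have h2 := h.2 _ _ h1 hdisj fun i hi => by
        rw [hlo i (.inl hi), Set.disjoint_singleton_right]
        rintro ⟨j, hj, hji⟩
        refine hn.2.2 _ (List.mem_map_of_mem hi) _ ?_ hji.symm
        simpa using ⟨j, hj, rfl⟩
      have h3 := ihB.1 _ _ (fun E h => hE E (.inr (.inr h))) (fun i hi => hup i (.inl hi))
        (fun i hi => hlo i (.inl hi)) hn.1 h2
      refine (LamTerm.betaEta_lam_app h.1.closed (x := g A.hd) fun hx => ?_).symm.trans (.lam _ h3)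
      exact Set.disjoint_left.1 hdisj (h.1.fv hx) ⟨A.hd, A.hd_mem_up, rfl⟩
    · intro K s hE hup hlo hn hb h
      refine ⟨hb, fun K' u hu h1 h2 => ?_⟩
      have hbu := hb.up
      simp only [ImpType.binders, List.mem_append] at hE
      simp only [ImpType.up_imp, ImpType.lo_imp, List.mem_append, List.mem_reverse] at hup hlo hbu
      rw [ImpType.up_imp, List.map_append, List.map_reverse, List.nodup_append,
        List.nodup_reverse] at hn
      have h3 := ihA.1 _ _ (fun E h => hE E (.inl h)) (fun i hi => hlo i (.inr hi))
        (fun i hi => hup i (.inr hi)) hn.2.1 hu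
      refine ihB.2 _ _ (fun E h => hE E (.inr h)) (fun i hi => hup i (.inl hi))
        (fun i hi => hlo i (.inl hi)) hn.1 ⟨⟨hb.closed, hu.bounded.closed⟩,
          Set.union_subset_union hb.fv hu.bounded.fv, fun i hi =>
          (hbu i (.inl hi)).trans Set.subset_union_left, fun i hi => ?_⟩ ?_
      · rw [hlo i (.inl hi)]
        exact Set.disjoint_empty _
      · exact (B.betaEta_appCanon (.app (.refl s) h3)).trans h

lemma exists_map_eq {α β : Type*} [DecidableEq α] {l : List α} {l' : List β}
    (h : l.length = l'.length) (hl : l.Nodup) (b : β) :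
    ∃ g : α → β, l.map g = l' ∧ ∀ a, g a ∈ b :: l' := by
  refine ⟨fun a => l'.getD (l.idxOf a) b, List.ext_getElem (by simp [h]) fun n h1 h2 => ?_,
    fun a => ?_⟩
  · simp only [List.getElem_map, hl.idxOf_getElem]
    exact List.getD_eq_getElem _ _ h2
  · change l'.getD (l.idxOf a) b ∈ b :: l'
    rw [List.getD_eq_getElem?_getD]
    cases hn : l'[l.idxOf a]? with
    | none => simp
    | some c => simpa using .inr (List.mem_of_getElem? hn)

end Canonical

section Faithfulness

variable {T X Ind : Type*} [DecidableEq X] [DecidableEq Ind]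

lemma LamTerm.subst_word (θ : X → LamTerm X T) (w : List T) (s : LamTerm X T) :
    subst θ (word w s) = word w (subst θ s) := by
  induction w with
  | nil => rfl
  | cons c w ih => exact congrArg (LamTerm.app (.con c)) ih

lemma LamTerm.fv_word (w : List T) (s : LamTerm X T) : (word w s).fv = s.fv := by
  induction w with
  | nil => rfl
  | cons c w ih =>
    change ∅ ∪ (word w s).fv = s.fv
    rw [ih, Set.empty_union]

lemma NetWF.edge_eq {m : Net T Ind} (hm : NetWF m) {w w' : List T} {i i' j : Ind}
    (h : Factor.edge w i j ∈ m) (h' : Factor.edge w' i' j ∈ m) : w = w' ∧ i = i' := by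
  obtain ⟨m, rfl⟩ := Multiset.exists_cons_of_mem h
  rcases Multiset.mem_cons.1 h' with h' | h'
  · cases h'
    exact ⟨rfl, rfl⟩
  · obtain ⟨m, rfl⟩ := Multiset.exists_cons_of_mem h'
    have := (hm j).2
    simp [Factor.sub] at this

/-- The equations given by a net and by the types of the bound and free variables have a
solution. -/
lemma exists_valuation [Infinite X] {m : Net T Ind} (hm : NetWF m) {l : List (ImpType Ind)}
    (hl : (l.map ImpType.hd).Nodup) (hlm : ∀ E ∈ l, csub m E.hd = 0) {g : Ind → X} {Y : List X}
    (hY : Y.Nodup) (hg : ∀ i, g i ∈ Y) :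
    ∃ ρ : Ind → LamTerm X T, (∀ i, (ρ i).ClosedAt 0) ∧ (∀ E ∈ l, Solves ρ g E) ∧
      ∀ w i j, Factor.edge w i j ∈ m → BetaEta (ρ j) (.word w (ρ i)) := by
  classical
  let F : Ind → (Ind → LamTerm X T) → LamTerm X T := fun i ρ =>
    if h : ∃ E ∈ l, E.hd = i then h.choose.appCanon ρ g (.fvar (g i))
    else if h : ∃ p : List T × Ind, Factor.edge p.1 p.2 i ∈ m then
      .word h.choose.1 (ρ h.choose.2)
    else ρ i
  obtain ⟨ρ, h1, h2⟩ := LamTerm.exists_solution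
    (l.map ImpType.hd ++ (m.bind Factor.sub).toList) Y hY F (by
      intro i θ ρ hθ hθ'
      dsimp only [F]
      split
      · rw [ImpType.subst_appCanon (fun j => hθ _ (hg j)) (fun x j => hθ' x _ (hg j)),
          LamTerm.subst, hθ _ (hg i)]
      · split
        · rw [LamTerm.subst_word]
        · rfl) (by
      intro i ρ hρ
      dsimp only [F]
      split
      · exact ImpType.closedAt_appCanon hρ _ trivial
      · split
        · exact (hρ _).word _
        · exact hρ i) (by
      intro i ρ x hx
      dsimp only [F] at hx
      split at hx
      · rcases ImpType.exists_mem_fv_of_appCanon hx with hx | hx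
        · exact .inl ((show x = g i from hx) ▸ hg i)
        · exact .inr hx
      · split at hx
        · rw [LamTerm.fv_word] at hx
          exact .inr ⟨_, hx⟩
        · exact .inr ⟨_, hx⟩)
  refine ⟨ρ, h1, fun E hE => ?_, fun w i j hj => ?_⟩
  · have h3 := h2 E.hd (List.mem_append.2 (.inl (List.mem_map_of_mem hE)))
    have h4 : ∃ E' ∈ l, E'.hd = E.hd := ⟨E, hE, rfl⟩
    dsimp only [F] at h3
    rw [dif_pos h4, List.inj_on_of_nodup_map hl h4.choose_spec.1 hE h4.choose_spec.2] at h3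
    exact h3
  · have hj' : 0 < csub m j := Multiset.count_pos.2
      (Multiset.mem_bind.2 ⟨_, hj, Multiset.mem_singleton_self j⟩)
    have h3 := h2 j (List.mem_append.2 (.inr (by
      rw [Multiset.mem_toList]
      exact Multiset.count_pos.1 hj')))
    have h4 : ¬∃ E ∈ l, E.hd = j := by
      rintro ⟨E, hE, rfl⟩
      rw [hlm E hE] at hj'
      exact lt_irrefl _ hj'
    have h5 : ∃ p : List T × Ind, Factor.edge p.1 p.2 j ∈ m := ⟨(w, i), hj⟩
    dsimp only [F] at h3
    rw [dif_neg h4, dif_pos h5] at h3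
    obtain ⟨h6, h7⟩ := hm.edge_eq h5.choose_spec hj
    rwa [h6, h7] at h3

/-- Variables for the indices of a sequent, those for the target atoms of the types being given. -/
lemma exists_naming [Infinite X] {α : Type*} {l : List α} {E : α → ImpType Ind} {D : ImpType Ind}
    {v : α → X} (hH : (D.lo ++ l.flatMap fun a => (E a).up).Nodup) (hv : (l.map v).Nodup) :
    ∃ (g : Ind → X) (Y : List X), Y.Nodup ∧ (∀ i, g i ∈ Y) ∧ (∀ a ∈ l, g (E a).hd = v a) ∧
      ((D.lo ++ l.flatMap fun a => (E a).up).map g).Nodup := by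
  choose tail htail using fun a => (E a).exists_up_eq
  have hp : (l.map (fun a => (E a).hd) ++ (l.flatMap tail ++ D.lo)).Perm
      (D.lo ++ l.flatMap fun a => (E a).up) := by
    rw [← List.append_assoc]
    refine ((List.map_append_flatMap_perm l _ _).append_right _).trans ?_
    simp only [htail]
    exact List.perm_append_comm
  obtain ⟨V, hV1, hV2, hV3⟩ :=
    exists_fresh_list (l.map v).toFinset (l.flatMap tail ++ D.lo).length
  have hV : (l.map v ++ V).Nodup := by
    rw [List.nodup_append]
    refine ⟨hv, hV2, ?_⟩
    rintro x hx _ hy rfl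
    exact hV3 x hy (List.mem_toFinset.2 hx)
  obtain ⟨g, h1, h2⟩ := exists_map_eq (l' := l.map v ++ V)
    (by simp only [List.length_append, List.length_map, hV1])
    (hp.nodup_iff.2 hH) (Classical.arbitrary X)
  refine ⟨g, (Classical.arbitrary X :: (l.map v ++ V)).dedup, List.nodup_dedup _,
    fun i => List.mem_dedup.2 (h2 i), ?_, ?_⟩
  · rw [List.map_append] at h1
    have h3 := (List.append_inj h1 (by simp)).1
    rw [List.map_map] at h3
    exact List.map_inj_left.1 h3
  · rw [← (hp.map g).nodup_iff, h1]
    exact hV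

/-- All terms with the same translation are equivalent to one term. -/
theorem exists_betaEta_of_translates [Infinite X] {e : TensorTerm T Ind}
    {Δ : Multiset (LinkedAssumption Unit X Ind)} {L : TensorType Unit Ind} {A₀ : ImpType Unit}
    (hv : NetValid (strTranslation T Ind).val e.flat (L ::ₘ links Δ))
    (hnd : (Δ.map LinkedAssumption.var).Nodup) (hL : L.sym = A₀.toSymbol)
    (hΔ : ∀ a ∈ Δ, a.link.sym = a.type.toSymbol.dual) :
    ∃ c : LamTerm X T, ∀ t A, Translates (strLam T) (strTranslation T Ind) Δ t A e L →
      BetaEta t c := by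
  classical
  obtain ⟨D, rfl⟩ := ImpType.exists_deco hL (hv.1 L (by simp))
  have hEx : ∀ a : LinkedAssumption Unit X Ind, ∃ E : ImpType Ind, a ∈ Δ → E.deco.dual = a.link := by
    intro a
    by_cases ha : a ∈ Δ
    · obtain ⟨E, hE⟩ := ImpType.exists_deco (A := a.type) (L := a.link.dual) (by
        rw [TensorType.sym_dual, hΔ a ha, TypeSymbol.dual_dual])
        (TensorType.fits_dual.2 (hv.1 a.link
          (Multiset.mem_cons_of_mem (Multiset.mem_map_of_mem _ ha))))
      exact ⟨E, fun _ => by rw [hE, TensorType.dual_dual]⟩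
    · exact ⟨D, fun h => absurd h ha⟩
  choose E hE using hEx
  have hlinkup : ∀ a ∈ Δ, a.link.up = (E a).lo.reverse := fun a ha => by rw [← hE a ha]; rfl
  have hlinklo : ∀ a ∈ Δ, a.link.lo = (E a).up.reverse := fun a ha => by rw [← hE a ha]; rfl
  obtain ⟨l, rfl⟩ := Quot.exists_rep Δ
  change NetValid _ _ (_ ::ₘ links (l : Multiset (LinkedAssumption Unit X Ind))) at hv
  change ∀ a ∈ l, _ at hE
  change ∀ a ∈ l, _ at hlinkup
  change ∀ a ∈ l, _ at hlinklo
  change (l.map LinkedAssumption.var).Nodup at hnd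
  have hH : ∀ i, (D.lo ++ l.flatMap fun a => (E a).up).count i =
      clo (D.deco ::ₘ links (l : Multiset (LinkedAssumption Unit X Ind))) i := by
    intro i
    rw [clo_cons, List.count_append, ImpType.lo_deco]
    congr 1
    clear hv hE hlinkup hnd hΔ
    induction l with
    | nil => simp [links]
    | cons a l ih =>
      rw [List.flatMap_cons, List.count_append, links, ← Multiset.cons_coe, Multiset.map_cons,
        clo_cons, hlinklo a (by simp), List.count_reverse,
        ih fun b hb => hlinklo b (List.mem_cons_of_mem _ hb)]
  have hHn : (D.lo ++ l.flatMap fun a => (E a).up).Nodup := List.nodup_iff_count_le_one.2 fun i => by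
    have := hv.2 i
    rw [hH]
    omega
  have hsub : ∀ i ∈ D.lo ++ l.flatMap fun a => (E a).up, csub e.flat i = 0 := fun i hi => by
    have := hv.2 i
    rw [← List.count_pos_iff, hH] at hi
    omega
  have hupH : ∀ i, 0 < cup (D.deco ::ₘ links (l : Multiset (LinkedAssumption Unit X Ind))) i →
      i ∉ D.lo ++ l.flatMap fun a => (E a).up := fun i hi hi' => by
    have := hv.2 i
    rw [← List.count_pos_iff, hH] at hi'
    omega
  obtain ⟨g, Y, hY, hgY, hgv, hg⟩ := exists_naming hHn hnd
  have hp : ((D.binders.1 ++ l.flatMap fun a => E a :: (E a).binders.2).map ImpType.hd).Perm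
      (D.lo ++ l.flatMap fun a => (E a).up) := by
    rw [List.map_append, List.map_flatMap]
    exact D.map_hd_binders.1.append (List.Perm.flatMap_left l fun a _ => (E a).map_hd_binders.2)
  obtain ⟨ρ, hρ, hsol, hedge⟩ := exists_valuation (m := e.flat) hv.wf
    (hp.nodup_iff.2 hHn) (fun F hF => hsub _ (hp.mem_iff.1 (List.mem_map_of_mem hF))) hY hgY
  have hinj := List.inj_on_of_nodup_map hg
  have hmem : ∀ a ∈ l, ∀ i ∈ (E a).up, i ∈ D.lo ++ l.flatMap fun a => (E a).up := fun a ha i hi =>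
    List.mem_append_right _ (List.mem_flatMap.2 ⟨a, ha, hi⟩)
  have hmemD : ∀ i ∈ D.lo, i ∈ D.lo ++ l.flatMap fun a => (E a).up := fun i hi =>
    List.mem_append_left _ hi
  let ν : Ind → Set X := fun i => if i ∈ D.lo ++ l.flatMap fun a => (E a).up then {g i} else ∅
  have hν : ∀ i ∈ D.lo ++ l.flatMap fun a => (E a).up, ν i = {g i} := fun i hi => if_pos hi
  have hν' : ∀ i, 0 < cup (D.deco ::ₘ links (l : Multiset (LinkedAssumption Unit X Ind))) i → ν i = ∅ := fun i hi =>
    if_neg (hupH i hi)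
  have hνD : ∀ i ∈ D.up, ν i = ∅ := fun i hi => hν' i
    ((mem_up_iff _ _).1 ⟨_, Multiset.mem_cons_self _ _, hi⟩)
  have hνl : ∀ a ∈ l, ∀ i ∈ a.link.up, ν i = ∅ := fun a ha i hi => hν' i
    ((mem_up_iff _ _).1 ⟨_, Multiset.mem_cons_of_mem (Multiset.mem_map_of_mem _ ha), hi⟩)
  let κ : X → Set X := fun x => {y | ∃ a ∈ l, a.var = x ∧ ∃ i ∈ (E a).up, g i = y}
  have hHn' := List.nodup_append.1 hHn
  have hr : Realization ρ ν .fvar κ (l : Multiset (LinkedAssumption Unit X Ind)) D.deco := by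
    refine ⟨fun x => trivial, hνD, hνl, fun a ha => ?_, ?_, ?_⟩
    · have hup : ∀ i ∈ (E a).up, ν i = {g i} := fun i hi => hν i (hmem a ha i hi)
      have hlo : ∀ i ∈ (E a).lo, ν i = ∅ := fun i hi => hνl a ha i (by
        rw [hlinkup a ha]
        exact List.mem_reverse.2 hi)
      have hs := hsol (E a) (List.mem_append_right _
        (List.mem_flatMap.2 ⟨a, ha, List.mem_cons_self⟩))
      rw [Solves, hgv a ha] at hs
      refine ⟨E a, hE a ha, (Realizes.reify_reflect (E a)).2 _ _ (fun F hF => hsol F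
        (List.mem_append_right _ (List.mem_flatMap.2 ⟨a, ha, List.mem_cons_of_mem _ hF⟩)))
        hup hlo ?_ ⟨trivial, ?_, fun i hi => ?_, fun i hi => ?_⟩ hs.symm⟩
      · exact ((List.nodup_flatMap.1 hHn'.2.1).1 a ha).map_on fun i hi j hj h =>
          hinj (hmem a ha i hi) (hmem a ha j hj) h
      · rintro _ rfl
        exact ⟨a, ha, rfl, _, (E a).hd_mem_up, hgv a ha⟩
      · rw [hup i hi]
        rintro _ rfl
        exact ⟨a, ha, rfl, i, hi, rfl⟩
      · rw [hlo i hi]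
        exact Set.disjoint_empty _
    · intro a _ b _ hab
      rw [Set.disjoint_left]
      rintro _ ⟨a', ha, ha', i, hi, rfl⟩ ⟨b', hb, hb', j, hj, hij⟩
      obtain rfl := hinj (hmem b' hb j hj) (hmem a' ha i hi) hij
      have : Std.Symm (Function.onFun List.Disjoint fun a => (E a).up) :=
        ⟨fun _ _ h => List.Disjoint.symm h⟩
      have := (List.nodup_flatMap.1 hHn'.2.1).2.forall ha hb
        (fun h => hab (by rw [← ha', ← hb', h]))
      exact this hi hj
    · intro a _ i hi
      rw [hν i (hmemD i hi), Set.disjoint_singleton_right]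
      rintro ⟨b, hb, -, j, hj, hij⟩
      obtain rfl := hinj (hmem b hb j hj) (hmemD i hi) hij
      exact hHn'.2.2 _ hi _ (List.mem_flatMap.2 ⟨b, hb, hj⟩) rfl
  refine ⟨D.canon ρ g, fun t A h => ?_⟩
  have := h.realizes ρ ν .fvar κ D hρ (sat_iff.2 hedge) rfl hr
  rw [LamTerm.subst_fvar] at this
  exact (Realizes.reify_reflect D).1 _ _ (fun F hF => hsol F (List.mem_append_left _ hF)) hνD
    (fun i hi => hν i (hmemD i hi)) ((List.map_append ▸ hg).of_append_left) this

end Faithfulness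

section Main

lemma exists_perm_map_eq_of_perm {α β : Type*} {f : α → β} {l : List β} {l' : List α}
    (h : l.Perm (l'.map f)) : ∃ k : List α, k.Perm l' ∧ k.map f = l := by
  induction l generalizing l' with
  | nil =>
    rw [List.nil_perm, List.map_eq_nil_iff] at h
    exact ⟨[], by rw [h], rfl⟩
  | cons b l ih =>
    obtain ⟨a, ha, rfl⟩ := List.mem_map.1 (h.mem_iff.1 List.mem_cons_self)
    obtain ⟨l₁, l₂, rfl⟩ := List.append_of_mem ha
    have h1 := h.trans (List.perm_middle.map f)
    obtain ⟨k, hk, rfl⟩ := ih (l' := l₁ ++ l₂) (List.perm_cons _ |>.1 h1)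
    exact ⟨a :: k, (hk.cons a).trans List.perm_middle.symm, rfl⟩

namespace StringACG

variable {P C T X Ind : Type*} [DecidableEq X] [DecidableEq Ind] (G : StringACG P C T X)

theorem exists_rename_of_translatesTo [Infinite X] {π : TensorJudgement P T Ind}
    {Δ₁ Δ₂ : Multiset (LinkedAssumption P X Ind)} {t₁ t₂ : LamTerm X C} {A₁ A₂ : ImpType P}
    (h₁ : TranslatesTo G.abstractSig (G.translation Ind) Δ₁ t₁ A₁ π)
    (h₂ : TranslatesTo G.abstractSig (G.translation Ind) Δ₂ t₂ A₂ π) :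
    A₁ = A₂ ∧ ∃ r : Equiv.Perm X, Δ₂ = Δ₁.map (LinkedAssumption.rename r) ∧
      BetaEta ((G.onTerm t₁).rename r) (G.onTerm t₂) := by
  obtain ⟨L₁, tr₁, e₁⟩ := h₁
  obtain ⟨L₂, tr₂, e₂⟩ := h₂
  obtain ⟨-, n₁, s₁, k₁⟩ := tr₁.invariants
  obtain ⟨-, n₂, s₂, k₂⟩ := tr₂.invariants
  obtain ⟨rfl, hlinks⟩ := exists_of_pos (e₁.symm.trans e₂) ⟨A₁, s₁⟩ k₂
  obtain rfl := ImpType.toSymbol_injective (s₁.symm.trans s₂)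
  refine ⟨rfl, ?_⟩
  have hr : ∃ r : Equiv.Perm X, Δ₂ = Δ₁.map (LinkedAssumption.rename r) := by
    clear tr₁ tr₂ e₁ e₂
    obtain ⟨l₁, rfl⟩ := Quot.exists_rep Δ₁
    obtain ⟨l₂, rfl⟩ := Quot.exists_rep Δ₂
    obtain ⟨l, hl, hl'⟩ := exists_perm_map_eq_of_perm (Multiset.coe_eq_coe.1 hlinks)
    have hn : (l.map LinkedAssumption.var).Nodup := (hl.map _).nodup_iff.2 n₂
    obtain ⟨r, hr⟩ := exists_perm_map_eq (l₁.map LinkedAssumption.var) (l.map LinkedAssumption.var)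
      (by rw [List.length_map, List.length_map, ← List.length_map (f := LinkedAssumption.link), ← hl',
        List.length_map]) n₁ hn
    refine ⟨r, Multiset.coe_eq_coe.2 (hl.symm.trans (.of_eq ?_))⟩
    have k₂' : ∀ a ∈ l, a.link.sym = a.type.toSymbol.dual := fun a ha => k₂ a (hl.mem_iff.1 ha)
    have k₁' : ∀ a ∈ l₁, a.link.sym = a.type.toSymbol.dual := k₁
    clear n₁ n₂ k₁ k₂ hn hl hlinks
    induction l generalizing l₁ with
    | nil =>
      rw [List.map_nil, eq_comm, List.map_eq_nil_iff] at hl'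
      rw [hl']
      rfl
    | cons a l ih =>
      cases l₁ with
      | nil => simp at hl'
      | cons b l₁ =>
        simp only [List.map_cons, List.cons.injEq, List.mem_cons, forall_eq_or_imp] at *
        refine ⟨?_, ih l₁ hl'.2 hr.2 k₂'.2 k₁'.2⟩
        have ht : a.type = b.type := ImpType.toSymbol_injective
          (TypeSymbol.dual_injective (by rw [← k₂'.1, ← k₁'.1, hl'.1]))
        rw [LinkedAssumption.rename, hr.1, ← ht, ← hl'.1]
  obtain ⟨r, rfl⟩ := hr
  refine ⟨r, rfl, ?_⟩
  have tr₁' := (G.translates_onTerm tr₁).rename r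
  have tr₂' := G.translates_onTerm tr₂
  obtain ⟨hv, hn, hs, hk⟩ := tr₂'.invariants
  obtain ⟨c, hc⟩ := exists_betaEta_of_translates hv hn hs hk
  rw [Multiset.map_map] at tr₁' tr₂'
  rw [Multiset.map_map] at hc
  exact (hc _ _ tr₁').trans (hc _ _ tr₂').symm

end StringACG

end Main

end StringACGTensor

theorem mainTheorem1 {P C T X Ind : Type*} [DecidableEq X] [Infinite X] [DecidableEq Ind]
    [Infinite Ind] (G : StringACGTensor.StringACG P C T X)
    (π : StringACGTensor.TensorJudgement P T Ind)
    (hπ : π.Valid G.val) (hpol : StringACGTensor.Polarized π.sequent) :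
    (StringACGTensor.TensorDer (G.translation Ind).signature π.term π.sequent ↔
      ∃ (Δ : Multiset (StringACGTensor.LinkedAssumption P X Ind))
        (t : StringACGTensor.LamTerm X C) (A : StringACGTensor.ImpType P),
        StringACGTensor.LamDer G.abstractSig
          (Δ.map StringACGTensor.LinkedAssumption.assumption) t A ∧
        StringACGTensor.TranslatesTo G.abstractSig (G.translation Ind) Δ t A π ∧
        StringACGTensor.TranslatesTo (StringACGTensor.strLam T)
          (StringACGTensor.strTranslation T Ind) (Δ.map G.onAssumption) (G.onTerm t)
          (G.lexicon.onType A) (G.onTensorJudgement π)) ∧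
    (∀ (Δ₁ Δ₂ : Multiset (StringACGTensor.LinkedAssumption P X Ind))
      (t₁ t₂ : StringACGTensor.LamTerm X C) (A₁ A₂ : StringACGTensor.ImpType P),
      StringACGTensor.TranslatesTo G.abstractSig (G.translation Ind) Δ₁ t₁ A₁ π →
      StringACGTensor.TranslatesTo G.abstractSig (G.translation Ind) Δ₂ t₂ A₂ π →
      A₁ = A₂ ∧ ∃ r : Equiv.Perm X,
        Δ₂ = Δ₁.map (StringACGTensor.LinkedAssumption.rename r) ∧
        StringACGTensor.LamTerm.BetaEta ((G.onTerm t₁).rename r) (G.onTerm t₂)) := by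
  exact ⟨G.tensorDer_iff hpol, fun _ _ _ _ _ _ => G.exists_rename_of_translatesTo⟩
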